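/- Let $K=\mathbb F_2(z)$ and let $Q=[z,1+z^3)$ be the quaternion algebra over $K$ with $K$-basis $1,I,J,IJ$ and relations $I^2=I+z$, $J^2=1+z^3$, $JI=(I+1)J$. Let $G(K)=Q^\times/K^\times$, let $R_1=\mathbb F_2[z,\frac1{z(1+z)}]$ and $\mathfrak O_1=R_1\oplus R_1I\oplus R_1J\oplus R_1IJ$, and let $G(R_1)$ be the image of $\mathfrak O_1^\times$ in $G(K)$. Let $b_1,b_2,c_1,c_2\in G(K)$ be the classes of $$(1+z)I+J,\qquad z+z^2+(1+z)I+J+IJ,\qquad 1+z^2+IJ,\qquad z+z^2+IJ,$$ and put $\Lambda=\langle b_1,b_2,c_1,c_2\rangle$, $a_1=c_1b_1^{-1}$, $a_2=c_2b_2^{-1}$, $\Gamma=\langle a_1,a_2\rangle$, $\mathcal A=\{b_1,b_1^{-1},c_1\}$, $\mathcal B=\{b_2,b_2^{-1},c_2\}$. The completions of $K$ at $z=0$ and $z=\infty$ are $\mathbb F_2((y))$ with $y^2+y=z$ and $\mathbb F_2((t))$ with $t^2+t=u:=z^{-1}$. The algebra $Q$ splits there, by $$I\mapsto\begin{pmatrix}y&0\\0&1+y\end{pmatrix},\quad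 J\mapsto\begin{pmatrix}0&1+z^3\\1&0\end{pmatrix}\qquad\text{and}\qquad I\mapsto\begin{pmatrix}1+u+t&1+u^3\\u^{-1}&u+t\end{pmatrix},\quad J\mapsto\begin{pmatrix}0&u^{-1}+u^2\\u^{-2}&0\end{pmatrix}$$ respectively. These splittings give homomorphisms from $G(K)$ to $\mathrm{PGL}_2(\mathbb F_2((y)))$ and $\mathrm{PGL}_2(\mathbb F_2((t)))$, and hence an action of $G(K)$ on the product $T_0\times T_\infty$ of the two Bruhat–Tits trees (vertices: homothety classes of lattices in the plane; edges: classes having representatives $M\supsetneq N\supsetneq\pi M$, with $\pi$ a uniformizer). Then: 1. $T_0$ and $T_\infty$ are trees of constant valency $3$, on which the groups $\mathrm{PGL}_2$ act by automorphisms. We have $\Lambda=G(R_1)$, and $\Lambda$ embeds diagonally as a discrete cocompact subgroup of $\mathrm{PGL}_2(\mathbb F_2((y)))\times\mathrm{PGL}_2(\mathbb F_2((t)))$. It acts simply transitively on the vertices of $T_0\times T_\infty\cong T_3\times T_3$. 2. $\Lambda=\langle b_1,b_2,c_1,c_2\mid c_1^2,\ c_2^2,\ c_1c_2=c_2c_1,\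 b_1b_2c_1b_2,\ b_1c_2b_1b_2^{-1}\rangle$. 3. $(\mathcal A,\mathcal B)$ is a $V_4$-structure of $\Lambda$: both sets are finite and closed under inversion, together they generate $\Lambda$, $\mathcal A\mathcal B=\mathcal B\mathcal A$, and $(a,b)\mapsto ab$ and $(a,b)\mapsto ba$ are bijections $\mathcal A\times\mathcal B\to\mathcal A\mathcal B$. Let $\Sigma$ be the associated square complex: it has the vertices $s_{ij}$ ($i,j\in\{0,1\}$), an edge $(a,i)$ from $s_{i0}$ to $s_{i1}$ for $a\in\mathcal A$ and $i\in\{0,1\}$, an edge $(b,j)$ from $s_{0j}$ to $s_{1j}$ for $b\in\mathcal B$ and $j\in\{0,1\}$, and for all $a,a'\in\mathcal A$, $b,b'\in\mathcal B$ with $ab'=ba'$ a square $[a,b';b,a']$, glued along the closed path $(a,0),(b',1),\overline{(a',1)},\overline{(b,0)}$. It has $4$ vertices, $12$ edges and $9$ squares. The group $V_4=\langle\gamma_v,\gamma_h\rangle\cong(\mathbb Z/2)^2$ acts on $\Sigma$: $\gamma_v$ interchanges $s_{ij}$ with $s_{i(1-j)}$, $(a,i)$ with $\overline{(a^{-1},i)}$,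 $(b,0)$ with $(b,1)$, and $[a,b';b,a']$ with $[a^{-1},b;b',a'^{-1}]$; $\gamma_h$ interchanges $s_{ij}$ with $s_{(1-i)j}$, $(a,0)$ with $(a,1)$, $(b,j)$ with $\overline{(b^{-1},j)}$, and $[a,b';b,a']$ with $[a',b'^{-1};b^{-1},a]$. Let $\pi_1^{\rm orb}(\Sigma,V_4,s_{00})$ be the orbispace fundamental group, which consists of the pairs $[\alpha;g]$ of an element $g\in V_4$ and a homotopy class $\alpha$ of paths in $\Sigma$ from $s_{00}$ to $gs_{00}$, with the product $[\alpha;g][\beta;h]=[\alpha*g\beta;gh]$. Then there is an isomorphism $\varphi:\pi_1^{\rm orb}(\Sigma,V_4,s_{00})\to\Lambda$ with $\varphi([(a,0);\gamma_v])=a$ for $a\in\mathcal A$ and $\varphi([(b,0);\gamma_h])=b$ for $b\in\mathcal B$. 4. $\Gamma$ is a torsion-free normal subgroup of $\Lambda$ with $\Lambda/\Gamma\cong V_4$. It is the fundamental group of $\Sigma$: an element $[\alpha;g]$ is mapped to $\Gamma$ by $\varphi$ if and only if $g=1$, and $\alpha\mapsto\varphi([\alpha;1])$ is an isomorphism $\pi_1(\Sigma,s_{00})\to\Gamma$.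 Moreover $$\Gamma=\langle a_1,a_2\mid a_2a_1^{-1}a_2^2a_1a_2a_1a_2^2a_1^{-1}a_2a_1,\ a_1a_2^2a_1^{-1}a_2^2a_1^{-1}a_2^2a_1a_2a_1^{-1}a_2\rangle.$$ -/

import Mathlib

open scoped Pointwise MatrixGroups unitInterval

noncomputable section

namespace QuaternionLattice

/-! ### The quaternion algebra -/

/-- The field with two elements. -/
abbrev F2 : Type := ZMod 2

/-- The rational function field `𝔽₂(z)`; the variable `z` is `RatFunc.X`. -/
abbrev K : Type := RatFunc F2

/-- The variable `z`. -/
abbrev z : K := RatFunc.X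

/-- The quaternion algebra `[z, 1 + z³)` over `𝔽₂(z)`: it has the basis `1, I, J, I J` with
`I² = z + I`, `J² = 1 + z³` and `J I = J - I J = (I + 1) J`. -/
abbrev Q : Type := QuaternionAlgebra K z 1 (1 + z ^ 3)

/-- The subgroup `Kˣ` of `Qˣ`. -/
def scalars : Subgroup Qˣ := (Units.map (algebraMap K Q : K →* Q)).range

instance scalars_normal : scalars.Normal := by
  refine ⟨?_⟩
  rintro _ ⟨c, rfl⟩ g
  refine ⟨c, Units.ext ?_⟩
  have h : algebraMap K Q (c : K) * (g : Q) = (g : Q) * algebraMap K Q (c : K) :=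
    Algebra.commutes _ _
  change algebraMap K Q (c : K) = (g : Q) * algebraMap K Q (c : K) * ((g⁻¹ : Qˣ) : Q)
  rw [← h, mul_assoc, Units.mul_inv, mul_one]

/-- `G(K) = PGL₁(Q) = Qˣ / Kˣ`. -/
abbrev GK : Type := Qˣ ⧸ scalars

/-- The ring `R₁ = 𝔽₂[z, 1 / (z (1 + z))]`. -/
def R1 : Subalgebra F2 K := Algebra.adjoin F2 {z, (z * (1 + z))⁻¹}

theorem z_mem_R1 : z ∈ R1 := Algebra.subset_adjoin (by simp)

/-- The order `𝔒₁ = R₁ ⊕ R₁ I ⊕ R₁ J ⊕ R₁ I J` of `Q`. -/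
def O1 : Subring Q where
  carrier := {q | q.re ∈ R1 ∧ q.imI ∈ R1 ∧ q.imJ ∈ R1 ∧ q.imK ∈ R1}
  mul_mem' := by
    rintro p q ⟨h1, h2, h3, h4⟩ ⟨k1, k2, k3, k4⟩
    have hz := z_mem_R1
    have hN : (1 + z ^ 3 : K) ∈ R1 := add_mem (one_mem _) (pow_mem hz 3)
    simp only [Set.mem_ofPred_eq, QuaternionAlgebra.re_mul, QuaternionAlgebra.imI_mul,
      QuaternionAlgebra.imJ_mul, QuaternionAlgebra.imK_mul, one_mul]
    refine ⟨?_, ?_, ?_, ?_⟩ <;>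
    repeat first
      | assumption
      | apply sub_mem
      | apply add_mem
      | apply mul_mem
  one_mem' := by simp [one_mem, zero_mem]
  add_mem' := by
    rintro p q ⟨h1, h2, h3, h4⟩ ⟨k1, k2, k3, k4⟩
    exact ⟨add_mem h1 k1, add_mem h2 k2, add_mem h3 k3, add_mem h4 k4⟩
  zero_mem' := by simp [zero_mem]
  neg_mem' := by
    rintro p ⟨h1, h2, h3, h4⟩
    exact ⟨neg_mem h1, neg_mem h2, neg_mem h3, neg_mem h4⟩

/-- `G(R₁)`: the image of `𝔒₁ˣ` in `Qˣ / Kˣ`. -/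
def GR1 : Subgroup GK := (O1.toSubmonoid.units).map (QuotientGroup.mk' scalars)

/-- The class in `Qˣ / Kˣ` of a quaternion whose reduced norm `q q̄` is nonzero. -/
def toGK (q : Q) (h : (q * star q).re ≠ 0) : GK :=
  QuotientGroup.mk' scalars
    { val := q
      inv := (q * star q).re⁻¹ • star q
      val_inv := by
        rw [mul_smul_comm, q.mul_star_eq_coe, QuaternionAlgebra.re_coe, ← QuaternionAlgebra.coe_smul,
          smul_eq_mul, inv_mul_cancel₀ h, QuaternionAlgebra.coe_one]
      inv_val := by
        rw [smul_mul_assoc, star_comm_self', q.mul_star_eq_coe, QuaternionAlgebra.re_coe,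
          ← QuaternionAlgebra.coe_smul, smul_eq_mul, inv_mul_cancel₀ h, QuaternionAlgebra.coe_one] }

theorem two_eq_zero_K : (2 : K) = 0 := by
  have h := CharP.cast_eq_zero K 2
  exact_mod_cast h

theorem z_ne_zero : z ≠ 0 := RatFunc.X_ne_zero

theorem one_add_z_ne_zero : 1 + z ≠ 0 := by
  intro h
  have h' : algebraMap (Polynomial F2) K (Polynomial.X + Polynomial.C 1) = 0 := by
    simpa [add_comm] using h
  rw [map_eq_zero_iff _ (RatFunc.algebraMap_injective F2)] at h'
  exact Polynomial.X_add_C_ne_zero 1 h'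

/-- `B₁ = (1 + z) I + J`. -/
def B1 : Q := ⟨0, 1 + z, 1, 0⟩

/-- `B₂ = z + z² + (1 + z) I + J + I J`. -/
def B2 : Q := ⟨z + z ^ 2, 1 + z, 1, 1⟩

/-- `C₁ = 1 + z² + I J`. -/
def C1 : Q := ⟨1 + z ^ 2, 0, 0, 1⟩

/-- `C₂ = z + z² + I J`. -/
def C2 : Q := ⟨z + z ^ 2, 0, 0, 1⟩

theorem norm_B1 : (B1 * star B1).re = 1 + z := by
  simp only [B1, QuaternionAlgebra.re_mul, QuaternionAlgebra.re_star,
    QuaternionAlgebra.imI_star, QuaternionAlgebra.imJ_star, QuaternionAlgebra.imK_star]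
  linear_combination (-1 - z - z ^ 2 - z ^ 3) * two_eq_zero_K

theorem norm_B2 : (B2 * star B2).re = z * (1 + z) := by
  simp only [B2, QuaternionAlgebra.re_mul, QuaternionAlgebra.re_star,
    QuaternionAlgebra.imI_star, QuaternionAlgebra.imJ_star, QuaternionAlgebra.imK_star]
  linear_combination (-1 + z ^ 4) * two_eq_zero_K

theorem norm_C1 : (C1 * star C1).re = 1 + z := by
  simp only [C1, QuaternionAlgebra.re_mul, QuaternionAlgebra.re_star,
    QuaternionAlgebra.imI_star, QuaternionAlgebra.imJ_star, QuaternionAlgebra.imK_star]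
  linear_combination (z ^ 2 + z ^ 4) * two_eq_zero_K

theorem norm_C2 : (C2 * star C2).re = z * (1 + z) := by
  simp only [C2, QuaternionAlgebra.re_mul, QuaternionAlgebra.re_star,
    QuaternionAlgebra.imI_star, QuaternionAlgebra.imJ_star, QuaternionAlgebra.imK_star]
  linear_combination (z ^ 3 + z ^ 4) * two_eq_zero_K

/-- The class of `B₁`. -/
def b1 : GK := toGK B1 (by rw [norm_B1]; exact one_add_z_ne_zero)

/-- The class of `B₂`. -/
def b2 : GK := toGK B2 (by rw [norm_B2]; exact mul_ne_zero z_ne_zero one_add_z_ne_zero)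

/-- The class of `C₁`. -/
def c1 : GK := toGK C1 (by rw [norm_C1]; exact one_add_z_ne_zero)

/-- The class of `C₂`. -/
def c2 : GK := toGK C2 (by rw [norm_C2]; exact mul_ne_zero z_ne_zero one_add_z_ne_zero)

/-- The group `Λ = ⟨b₁, b₂, c₁, c₂⟩`. -/
def Lam : Subgroup GK := Subgroup.closure {b1, b2, c1, c2}

/-- `b₁` as an element of `Λ`. -/
def b1L : Lam := ⟨b1, Subgroup.subset_closure (by simp)⟩

/-- `b₂` as an element of `Λ`. -/
def b2L : Lam := ⟨b2, Subgroup.subset_closure (by simp)⟩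

/-- `c₁` as an element of `Λ`. -/
def c1L : Lam := ⟨c1, Subgroup.subset_closure (by simp)⟩

/-- `c₂` as an element of `Λ`. -/
def c2L : Lam := ⟨c2, Subgroup.subset_closure (by simp)⟩

/-- `a₁ = c₁ b₁⁻¹`. -/
def a1 : Lam := c1L * b1L⁻¹

/-- `a₂ = c₂ b₂⁻¹`. -/
def a2 : Lam := c2L * b2L⁻¹

/-- The group `Γ = ⟨a₁, a₂⟩`. -/
def Gam : Subgroup Lam := Subgroup.closure {a1, a2}

/-- `a₁` as an element of `Γ`. -/
def a1G : Gam := ⟨a1, Subgroup.subset_closure (by simp)⟩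

/-- `a₂` as an element of `Γ`. -/
def a2G : Gam := ⟨a2, Subgroup.subset_closure (by simp)⟩

/-- The relators
`c₁², c₂², c₁ c₂ (c₂ c₁)⁻¹, b₁ b₂ c₁ b₂, b₁ c₂ b₁ b₂⁻¹` in the free group on `b₁, b₂, c₁, c₂`. -/
def relsLam : Set (FreeGroup (Fin 4)) :=
  let b₁ := FreeGroup.of 0
  let b₂ := FreeGroup.of 1
  let c₁ := FreeGroup.of 2
  let c₂ := FreeGroup.of 3
  {c₁ ^ 2, c₂ ^ 2, c₁ * c₂ * (c₂ * c₁)⁻¹, b₁ * b₂ * c₁ * b₂, b₁ * c₂ * b₁ * b₂⁻¹}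

/-- The two relators of `Γ` in the free group on `a₁, a₂`. -/
def relsGam : Set (FreeGroup (Fin 2)) :=
  let a₁ := FreeGroup.of 0
  let a₂ := FreeGroup.of 1
  {a₂ * a₁⁻¹ * a₂ ^ 2 * a₁ * a₂ * a₁ * a₂ ^ 2 * a₁⁻¹ * a₂ * a₁,
    a₁ * a₂ ^ 2 * a₁⁻¹ * a₂ ^ 2 * a₁⁻¹ * a₂ ^ 2 * a₁ * a₂ * a₁⁻¹ * a₂}

/-! ### The two splittings and the Bruhat–Tits action -/

/-- The field `𝔽₂((x))` of Laurent series. -/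
abbrev L : Type := LaurentSeries F2

/-- The valuation ring `𝔽₂[[x]]`. -/
abbrev O : Type := PowerSeries F2

/-- The variable `x` of `𝔽₂((x))`. -/
def x : L := HahnSeries.single 1 1

theorem x_ne_zero : x ≠ 0 := by simp [x]

theorem transcendental_x : Transcendental F2 x := by
  have h : (Polynomial.aeval x : Polynomial F2 →ₐ[F2] L).toRingHom
      = algebraMap (Polynomial F2) L := by
    refine Polynomial.ringHom_ext' (Subsingleton.elim _ _) ?_
    simp [x]
  rw [transcendental_iff_injective]
  intro p q hpq
  exact Polynomial.algebraMap_hahnSeries_injective ℤ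
    ((RingHom.congr_fun h p).symm.trans (hpq.trans (RingHom.congr_fun h q)))

theorem transcendental_sq_add : Transcendental F2 (x ^ 2 + x) := by
  have hd : (Polynomial.X ^ 2 + Polynomial.X : Polynomial F2).natDegree = 2 := by
    compute_degree!
  have hm : (Polynomial.X ^ 2 + Polynomial.X : Polynomial F2).leadingCoeff = 1 := by
    rw [Polynomial.leadingCoeff, hd]
    simp [Polynomial.coeff_X]
  have h := transcendental_x.aeval (Polynomial.X ^ 2 + Polynomial.X) (by rw [hd]; norm_num)
    (by rw [hm]; exact one_mem _)
  simpa using h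

/-- The field homomorphism `𝔽₂(z) → 𝔽₂((x))` that sends `z` to a given transcendental element. -/
def subst (s : L) (hs : Transcendental F2 s) : K →+* L :=
  RatFunc.liftRingHom (Polynomial.aeval s : Polynomial F2 →ₐ[F2] L).toRingHom <| by
    intro p hp
    rw [mem_nonZeroDivisors_iff_ne_zero] at hp
    rw [Submonoid.mem_comap, mem_nonZeroDivisors_iff_ne_zero]
    intro h
    exact hp ((map_eq_zero_iff _ (transcendental_iff_injective.mp hs)).mp h)

theorem subst_z (s : L) (hs : Transcendental F2 s) : subst s hs z = s := by
  simp [subst, RatFunc.liftRingHom_X]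

/-- The ring homomorphism `Q → M₂(𝔽₂((x)))` that extends a homomorphism `φ : 𝔽₂(z) → 𝔽₂((x))` and
sends `I` and `J` to given matrices which satisfy the defining relations of `Q`. -/
def liftQ (φ : K →+* L) (MI MJ : Matrix (Fin 2) (Fin 2) L)
    (hI : MI * MI = φ z • (1 : Matrix (Fin 2) (Fin 2) L) + MI)
    (hJ : MJ * MJ = φ (1 + z ^ 3) • (1 : Matrix (Fin 2) (Fin 2) L))
    (hJI : MJ * MI = MJ - MI * MJ) : Q →+* Matrix (Fin 2) (Fin 2) L :=
  letI : Algebra K L := φ.toAlgebra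
  (QuaternionAlgebra.Basis.liftHom (R := K) (A := Matrix (Fin 2) (Fin 2) L)
    { i := MI
      j := MJ
      k := MI * MJ
      i_mul_i := by rw [one_smul]; exact hI
      j_mul_j := hJ
      i_mul_j := rfl
      j_mul_i := by rw [one_smul]; exact hJI }).toRingHom

/-- The embedding of `𝔽₂(z)` into its completion `𝔽₂((y))` at `z = 0`, where `y² + y = z`. -/
def phi0 : K →+* L := subst (x ^ 2 + x) transcendental_sq_add

theorem phi0_z : phi0 z = x ^ 2 + x := subst_z _ _

/-- The embedding of `𝔽₂(z)` into its completion `𝔽₂((t))` at `z = ∞`, where `t² + t = z⁻¹`. -/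
def phiInf : K →+* L :=
  subst (x ^ 2 + x)⁻¹ (fun h => transcendental_sq_add (IsAlgebraic.inv_iff.mp h))

theorem phiInf_z : phiInf z = (x ^ 2 + x)⁻¹ := subst_z _ _

theorem two_eq_zero_L : (2 : L) = 0 := by
  have h := congrArg phi0 two_eq_zero_K
  rw [map_zero, map_ofNat] at h
  exact h

theorem sq_add_ne_zero : x ^ 2 + x ≠ 0 := by
  intro h
  exact transcendental_sq_add (h ▸ isAlgebraic_zero)

theorem rho0_aux {F : Type*} [Field F] (h2 : (2 : F) = 0) (y n : F) :
    let MI : Matrix (Fin 2) (Fin 2) F := !![y, 0; 0, 1 + y]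
    let MJ : Matrix (Fin 2) (Fin 2) F := !![0, n; 1, 0]
    MI * MI = (y ^ 2 + y) • (1 : Matrix (Fin 2) (Fin 2) F) + MI ∧
      MJ * MJ = n • (1 : Matrix (Fin 2) (Fin 2) F) ∧ MJ * MI = MJ - MI * MJ := by
  refine ⟨?_, ?_, ?_⟩
  · ext i j
    fin_cases i <;> fin_cases j <;> simp [Matrix.mul_apply, Fin.sum_univ_two]
    · linear_combination -y * h2
    · ring
  · ext i j
    fin_cases i <;> fin_cases j <;> simp [Matrix.mul_apply, Fin.sum_univ_two]
  · ext i j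
    fin_cases i <;> fin_cases j <;> simp [Matrix.mul_apply, Fin.sum_univ_two]
    · linear_combination y * n * h2
    · linear_combination y * h2

theorem rhoInf_aux {F : Type*} [Field F] (h2 : (2 : F) = 0) {t u v : F} (hu : u = t ^ 2 + t)
    (hv : u * v = 1) :
    let MI : Matrix (Fin 2) (Fin 2) F := !![1 + u + t, 1 + u ^ 3; v, u + t]
    let MJ : Matrix (Fin 2) (Fin 2) F := !![0, v + u ^ 2; v ^ 2, 0]
    MI * MI = v • (1 : Matrix (Fin 2) (Fin 2) F) + MI ∧
      MJ * MJ = (1 + v ^ 3) • (1 : Matrix (Fin 2) (Fin 2) F) ∧ MJ * MI = MJ - MI * MJ := by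
  refine ⟨?_, ?_, ?_⟩
  · ext i j
    fin_cases i <;> fin_cases j <;> simp [Matrix.mul_apply, Fin.sum_univ_two]
    · linear_combination (u ^ 2 + u * t + u) * h2 + u ^ 2 * hv - hu
    · linear_combination (1 + u ^ 3) * (u + t) * h2
    · linear_combination v * (u + t) * h2
    · linear_combination (u ^ 2 + u * t - t) * h2 + u ^ 2 * hv - hu
  · ext i j
    fin_cases i <;> fin_cases j <;> simp [Matrix.mul_apply, Fin.sum_univ_two]
    · linear_combination (u * v + 1) * hv
    · linear_combination (u * v + 1) * hv
  · ext i j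
    fin_cases i <;> fin_cases j <;> simp [Matrix.mul_apply, Fin.sum_univ_two]
    · linear_combination -(u ^ 2 * v) * hv + (1 + u ^ 3) * v ^ 2 * h2
    · linear_combination (v + u ^ 2) * (u + t) * h2
    · linear_combination v ^ 2 * (u + t) * h2
    · linear_combination u ^ 2 * v * hv + v * (v + u ^ 2) * h2

/-- The splitting `Q → M₂(𝔽₂((y)))` at the place `z = 0`, where `y² + y = z`. -/
def rho0 : Q →+* Matrix (Fin 2) (Fin 2) L :=
  let y := x
  liftQ phi0 !![y, 0; 0, 1 + y] !![0, phi0 (1 + z ^ 3); 1, 0]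
    (by rw [phi0_z]; exact (rho0_aux two_eq_zero_L x 0).1)
    (rho0_aux two_eq_zero_L x _).2.1
    (rho0_aux two_eq_zero_L x _).2.2

/-- The splitting `Q → M₂(𝔽₂((t)))` at the place `z = ∞`, where `t² + t = u = z⁻¹`. -/
def rhoInf : Q →+* Matrix (Fin 2) (Fin 2) L :=
  let t := x
  let u := x ^ 2 + x
  liftQ phiInf !![1 + u + t, 1 + u ^ 3; u⁻¹, u + t] !![0, u⁻¹ + u ^ 2; u⁻¹ ^ 2, 0]
    (by
      rw [phiInf_z]
      exact (rhoInf_aux two_eq_zero_L rfl (mul_inv_cancel₀ sq_add_ne_zero)).1)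
    (by
      rw [map_add, map_one, map_pow, phiInf_z]
      exact (rhoInf_aux two_eq_zero_L rfl (mul_inv_cancel₀ sq_add_ne_zero)).2.1)
    (rhoInf_aux two_eq_zero_L rfl (mul_inv_cancel₀ sq_add_ne_zero)).2.2

/-- The homomorphism `Qˣ / Kˣ → PGL₂(𝔽₂((x)))` induced by a homomorphism `Q → M₂(𝔽₂((x)))` which
sends `K` to scalar matrices. -/
def toPGL (ρ : Q →+* Matrix (Fin 2) (Fin 2) L)
    (h : ∀ c : K, ∃ d : L, ρ (algebraMap K Q c) = Matrix.scalar (Fin 2) d) : GK →* PGL(2, L) :=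
  QuotientGroup.lift scalars (Matrix.ProjGenLinGroup.mk.comp (Units.map (ρ : Q →* _))) <| by
    rintro _ ⟨c, rfl⟩
    obtain ⟨d, hd⟩ := h c
    change Matrix.ProjGenLinGroup.mk _ = 1
    rw [Matrix.ProjGenLinGroup.mk_eq_one, Subgroup.mem_center_iff]
    intro g
    refine Units.ext ?_
    change (g : Matrix (Fin 2) (Fin 2) L) * ρ (algebraMap K Q c)
      = ρ (algebraMap K Q c) * (g : Matrix (Fin 2) (Fin 2) L)
    rw [hd]
    exact (Matrix.scalar_commute d (fun r => mul_comm _ _) _).symm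

theorem liftQ_algebraMap (φ MI MJ hI hJ hJI) (c : K) :
    liftQ φ MI MJ hI hJ hJI (algebraMap K Q c) = Matrix.scalar (Fin 2) (φ c) := by
  let : Algebra K L := φ.toAlgebra
  exact AlgHom.commutes (QuaternionAlgebra.Basis.liftHom (R := K) (A := Matrix (Fin 2) (Fin 2) L)
    (c₁ := z) (c₂ := 1) (c₃ := 1 + z ^ 3) _) c

/-- The embedding `G(K) → PGL₂(𝔽₂((y))) ≅ G(K₀)`. -/
def pgl0 : GK →* PGL(2, L) := toPGL rho0 fun c => ⟨phi0 c, by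
  unfold rho0
  exact liftQ_algebraMap _ _ _ _ _ _ c⟩

/-- The embedding `G(K) → PGL₂(𝔽₂((t))) ≅ G(K_∞)`. -/
def pglInf : GK →* PGL(2, L) := toPGL rhoInf fun c => ⟨phiInf c, by
  unfold rhoInf
  exact liftQ_algebraMap _ _ _ _ _ _ c⟩

/-- The diagonal embedding of `Λ` in `PGL₂(𝔽₂((y))) × PGL₂(𝔽₂((t)))`. -/
def diag : Lam →* PGL(2, L) × PGL(2, L) := (pgl0.prod pglInf).comp Lam.subtype

/-- `PGL₂(𝔽₂((x)))` carries the quotient topology of `GL₂(𝔽₂((x)))`, where `𝔽₂((x))` carries its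
valuation topology. -/
instance : TopologicalSpace PGL(2, L) :=
  inferInstanceAs (TopologicalSpace (GL (Fin 2) L ⧸ Subgroup.center (GL (Fin 2) L)))

/-- The `𝔽₂[[x]]`-lattices in `𝔽₂((x))²`: finitely generated submodules that span the plane. -/
@[ext]
structure Lattice2 : Type where
  /-- The underlying submodule. -/
  mod : Submodule O (Fin 2 → L)
  isLattice : Submodule.IsLattice L mod

/-- Left multiplication by `g ∈ GL₂` as an `𝔽₂[[x]]`-linear map. -/
def glMap (g : GL (Fin 2) L) : (Fin 2 → L) →ₗ[O] (Fin 2 → L) :=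
  (Matrix.mulVecLin (g : Matrix (Fin 2) (Fin 2) L)).restrictScalars O

theorem glMap_one : glMap 1 = LinearMap.id := by
  refine LinearMap.ext fun v => ?_
  change Matrix.mulVec (1 : Matrix (Fin 2) (Fin 2) L) v = v
  exact Matrix.one_mulVec v

theorem glMap_mul (g h : GL (Fin 2) L) : glMap (g * h) = (glMap g).comp (glMap h) := by
  refine LinearMap.ext fun v => ?_
  exact (Matrix.mulVec_mulVec v (g : Matrix (Fin 2) (Fin 2) L)
    (h : Matrix (Fin 2) (Fin 2) L)).symm

theorem isLattice_map (g : GL (Fin 2) L) (M : Submodule O (Fin 2 → L))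
    (hM : Submodule.IsLattice L M) : Submodule.IsLattice L (M.map (glMap g)) where
  fg := hM.fg.map _
  span_eq_top := by
    have h : (M.map (glMap g) : Set (Fin 2 → L)) =
        Matrix.mulVecLin (g : Matrix (Fin 2) (Fin 2) L) '' (M : Set (Fin 2 → L)) := rfl
    rw [h, Submodule.span_image, hM.span_eq_top, Submodule.map_top, LinearMap.range_eq_top]
    intro v
    refine ⟨Matrix.mulVec ((g⁻¹ : GL (Fin 2) L) : Matrix (Fin 2) (Fin 2) L) v, ?_⟩
    rw [Matrix.mulVecLin_apply, Matrix.mulVec_mulVec, ← Units.val_mul, mul_inv_cancel,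
      Units.val_one, Matrix.one_mulVec]

/-- `GL₂` acts on lattices by left multiplication. -/
instance latticeAction : MulAction (GL (Fin 2) L) Lattice2 where
  smul g M := ⟨M.mod.map (glMap g), isLattice_map g M.mod M.isLattice⟩
  one_smul M := Lattice2.ext <| by
    change M.mod.map (glMap 1) = M.mod
    rw [glMap_one, Submodule.map_id]
  mul_smul g h M := Lattice2.ext <| by
    change M.mod.map (glMap (g * h)) = (M.mod.map (glMap h)).map (glMap g)
    rw [glMap_mul, Submodule.map_comp]

/-- Two lattices `M`, `N` are homothetic if `N = c M` for a scalar `c ∈ 𝔽₂((x))ˣ`. -/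
instance homothety : Setoid Lattice2 where
  r M N := ∃ c : Lˣ, N = Matrix.GeneralLinearGroup.scalar (Fin 2) c • M
  iseqv :=
    ⟨fun M => ⟨1, by rw [map_one, one_smul]⟩,
      fun {M N} ⟨c, h⟩ => ⟨c⁻¹, by rw [h, map_inv, inv_smul_smul]⟩,
      fun {M N P} ⟨c, h⟩ ⟨d, k⟩ => ⟨d * c, by rw [k, h, map_mul, mul_smul]⟩⟩

theorem scalar_mul_comm (c : Lˣ) (g : GL (Fin 2) L) :
    g * Matrix.GeneralLinearGroup.scalar (Fin 2) c
      = Matrix.GeneralLinearGroup.scalar (Fin 2) c * g :=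
  Units.ext (Matrix.scalar_commute (c : L) (fun _ => mul_comm _ _) _).symm

/-- The vertices of the Bruhat–Tits tree of `PGL₂(𝔽₂((x)))`: homothety classes of lattices. -/
def BTVertex : Type := Quotient homothety

instance glAction : MulAction (GL (Fin 2) L) BTVertex where
  smul g := Quotient.map (fun M => g • M) fun M N ⟨c, h⟩ => ⟨c, by
    rw [h, smul_smul, scalar_mul_comm, mul_smul]⟩
  one_smul v := by
    induction v using Quotient.inductionOn with
    | h M =>
      change Quotient.mk homothety ((1 : GL (Fin 2) L) • M) = _
      rw [one_smul]
  mul_smul g h v := by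
    induction v using Quotient.inductionOn with
    | h M =>
      change Quotient.mk homothety ((g * h) • M) = Quotient.mk homothety (g • h • M)
      rw [mul_smul]

/-- The action of `PGL₂` on the vertices of the Bruhat–Tits tree. -/
instance pglAction : MulAction PGL(2, L) BTVertex :=
  Matrix.ProjGenLinGroup.mulActionOfGL <| by
    intro u v
    induction v using Quotient.inductionOn with
    | h M =>
      exact Quotient.sound ⟨u⁻¹, by rw [map_inv, inv_smul_smul]⟩

/-- The Bruhat–Tits tree: the classes of `M` and `N` are joined by an edge if, for suitable
representatives, `x M ⊊ N ⊊ M` (this relation is symmetric and irreflexive). -/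
def BTTree : SimpleGraph BTVertex :=
  SimpleGraph.fromRel fun v w => ∃ M N : Lattice2, v = Quotient.mk homothety M ∧
    w = Quotient.mk homothety N ∧ (PowerSeries.X : O) • M.mod < N.mod ∧ N.mod < M.mod

/-- The Bruhat–Tits action of `G(K)` on the vertices of `T₀ × T_∞`. -/
def btAct (g : GK) (v : BTVertex × BTVertex) : BTVertex × BTVertex :=
  (pgl0 g • v.1, pglInf g • v.2)

/-! ### Square complexes and orbispace fundamental groups -/

/-- A square complex: a set `V` of vertices, a set `E` of oriented edges with a fixed point free
inversion `rev` and an origin map `src` (so that the terminus of `e` is `src (rev e)`), and a set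
`S` of squares, each one glued along a closed edge path `bd 0, bd 1, bd 2, bd 3` of length four. -/
structure SquareComplex where
  /-- vertices -/
  V : Type
  /-- oriented edges -/
  E : Type
  /-- squares -/
  S : Type
  /-- the origin of an oriented edge -/
  src : E → V
  /-- the same edge with the opposite orientation -/
  rev : E → E
  rev_rev : ∀ e, rev (rev e) = e
  rev_ne : ∀ e, rev e ≠ e
  /-- the boundary path of a square -/
  bd : Fin 4 → S → E
  bd_closed : ∀ i s, src (rev (bd i s)) = src (bd (i + 1) s)

namespace SquareComplex

/-- The unoriented edges: oriented edges up to inversion. -/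
def UnorientedEdge (X : SquareComplex) : Type := Quot fun e f : X.E => f = X.rev e

/-- The disjoint union of the vertices, of an interval for every oriented edge, and of a unit
square for every square. -/
abbrev Cells (X : SquareComplex) : Type :=
  (Σ _ : X.V, PUnit) ⊕ (Σ _ : X.E, I) ⊕ (Σ _ : X.S, I × I)

/-- The point of a vertex. -/
abbrev vtx {X : SquareComplex} (v : X.V) : X.Cells := Sum.inl ⟨v, PUnit.unit⟩

/-- The point with parameter `t` on an oriented edge. -/
abbrev edg {X : SquareComplex} (e : X.E) (t : I) : X.Cells := Sum.inr (Sum.inl ⟨e, t⟩)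

/-- The point with coordinates `p` in a square. -/
abbrev sqr {X : SquareComplex} (s : X.S) (p : I × I) : X.Cells := Sum.inr (Sum.inr ⟨s, p⟩)

/-- The gluing: an oriented edge starts at its origin, the two orientations of an edge are
identified, and the boundary of the square `s`, run through along
`(0,0) → (1,0) → (1,1) → (0,1) → (0,0)`, is glued to `bd 0 s, bd 1 s, bd 2 s, bd 3 s`. -/
inductive Glue (X : SquareComplex) : X.Cells → X.Cells → Prop
  | src (e : X.E) : Glue X (edg e 0) (vtx (X.src e))
  | rev (e : X.E) (t : I) : Glue X (edg (X.rev e) t) (edg e (σ t))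
  | bd0 (s : X.S) (t : I) : Glue X (sqr s (t, 0)) (edg (X.bd 0 s) t)
  | bd1 (s : X.S) (t : I) : Glue X (sqr s (1, t)) (edg (X.bd 1 s) t)
  | bd2 (s : X.S) (t : I) : Glue X (sqr s (σ t, 1)) (edg (X.bd 2 s) t)
  | bd3 (s : X.S) (t : I) : Glue X (sqr s (0, σ t)) (edg (X.bd 3 s) t)

/-- The topological space of a square complex, with the quotient topology. -/
def Realization (X : SquareComplex) : Type := Quot X.Glue

instance (X : SquareComplex) : TopologicalSpace X.Realization :=
  inferInstanceAs (TopologicalSpace (Quot X.Glue))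

/-- The quotient map from the cells to the square complex. -/
def proj (X : SquareComplex) : X.Cells → X.Realization := Quot.mk X.Glue

theorem continuous_proj (X : SquareComplex) : Continuous X.proj := continuous_quot_mk

variable {X : SquareComplex}

theorem proj_src (e : X.E) : X.proj (edg e 0) = X.proj (vtx (X.src e)) := Quot.sound (.src e)

theorem proj_rev (e : X.E) (t : I) : X.proj (edg (X.rev e) t) = X.proj (edg e (σ t)) :=
  Quot.sound (.rev e t)

theorem proj_bd0 (s : X.S) (t : I) : X.proj (sqr s (t, 0)) = X.proj (edg (X.bd 0 s) t) :=
  Quot.sound (.bd0 s t)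

theorem proj_bd1 (s : X.S) (t : I) : X.proj (sqr s (1, t)) = X.proj (edg (X.bd 1 s) t) :=
  Quot.sound (.bd1 s t)

theorem proj_bd2 (s : X.S) (t : I) : X.proj (sqr s (σ t, 1)) = X.proj (edg (X.bd 2 s) t) :=
  Quot.sound (.bd2 s t)

theorem proj_bd3 (s : X.S) (t : I) : X.proj (sqr s (0, σ t)) = X.proj (edg (X.bd 3 s) t) :=
  Quot.sound (.bd3 s t)

/-- The path that runs along an oriented edge. -/
def edgePath (e : X.E) : Path (X.proj (vtx (X.src e))) (X.proj (vtx (X.src (X.rev e)))) where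
  toFun t := X.proj (edg e t)
  continuous_toFun := X.continuous_proj.comp
    (continuous_inr.comp (continuous_inl.comp continuous_sigmaMk))
  source' := proj_src e
  target' := by
    rw [← proj_src, proj_rev, unitInterval.symm_zero]

/-- A map on cells that is given by maps of vertices and edges, and on squares by a map together
with a continuous change of coordinates. -/
def cellMap (fV : X.V → X.V) (fE : X.E → X.E) (fS : X.S → X.S) (c : C(I × I, I × I)) :
    X.Cells → X.Cells :=
  Sum.map (Sigma.map fV fun _ => id) (Sum.map (Sigma.map fE fun _ => id) (Sigma.map fS fun _ => c))

theorem continuous_cellMap (fV : X.V → X.V) (fE : X.E → X.E) (fS : X.S → X.S)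
    (c : C(I × I, I × I)) : Continuous (cellMap fV fE fS c) := by
  refine Continuous.sumMap (Continuous.sigma_map fun _ => continuous_id)
    (Continuous.sumMap (Continuous.sigma_map fun _ => continuous_id)
      (Continuous.sigma_map fun _ => c.continuous))

end SquareComplex

section Orbispace

variable {G S : Type} [Group G] [TopologicalSpace S] [MulAction G S]

/-- The orbispace fundamental group `π₁^orb(S, G, s)` of a space `S` with an action of a discrete
group `G`: pairs `[α; g]` of an element `g` of `G` (the order) and a homotopy class `α` of paths
from `s` to `g • s`. -/
@[ext]
structure OrbPi1 (G : Type) {S : Type} [Group G] [TopologicalSpace S] [MulAction G S]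
    (s : S) : Type where
  /-- the order of the loop -/
  order : G
  /-- the homotopy class of the path -/
  cls : Path.Homotopic.Quotient s (order • s)

namespace OrbPi1

theorem ext_cast {s : S} {x y : OrbPi1 G s} (h : x.order = y.order)
    (hc : x.cls = y.cls.cast rfl (by rw [h])) : x = y := by
  obtain ⟨g, α⟩ := x
  obtain ⟨k, β⟩ := y
  obtain rfl : g = k := h
  rw [Path.Homotopic.Quotient.cast_rfl_rfl] at hc
  exact congrArg _ hc

variable [ContinuousConstSMul G S]

/-- The translate `g • α` of a homotopy class of paths. -/
def translate (g : G) {a b : S} (α : Path.Homotopic.Quotient a b) :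
    Path.Homotopic.Quotient (g • a) (g • b) :=
  α.map ⟨fun p => g • p, continuous_const_smul g⟩

theorem one_translate {a b : S} (α : Path.Homotopic.Quotient a b) :
    translate (1 : G) α = α.cast (one_smul G a) (one_smul G b) := by
  obtain ⟨p, rfl⟩ := Path.Homotopic.Quotient.mk_surjective α
  refine congrArg Path.Homotopic.Quotient.mk ?_
  ext t
  exact one_smul G (p t)

theorem mul_translate {a b : S} (g h : G) (α : Path.Homotopic.Quotient a b) :
    translate (g * h) α = (translate g (translate h α)).cast
      (mul_smul g h a) (mul_smul g h b) := by
  obtain ⟨p, rfl⟩ := Path.Homotopic.Quotient.mk_surjective α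
  refine congrArg Path.Homotopic.Quotient.mk ?_
  ext t
  exact mul_smul g h (p t)

theorem translate_trans {a b c : S} (g : G) (α : Path.Homotopic.Quotient a b)
    (β : Path.Homotopic.Quotient b c) :
    translate g (α.trans β) = (translate g α).trans (translate g β) := by
  obtain ⟨p, rfl⟩ := Path.Homotopic.Quotient.mk_surjective α
  obtain ⟨q, rfl⟩ := Path.Homotopic.Quotient.mk_surjective β
  exact congrArg Path.Homotopic.Quotient.mk (Path.map_trans p q (continuous_const_smul g))

theorem translate_symm {a b : S} (g : G) (α : Path.Homotopic.Quotient a b) :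
    translate g α.symm = (translate g α).symm := by
  obtain ⟨p, rfl⟩ := Path.Homotopic.Quotient.mk_surjective α
  rfl

theorem translate_cast {a b c : S} (g : G) (h : c = b) (α : Path.Homotopic.Quotient a b) :
    translate g (α.cast rfl h) = (translate g α).cast rfl (by rw [h]) := by
  subst h
  simp

theorem refl_cast_trans {a b c : S} (h : b = a) (α : Path.Homotopic.Quotient b c) :
    ((Path.Homotopic.Quotient.refl a).cast rfl h).trans α = α.cast h.symm rfl := by
  subst h
  simp

theorem symm_cast_trans {a b c d : S} (h : c = b) (k : d = b)
    (α : Path.Homotopic.Quotient a b) :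
    (α.symm.cast h rfl).trans (α.cast rfl k)
      = (Path.Homotopic.Quotient.refl c).cast rfl (k.trans h.symm) := by
  subst h
  subst k
  simp

theorem trans_cast {a b c d : S} (h : d = c)
    (α : Path.Homotopic.Quotient a b) (β : Path.Homotopic.Quotient b c) :
    α.trans (β.cast rfl h) = (α.trans β).cast rfl h := by
  subst h
  simp

theorem cast_trans_cast {a b c d e f : S} (h : d = c) (k : f = e)
    (α : Path.Homotopic.Quotient a b) (β : Path.Homotopic.Quotient b c)
    (γ : Path.Homotopic.Quotient c e) :
    ((α.trans β).cast rfl h).trans (γ.cast h k) = (α.trans (β.trans γ)).cast rfl k := by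
  subst h
  subst k
  simp

variable {s : S}

/-- The product `[α; g] * [β; h] = [α * (g • β); g h]`. -/
instance : Mul (OrbPi1 G s) where
  mul x y := ⟨x.order * y.order,
    x.cls.trans ((translate x.order y.cls).cast rfl (mul_smul x.order y.order s))⟩

/-- The identity is the constant loop of trivial order. -/
instance : One (OrbPi1 G s) where
  one := ⟨1, (Path.Homotopic.Quotient.refl s).cast rfl (one_smul G s)⟩

/-- The inverse `[g⁻¹ • α⁻¹; g⁻¹]` of `[α; g]`. -/
instance : Inv (OrbPi1 G s) where
  inv x := ⟨x.order⁻¹,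
    (translate x.order⁻¹ x.cls.symm).cast (inv_smul_smul x.order s).symm rfl⟩

theorem one_mul_aux (x : OrbPi1 G s) : 1 * x = x := by
  refine ext_cast (one_mul x.order) ?_
  change ((Path.Homotopic.Quotient.refl s).cast rfl (one_smul G s)).trans
    ((translate 1 x.cls).cast rfl (mul_smul 1 x.order s)) = _
  rw [one_translate, refl_cast_trans, Path.Homotopic.Quotient.cast_cast,
    Path.Homotopic.Quotient.cast_cast]

theorem inv_mul_aux (x : OrbPi1 G s) : x⁻¹ * x = 1 := by
  refine ext_cast (inv_mul_cancel x.order) ?_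
  change ((translate x.order⁻¹ x.cls.symm).cast (inv_smul_smul x.order s).symm rfl).trans
    ((translate x.order⁻¹ x.cls).cast rfl (mul_smul x.order⁻¹ x.order s))
    = ((Path.Homotopic.Quotient.refl s).cast rfl (one_smul G s)).cast rfl _
  rw [translate_symm, Path.Homotopic.Quotient.cast_cast]
  exact symm_cast_trans _ _ _

theorem mul_assoc_aux (x y w : OrbPi1 G s) : x * y * w = x * (y * w) := by
  refine ext_cast (mul_assoc x.order y.order w.order) ?_
  change (x.cls.trans ((translate x.order y.cls).cast rfl (mul_smul x.order y.order s))).trans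
      ((translate (x.order * y.order) w.cls).cast rfl (mul_smul (x.order * y.order) w.order s))
    = (x.cls.trans ((translate x.order (y.cls.trans ((translate y.order w.cls).cast rfl
        (mul_smul y.order w.order s)))).cast rfl
        (mul_smul x.order (y.order * w.order) s))).cast rfl _
  rw [mul_translate, translate_trans, translate_cast]
  simp only [trans_cast, Path.Homotopic.Quotient.cast_cast]
  exact cast_trans_cast _ _ _ _ _

instance : Group (OrbPi1 G s) := Group.ofLeftAxioms mul_assoc_aux one_mul_aux inv_mul_aux

/-- A homotopy class of loops as an element `[α; 1]` of the orbispace fundamental group. -/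
def ofLoop (α : Path.Homotopic.Quotient s s) : OrbPi1 G s := ⟨1, α.cast rfl (one_smul G s)⟩

end OrbPi1

end Orbispace

/-! ### `V₄`-structures and their square complexes -/

/-- The group `V₄ ≅ ℤ/2 × ℤ/2`. -/
abbrev V4 : Type := Multiplicative (ZMod 2) × Multiplicative (ZMod 2)

/-- The first generator `γ_v` of `V₄`. -/
def γv : V4 := (Multiplicative.ofAdd 1, 1)

/-- The second generator `γ_h` of `V₄`. -/
def γh : V4 := (1, Multiplicative.ofAdd 1)

/-- A `V₄`-structure of a group: finite sets `A`, `B` which are closed under inversion and together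
generate the group, such that `A B = B A` and both `(a, b) ↦ a b` and `(a, b) ↦ b a` are bijections
from `A × B` onto this set. -/
structure IsV4Structure {Λ : Type} [Group Λ] (A B : Set Λ) : Prop where
  finite_left : A.Finite
  finite_right : B.Finite
  closure_union : Subgroup.closure (A ∪ B) = ⊤
  inv_mem_left : ∀ a ∈ A, a⁻¹ ∈ A
  inv_mem_right : ∀ b ∈ B, b⁻¹ ∈ B
  mul_comm : A * B = B * A
  bijOn_mul : Set.BijOn (fun p : Λ × Λ => p.1 * p.2) (A ×ˢ B) (A * B)
  bijOn_mul_swap : Set.BijOn (fun p : Λ × Λ => p.2 * p.1) (A ×ˢ B) (A * B)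

section V4Complex

variable {Λ : Type} [Group Λ] {A B : Set Λ}

/-- The oriented edges of the square complex of a `V₄`-structure. With `r = false`, `v a i r` is
the vertical edge `(a, i)` from `s_{i0}` to `s_{i1}`, and `h b j r` is the horizontal edge `(b, j)`
from `s_{0j}` to `s_{1j}`; with `r = true` they are the inverse edges. -/
inductive V4Edge (A B : Set Λ) : Type
  | v (a : A) (i r : Bool) : V4Edge A B
  | h (b : B) (j r : Bool) : V4Edge A B

/-- The squares `[left, top; bottom, right]`, where `left * top = bottom * right`. -/
@[ext]
structure V4Square (A B : Set Λ) : Type where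
  /-- the label of the edge from `s₀₀` to `s₀₁` -/
  left : A
  /-- the label of the edge from `s₀₁` to `s₁₁` -/
  top : B
  /-- the label of the edge from `s₀₀` to `s₁₀` -/
  bottom : B
  /-- the label of the edge from `s₁₀` to `s₁₁` -/
  right : A
  mul_eq : (left : Λ) * top = bottom * right

/-- The square complex `Σ_{A,B}` of a `V₄`-structure. Its vertex `s_{ij}` is the pair `(i, j)`, and
the square `[a, b; c, d]` is glued along `(a, 0)`, `(b, 1)`, the inverse of `(d, 1)` and the
inverse of `(c, 0)`. -/
def v4Complex (_ : IsV4Structure A B) : SquareComplex where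
  V := Bool × Bool
  E := V4Edge A B
  S := V4Square A B
  src
    | .v _ i r => (i, r)
    | .h _ j r => (r, j)
  rev
    | .v a i r => .v a i !r
    | .h b j r => .h b j !r
  rev_rev := by rintro (⟨a, i, r⟩ | ⟨b, j, r⟩) <;> simp
  rev_ne := by rintro (⟨a, i, r⟩ | ⟨b, j, r⟩) <;> simp
  bd
    | 0, s => .v s.left false false
    | 1, s => .h s.top true false
    | 2, s => .v s.right true true
    | 3, s => .h s.bottom false true
  bd_closed := by
    intro i s
    fin_cases i <;> rfl

namespace v4Complex

open SquareComplex

variable (h : IsV4Structure A B)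

/-- Inversion on `A`. -/
def invA (a : A) : A := ⟨(a : Λ)⁻¹, h.inv_mem_left a a.2⟩

/-- Inversion on `B`. -/
def invB (b : B) : B := ⟨(b : Λ)⁻¹, h.inv_mem_right b b.2⟩

theorem invA_invA (a : A) : invA h (invA h a) = a := Subtype.ext (inv_inv _)

theorem invB_invB (b : B) : invB h (invB h b) = b := Subtype.ext (inv_inv _)

/-- The action of `γ_v` on edges: `(a, i)` goes to the inverse of `(a⁻¹, i)`, and `(b, j)` to
`(b, 1 - j)`. -/
def edgeV : V4Edge A B → V4Edge A B
  | .v a i r => .v (invA h a) i !r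
  | .h b j r => .h b (!j) r

/-- The action of `γ_h` on edges: `(a, i)` goes to `(a, 1 - i)`, and `(b, j)` to the inverse of
`(b⁻¹, j)`. -/
def edgeH : V4Edge A B → V4Edge A B
  | .v a i r => .v a (!i) r
  | .h b j r => .h (invB h b) j !r

/-- The action of `γ_v` on squares: `[a, b; c, d]` goes to `[a⁻¹, c; b, d⁻¹]`. -/
def squareV (s : V4Square A B) : V4Square A B where
  left := invA h s.left
  top := s.bottom
  bottom := s.top
  right := invA h s.right
  mul_eq := by
    change (s.left : Λ)⁻¹ * s.bottom = s.top * (s.right : Λ)⁻¹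
    rw [inv_mul_eq_iff_eq_mul, ← mul_assoc, s.mul_eq, mul_inv_cancel_right]

/-- The action of `γ_h` on squares: `[a, b; c, d]` goes to `[d, b⁻¹; c⁻¹, a]`. -/
def squareH (s : V4Square A B) : V4Square A B where
  left := s.right
  top := invB h s.top
  bottom := invB h s.bottom
  right := s.left
  mul_eq := by
    change (s.right : Λ) * (s.top : Λ)⁻¹ = (s.bottom : Λ)⁻¹ * s.left
    rw [eq_inv_mul_iff_mul_eq, ← mul_assoc, ← s.mul_eq, mul_inv_cancel_right]

/-- The action of `γ_v` on the cells. -/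
def cellV : (v4Complex h).Cells → (v4Complex h).Cells :=
  cellMap (X := v4Complex h) (fun p => (p.1, !p.2)) (edgeV h) (squareV h)
    ⟨fun p => (σ p.1, p.2), by fun_prop⟩

/-- The action of `γ_h` on the cells. -/
def cellH : (v4Complex h).Cells → (v4Complex h).Cells :=
  cellMap (X := v4Complex h) (fun p => (!p.1, p.2)) (edgeH h) (squareH h)
    ⟨fun p => (p.1, σ p.2), by fun_prop⟩

theorem cellV_cellV (p : (v4Complex h).Cells) : cellV h (cellV h p) = p := by
  rcases p with ⟨⟨i, j⟩, ⟨⟩⟩ | ⟨⟨a, i, r⟩ | ⟨b, j, r⟩, t⟩ | ⟨s, t⟩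
  · simp [cellV, cellMap, Sigma.map]
  · simp [cellV, cellMap, edgeV, Sigma.map, invA_invA]
  · simp [cellV, cellMap, edgeV, Sigma.map]
  · simp [cellV, cellMap, squareV, Sigma.map, invA_invA]
    rfl

theorem cellH_cellH (p : (v4Complex h).Cells) : cellH h (cellH h p) = p := by
  rcases p with ⟨⟨i, j⟩, ⟨⟩⟩ | ⟨⟨a, i, r⟩ | ⟨b, j, r⟩, t⟩ | ⟨s, t⟩
  · simp [cellH, cellMap, Sigma.map]
  · simp [cellH, cellMap, edgeH, Sigma.map]
  · simp [cellH, cellMap, edgeH, Sigma.map, invB_invB]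
  · simp [cellH, cellMap, squareH, Sigma.map, invB_invB]
    rfl

theorem cellV_cellH (p : (v4Complex h).Cells) : cellV h (cellH h p) = cellH h (cellV h p) := by
  rcases p with ⟨⟨i, j⟩, ⟨⟩⟩ | ⟨⟨a, i, r⟩ | ⟨b, j, r⟩, t⟩ | ⟨s, t⟩ <;> rfl

theorem proj_cellV {p q : (v4Complex h).Cells} (hpq : (v4Complex h).Glue p q) :
    (v4Complex h).proj (cellV h p) = (v4Complex h).proj (cellV h q) := by
  cases hpq with
  | src e =>
    rcases e with ⟨a, i, r⟩ | ⟨b, j, r⟩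
    · exact proj_src (X := v4Complex h) (.v (invA h a) i !r)
    · exact proj_src (X := v4Complex h) (.h b (!j) r)
  | rev e t =>
    rcases e with ⟨a, i, r⟩ | ⟨b, j, r⟩
    · exact proj_rev (X := v4Complex h) (.v (invA h a) i !r) t
    · exact proj_rev (X := v4Complex h) (.h b (!j) r) t
  | bd0 s t =>
    refine (proj_bd0 (X := v4Complex h) (squareV h s) (σ t)).trans ?_
    exact (proj_rev (X := v4Complex h) (.v (invA h s.left) false false) t).symm
  | bd1 s t =>
    have h1 := proj_bd3 (X := v4Complex h) (squareV h s) (σ t)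
    have h2 := proj_rev (X := v4Complex h) (.h s.top false false) (σ t)
    rw [unitInterval.symm_symm] at h1 h2
    change (v4Complex h).proj (sqr (squareV h s) (σ 1, t)) = _
    rw [unitInterval.symm_one]
    exact h1.trans h2
  | bd2 s t =>
    have h1 := proj_bd2 (X := v4Complex h) (squareV h s) (σ t)
    have h2 := proj_rev (X := v4Complex h) (.v (invA h s.right) true false) (σ t)
    rw [unitInterval.symm_symm] at h1 h2
    change (v4Complex h).proj (sqr (squareV h s) (σ (σ t), 1)) = _
    rw [unitInterval.symm_symm]
    exact h1.trans h2
  | bd3 s t =>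
    have h1 := proj_bd1 (X := v4Complex h) (squareV h s) (σ t)
    have h2 := proj_rev (X := v4Complex h) (.h s.bottom true false) t
    change (v4Complex h).proj (sqr (squareV h s) (σ 0, σ t)) = _
    rw [unitInterval.symm_zero]
    exact h1.trans h2.symm

theorem proj_cellH {p q : (v4Complex h).Cells} (hpq : (v4Complex h).Glue p q) :
    (v4Complex h).proj (cellH h p) = (v4Complex h).proj (cellH h q) := by
  cases hpq with
  | src e =>
    rcases e with ⟨a, i, r⟩ | ⟨b, j, r⟩
    · exact proj_src (X := v4Complex h) (.v a (!i) r)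
    · exact proj_src (X := v4Complex h) (.h (invB h b) j !r)
  | rev e t =>
    rcases e with ⟨a, i, r⟩ | ⟨b, j, r⟩
    · exact proj_rev (X := v4Complex h) (.v a (!i) r) t
    · exact proj_rev (X := v4Complex h) (.h (invB h b) j !r) t
  | bd0 s t =>
    have h1 := proj_bd2 (X := v4Complex h) (squareH h s) (σ t)
    have h2 := proj_rev (X := v4Complex h) (.v s.left true false) (σ t)
    rw [unitInterval.symm_symm] at h1 h2
    change (v4Complex h).proj (sqr (squareH h s) (t, σ 0)) = _
    rw [unitInterval.symm_zero]
    exact h1.trans h2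
  | bd1 s t =>
    refine (proj_bd1 (X := v4Complex h) (squareH h s) (σ t)).trans ?_
    exact (proj_rev (X := v4Complex h) (.h (invB h s.top) true false) t).symm
  | bd2 s t =>
    have h1 := proj_bd0 (X := v4Complex h) (squareH h s) (σ t)
    have h2 := proj_rev (X := v4Complex h) (.v s.right false false) t
    change (v4Complex h).proj (sqr (squareH h s) (σ t, σ 1)) = _
    rw [unitInterval.symm_one]
    exact h1.trans h2.symm
  | bd3 s t =>
    have h1 := proj_bd3 (X := v4Complex h) (squareH h s) (σ t)
    have h2 := proj_rev (X := v4Complex h) (.h (invB h s.bottom) false false) (σ t)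
    rw [unitInterval.symm_symm] at h1 h2
    change (v4Complex h).proj (sqr (squareH h s) (0, σ (σ t))) = _
    rw [unitInterval.symm_symm]
    exact h1.trans h2

/-- The action of `γ_v` on the square complex. -/
def actV : (v4Complex h).Realization → (v4Complex h).Realization :=
  Quot.lift (fun p => (v4Complex h).proj (cellV h p)) fun _ _ => proj_cellV h

/-- The action of `γ_h` on the square complex. -/
def actH : (v4Complex h).Realization → (v4Complex h).Realization :=
  Quot.lift (fun p => (v4Complex h).proj (cellH h p)) fun _ _ => proj_cellH h

theorem continuous_actV : Continuous (actV h) :=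
  continuous_quot_lift _ ((v4Complex h).continuous_proj.comp (continuous_cellMap _ _ _ _))

theorem continuous_actH : Continuous (actH h) :=
  continuous_quot_lift _ ((v4Complex h).continuous_proj.comp (continuous_cellMap _ _ _ _))

theorem actV_actV (p : (v4Complex h).Realization) : actV h (actV h p) = p := by
  induction p using Quot.ind with
  | mk p => exact congrArg (v4Complex h).proj (cellV_cellV h p)

theorem actH_actH (p : (v4Complex h).Realization) : actH h (actH h p) = p := by
  induction p using Quot.ind with
  | mk p => exact congrArg (v4Complex h).proj (cellH_cellH h p)

theorem actV_actH (p : (v4Complex h).Realization) : actV h (actH h p) = actH h (actV h p) := by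
  induction p using Quot.ind with
  | mk p => exact congrArg (v4Complex h).proj (cellV_cellH h p)

theorem eq_one_or (m : Multiplicative (ZMod 2)) : m = 1 ∨ m = Multiplicative.ofAdd 1 := by
  revert m
  decide

theorem ofAdd_mul_ofAdd :
    (Multiplicative.ofAdd 1 : Multiplicative (ZMod 2)) * Multiplicative.ofAdd 1 = 1 := by decide

/-- The action of `V₄` on the square complex. -/
instance : MulAction V4 (v4Complex h).Realization where
  smul g p := (if g.1 = 1 then id else actV h) ((if g.2 = 1 then id else actH h) p)
  one_smul p := rfl
  mul_smul := by
    rintro ⟨g, g'⟩ ⟨k, k'⟩ p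
    change (if g * k = 1 then id else actV h) ((if g' * k' = 1 then id else actH h) p)
      = (if g = 1 then id else actV h) ((if g' = 1 then id else actH h)
        ((if k = 1 then id else actV h) ((if k' = 1 then id else actH h) p)))
    rcases eq_one_or g with rfl | rfl <;> rcases eq_one_or g' with rfl | rfl <;>
    rcases eq_one_or k with rfl | rfl <;> rcases eq_one_or k' with rfl | rfl <;>
    simp [ofAdd_mul_ofAdd, actV_actV, actH_actH, actV_actH]

theorem γv_smul (p : (v4Complex h).Realization) : γv • p = actV h p := rfl

theorem γh_smul (p : (v4Complex h).Realization) : γh • p = actH h p := rfl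

instance : ContinuousConstSMul V4 (v4Complex h).Realization where
  continuous_const_smul := by
    rintro ⟨g, k⟩
    rcases eq_one_or g with rfl | rfl <;> rcases eq_one_or k with rfl | rfl
    · exact continuous_id
    · exact continuous_actH h
    · exact continuous_actV h
    · exact (continuous_actV h).comp (continuous_actH h)

/-- The base point `s₀₀`. -/
def s00 : (v4Complex h).Realization :=
  (v4Complex h).proj (vtx (X := v4Complex h) (false, false))

/-- The orbispace loop `α_a`: the edge `(a, 0)` from `s₀₀` to `s₀₁ = γ_v s₀₀`, of order `γ_v`. -/
def α (a : A) : OrbPi1 V4 (s00 h) where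
  order := γv
  cls := .mk (edgePath (X := v4Complex h) (.v a false false))

/-- The orbispace loop `β_b`: the edge `(b, 0)` from `s₀₀` to `s₁₀ = γ_h s₀₀`, of order `γ_h`. -/
def β (b : B) : OrbPi1 V4 (s00 h) where
  order := γh
  cls := .mk (edgePath (X := v4Complex h) (.h b false false))

end v4Complex

end V4Complex

/-- The set `𝒜 = {b₁, b₁⁻¹, c₁}`. -/
def setA : Set Lam := {b1L, b1L⁻¹, c1L}

/-- The set `ℬ = {b₂, b₂⁻¹, c₂}`. -/
def setB : Set Lam := {b2L, b2L⁻¹, c2L}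

end QuaternionLattice

end

open QuaternionLattice

open scoped Pointwise MatrixGroups unitInterval

noncomputable section

namespace QuaternionLattice

/-! ### Orders of Laurent series -/

/-! Everything rests on a normal form that can be read off from distances in two trees. Let a group
act on two trees with base vertices `v` and `w`. Suppose `A` maps `v` bijectively to its neighbours
and fixes `w`, that `B` does the same with the roles exchanged, that both are closed under
inversion, generate the group together and satisfy `B A ⊆ A B` (`IsTreePair`). Then every `g` is a
reduced word in `A` times a reduced word in `B`. A reduced word moves its base vertex along a path
without backtracking, so the lengths of the two words are the distances from `g v` to `v` and from
`g w` to `w`. Hence only `1` fixes both base vertices, and the action on pairs of vertices is simply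
transitive.

The inclusion `B A ⊆ A B` follows from the five defining relations alone. The argument therefore
also applies to the abstractly presented group, acting through its map to `G(K)`, and shows that
this map is injective (`presLam_bijective`). The arithmetic input is ten matrix computations, which
locate the images of the base vertices: `A = {b₁, b₁⁻¹, c₁}` moves the one of `T_∞` and `B = {b₂,
b₂⁻¹, c₂}` the one of `T₀`. The trees are made explicit by describing the vertices as balls in
`𝔽₂((x))` (`vert_eq_iff`, `adj_vert`).

`G(R₁)` contains `Λ`, so for equality it suffices that its stabiliser of the base vertex is trivial
(`eq_one_of_mem_GR1`). A representative can be scaled to norm `1` and to be integral at `0` and `∞`.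
It has no pole at `z = 1`, where the norm form is anisotropic, so its coordinates are polynomials,
and integrality at `∞` leaves only a scalar. Discreteness and cocompactness follow from simple
transitivity, since vertex stabilisers in `PGL₂` are open and compact.

For `Γ` the proof is Reidemeister–Schreier rewriting with the coset representatives `1, c₁, c₂,
c₁c₂`. The relations of `Λ` are verified on a monomial action on four copies of the group with the
two claimed relators, which makes the map from that group to `Λ` injective (`exists_actGam_spec`).
`Γ` is the kernel of `δ : Λ → V₄`, which records the parities of the two distances. An element of
finite order in `Γ` moves all vertices by even distances, hence fixes a vertex in each tree and is
trivial.

For the square complex, the relations of `Λ` hold in the orbispace fundamental group because they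
are squares, which gives a homomorphism from `Λ`. It is surjective because every path is homotopic
to an edge path (`exists_isEdgePath`, by contracting the open stars of the vertices). It is
injective because the product of the labels along an edge path is a homotopy invariant
(`IsEdgePath.unique`): it is the monodromy of a covering with fibre `Λ`. Loops of trivial order
correspond to `Γ`. -/

/-- The embedding `𝔽₂[[x]] → 𝔽₂((x))`. -/
abbrev incl : O →+* L := algebraMap O L

theorem incl_injective : Function.Injective incl := IsFractionRing.injective O L

theorem incl_X : incl PowerSeries.X = x := by
  change HahnSeries.ofPowerSeries ℤ F2 PowerSeries.X = x
  rw [HahnSeries.ofPowerSeries_X]; rfl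

/-- The fractional ideal `xⁿ 𝔽₂[[x]]`. -/
def fracIdeal (n : ℤ) : Set L := {a | ∃ p : O, a = x ^ n * incl p}

theorem zpow_mem_fracIdeal (n : ℤ) : x ^ n ∈ fracIdeal n := ⟨1, by simp⟩

theorem incl_mem_fracIdeal (p : O) : incl p ∈ fracIdeal 0 := ⟨p, by simp⟩

theorem zero_mem_fracIdeal (n : ℤ) : (0 : L) ∈ fracIdeal n := ⟨0, by simp⟩

theorem one_mem_fracIdeal : (1 : L) ∈ fracIdeal 0 := ⟨1, by simp⟩

theorem mem_fracIdeal_zero {a : L} : a ∈ fracIdeal 0 ↔ ∃ p : O, a = incl p := by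
  simp [fracIdeal]

theorem add_mem_fracIdeal {n : ℤ} {a b : L} (ha : a ∈ fracIdeal n) (hb : b ∈ fracIdeal n) :
    a + b ∈ fracIdeal n := by
  obtain ⟨p, rfl⟩ := ha
  obtain ⟨q, rfl⟩ := hb
  exact ⟨p + q, by rw [map_add, mul_add]⟩

theorem neg_mem_fracIdeal {n : ℤ} {a : L} (ha : a ∈ fracIdeal n) : -a ∈ fracIdeal n := by
  obtain ⟨p, rfl⟩ := ha
  exact ⟨-p, by rw [map_neg, mul_neg]⟩

theorem sub_mem_fracIdeal {n : ℤ} {a b : L} (ha : a ∈ fracIdeal n) (hb : b ∈ fracIdeal n) :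
    a - b ∈ fracIdeal n := by
  rw [sub_eq_add_neg]
  exact add_mem_fracIdeal ha (neg_mem_fracIdeal hb)

theorem mul_mem_fracIdeal {n m : ℤ} {a b : L} (ha : a ∈ fracIdeal n) (hb : b ∈ fracIdeal m) :
    a * b ∈ fracIdeal (n + m) := by
  obtain ⟨p, rfl⟩ := ha
  obtain ⟨q, rfl⟩ := hb
  exact ⟨p * q, by rw [map_mul, zpow_add₀ x_ne_zero]; ring⟩

theorem fracIdeal_anti {n m : ℤ} (h : n ≤ m) {a : L} (ha : a ∈ fracIdeal m) :
    a ∈ fracIdeal n := by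
  obtain ⟨p, rfl⟩ := ha
  obtain ⟨k, rfl⟩ := Int.le.dest h
  refine ⟨PowerSeries.X ^ k * p, ?_⟩
  rw [zpow_add₀ x_ne_zero, map_mul, map_pow, incl_X, zpow_natCast]
  ring

theorem zpow_mul_mem_fracIdeal {k n : ℤ} {a : L} : x ^ k * a ∈ fracIdeal n ↔ a ∈ fracIdeal
    (n - k) := by
  constructor
  · intro h
    have := mul_mem_fracIdeal (zpow_mem_fracIdeal (-k)) h
    rw [← mul_assoc, ← zpow_add₀ x_ne_zero, neg_add_cancel, zpow_zero, one_mul] at this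
    convert this using 2
    ring
  · intro h
    have := mul_mem_fracIdeal (zpow_mem_fracIdeal k) h
    convert this using 2
    ring

/-- `𝔽₂((x))` is the fraction field of a discrete valuation ring with uniformizer `X`. Orders are
handled below through membership in `fracIdeal n`, which means "order at least `n`" and needs no
exception for `0`. -/
theorem exists_eq_zpow_mul_unit {a : L} (ha : a ≠ 0) : ∃ (n : ℤ) (u : Oˣ), a = x ^ n * incl u := by
  obtain ⟨p, q, hq, rfl⟩ := IsFractionRing.div_surjective (A := O) a
  have hq0 : q ≠ 0 := nonZeroDivisors.ne_zero hq
  have hp0 : p ≠ 0 := by rintro rfl; simp at ha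
  have key : ∀ r : O, r ≠ 0 → ∃ (n : ℕ) (u : Oˣ), r = PowerSeries.X ^ n * (u : O) := by
    intro r hr
    obtain ⟨n, hn⟩ := IsDiscreteValuationRing.associated_pow_irreducible hr
      (PowerSeries.X_irreducible (R := F2))
    obtain ⟨u, hu⟩ := hn.symm
    exact ⟨n, u, hu.symm⟩
  obtain ⟨n, u, rfl⟩ := key p hp0
  obtain ⟨m, w, rfl⟩ := key q hq0
  refine ⟨n - m, u * w⁻¹, ?_⟩
  have hw : incl (w : O) * incl ((w⁻¹ : Oˣ) : O) = 1 := by rw [← map_mul, Units.mul_inv, map_one]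
  have hw0 : incl (w : O) ≠ 0 := left_ne_zero_of_mul_eq_one hw
  have hx : x ^ m ≠ 0 := pow_ne_zero _ x_ne_zero
  change incl _ / incl _ = _
  rw [zpow_sub₀ x_ne_zero, Units.val_mul, map_mul, map_mul, map_mul, map_pow, map_pow, incl_X,
    zpow_natCast, zpow_natCast]
  field_simp
  linear_combination (-x ^ n * incl (u : O)) * hw

/-- For `n < k` the unit would be divisible by `X`. -/
theorem zpow_mul_unit_mem {n k : ℤ} (u : Oˣ) : x ^ n * incl u ∈ fracIdeal k ↔ k ≤ n := by
  constructor
  · rintro ⟨p, hp⟩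
    by_contra! h
    obtain ⟨j, hj⟩ := Int.le.dest h
    have h1 : incl (u : O) = incl (PowerSeries.X ^ (j + 1) * p) := by
      apply mul_left_cancel₀ (zpow_ne_zero n x_ne_zero)
      rw [hp, map_mul, map_pow, incl_X, ← mul_assoc, ← zpow_natCast, ← zpow_add₀ x_ne_zero]
      congr 2
      push_cast
      linarith
    have h2 := incl_injective h1
    have h3 : IsUnit (PowerSeries.X : O) := by
      refine isUnit_of_dvd_unit ?_ u.isUnit
      rw [h2, pow_succ']
      exact Dvd.intro _ (by rw [mul_assoc])
    exact (PowerSeries.X_irreducible (R := F2)).not_isUnit h3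
  · intro h
    exact fracIdeal_anti h ⟨u, rfl⟩

theorem zpow_mem_fracIdeal_iff {n k : ℤ} : x ^ n ∈ fracIdeal k ↔ k ≤ n := by
  simpa using zpow_mul_unit_mem (n := n) (k := k) 1

theorem mul_unit_mem_fracIdeal {k : ℤ} {a : L} (u : Oˣ) :
    a * incl u ∈ fracIdeal k ↔ a ∈ fracIdeal k := by
  constructor
  · intro h
    have := mul_mem_fracIdeal h (incl_mem_fracIdeal ((u⁻¹ : Oˣ) : O))
    rw [mul_assoc, ← map_mul, Units.mul_inv, map_one, mul_one, add_zero] at this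
    exact this
  · intro h
    have := mul_mem_fracIdeal h (incl_mem_fracIdeal (u : O))
    rwa [add_zero] at this

theorem zpow_mul_unit_injective {n m : ℤ} {u w : Oˣ} (h : x ^ n * incl u = x ^ m * incl w) :
    n = m :=
  le_antisymm
    ((zpow_mul_unit_mem w).mp (h ▸ (zpow_mul_unit_mem u).mpr le_rfl))
    ((zpow_mul_unit_mem u).mp (h ▸ (zpow_mul_unit_mem w).mpr le_rfl))

theorem exists_mem_fracIdeal (a : L) (k : ℤ) : ∃ n ≤ k, a ∈ fracIdeal n := by
  rcases eq_or_ne a 0 with rfl | ha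
  · exact ⟨k, le_rfl, zero_mem_fracIdeal k⟩
  · obtain ⟨n, u, rfl⟩ := exists_eq_zpow_mul_unit ha
    exact ⟨min n k, min_le_right _ _, (zpow_mul_unit_mem u).mpr (min_le_left _ _)⟩

theorem mem_fracIdeal_total (a b : L) (hb : b ≠ 0) : a * b⁻¹ ∈ fracIdeal 0 ∨
    (a ≠ 0 ∧ b * a⁻¹ ∈ fracIdeal 0) := by
  rcases eq_or_ne a 0 with rfl | ha
  · left; simpa using zero_mem_fracIdeal 0
  obtain ⟨n, u, hu⟩ := exists_eq_zpow_mul_unit (mul_ne_zero ha (inv_ne_zero hb))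
  rcases le_total 0 n with h | h
  · left; rw [hu]; exact (zpow_mul_unit_mem u).mpr h
  · right
    refine ⟨ha, ?_⟩
    have : b * a⁻¹ = (a * b⁻¹)⁻¹ := by rw [mul_inv, inv_inv, mul_comm]
    rw [this, hu, mul_inv, ← zpow_neg]
    have h2 : (incl (u : O))⁻¹ = incl ((u⁻¹ : Oˣ) : O) :=
      inv_eq_of_mul_eq_one_right (by rw [← map_mul, Units.mul_inv, map_one])
    rw [h2]
    exact (zpow_mul_unit_mem _).mpr (by omega)

/-- The residue field has just the elements `0` and `1`. This is what makes the tree trivalent. -/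
theorem mem_fracIdeal_zero_cases {a : L} (h : a ∈ fracIdeal 0) :
    a ∈ fracIdeal 1 ∨ a - 1 ∈ fracIdeal 1 := by
  obtain ⟨p, rfl⟩ := mem_fracIdeal_zero.mp h
  have key : ∀ q : O, PowerSeries.constantCoeff q = 0 → incl q ∈ fracIdeal 1 := by
    intro q hq
    obtain ⟨r, rfl⟩ := PowerSeries.X_dvd_iff.mpr hq
    exact ⟨r, by rw [map_mul, incl_X, zpow_one]⟩
  have h01 : ∀ c : F2, c = 0 ∨ c - 1 = 0 := by decide
  rcases h01 (PowerSeries.constantCoeff p) with h | h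
  · exact Or.inl (key p h)
  · right
    rw [← map_one incl, ← map_sub]
    exact key _ (by rw [map_sub, map_one, h])

/-! ### Lattices -/

/-- A matrix with entries in `𝔽₂[[x]]`. -/
def IsIntegral (g : GL (Fin 2) L) : Prop := ∀ i j, (g : Matrix (Fin 2) (Fin 2) L) i j ∈ fracIdeal 0

/-- The standard lattice `𝔽₂[[x]]²`. -/
def std : Lattice2 where
  mod :=
    { carrier := {f | ∀ i, f i ∈ fracIdeal 0}
      add_mem' := fun hf hg i => add_mem_fracIdeal (hf i) (hg i)
      zero_mem' := fun _ => zero_mem_fracIdeal 0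
      smul_mem' := fun c f hf i => by
        rw [Pi.smul_apply, Algebra.smul_def]
        simpa using mul_mem_fracIdeal (incl_mem_fracIdeal c) (hf i) }
  isLattice :=
    { fg := by
        refine Submodule.fg_def.mpr ⟨({Pi.single 0 1, Pi.single 1 1} : Set (Fin 2 → L)),
          Set.toFinite _, le_antisymm ?_ ?_⟩
        · rw [Submodule.span_le]
          intro f hf
          simp only [Set.mem_insert_iff, Set.mem_singleton_iff] at hf
          rcases hf with rfl | rfl <;> intro i <;> fin_cases i <;>
            simp [one_mem_fracIdeal, zero_mem_fracIdeal]
        · intro f hf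
          obtain ⟨p, hp⟩ := mem_fracIdeal_zero.mp (hf 0)
          obtain ⟨q, hq⟩ := mem_fracIdeal_zero.mp (hf 1)
          have : f = p • (Pi.single 0 1 : Fin 2 → L) + q • (Pi.single 1 1 : Fin 2 → L) := by
            funext i
            fin_cases i <;> simp [hp, hq, Algebra.smul_def]
          rw [this]
          exact add_mem (Submodule.smul_mem _ _ (Submodule.subset_span (by simp)))
            (Submodule.smul_mem _ _ (Submodule.subset_span (by simp)))
      span_eq_top := by
        rw [eq_top_iff]
        intro f _
        have : f = f 0 • (Pi.single 0 1 : Fin 2 → L) + f 1 • (Pi.single 1 1 : Fin 2 → L) := by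
          funext i
          fin_cases i <;> simp
        rw [this]
        refine add_mem (Submodule.smul_mem _ _ (Submodule.subset_span ?_))
            (Submodule.smul_mem _ _ (Submodule.subset_span ?_)) <;>
          intro i <;> fin_cases i <;> simp [one_mem_fracIdeal, zero_mem_fracIdeal] }

theorem mem_smul_lattice {g : GL (Fin 2) L} {M : Lattice2} {f : Fin 2 → L} :
    f ∈ (g • M).mod ↔ Matrix.mulVec ((g⁻¹ : GL (Fin 2) L) : Matrix (Fin 2) (Fin 2) L) f ∈
      M.mod := by
  change f ∈ M.mod.map (glMap g) ↔ _
  constructor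
  · rintro ⟨w, hw, rfl⟩
    change Matrix.mulVec _ (Matrix.mulVec (g : Matrix (Fin 2) (Fin 2) L) w) ∈ _
    rwa [Matrix.mulVec_mulVec, ← Units.val_mul, inv_mul_cancel, Units.val_one, Matrix.one_mulVec]
  · intro h
    refine ⟨_, h, ?_⟩
    change Matrix.mulVec (g : Matrix (Fin 2) (Fin 2) L) (Matrix.mulVec _ f) = _
    rw [Matrix.mulVec_mulVec, ← Units.val_mul, mul_inv_cancel, Units.val_one, Matrix.one_mulVec]

theorem smul_lattice_mono {g : GL (Fin 2) L} {M N : Lattice2} :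
    (g • M).mod ≤ (g • N).mod ↔ M.mod ≤ N.mod := by
  constructor
  · intro h f hf
    have := h (x := Matrix.mulVec (g : Matrix (Fin 2) (Fin 2) L) f) ⟨f, hf, rfl⟩
    rw [mem_smul_lattice, Matrix.mulVec_mulVec, ← Units.val_mul, inv_mul_cancel, Units.val_one,
      Matrix.one_mulVec] at this
    exact this
  · exact fun h => Submodule.map_mono h

theorem smul_std_le_std {g : GL (Fin 2) L} : (g • std).mod ≤ std.mod ↔ IsIntegral g := by
  constructor
  · intro h i j
    have := h (x := Matrix.mulVec (g : Matrix (Fin 2) (Fin 2) L) (Pi.single j 1))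
      ⟨Pi.single j 1, fun k => by
        rcases eq_or_ne k j with rfl | hk
        · simp [one_mem_fracIdeal]
        · simp [hk, zero_mem_fracIdeal], rfl⟩ i
    simpa using this
  · rintro h _ ⟨f, hf, rfl⟩ i
    change Matrix.mulVec (g : Matrix (Fin 2) (Fin 2) L) f i ∈ _
    rw [Matrix.mulVec, dotProduct, Fin.sum_univ_two]
    exact add_mem_fracIdeal (by simpa using mul_mem_fracIdeal (h i 0) (hf 0))
      (by simpa using mul_mem_fracIdeal (h i 1) (hf 1))

/-- Together with `exists_eq_smul_std` this turns all questions about inclusions of lattices into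
questions about the orders of matrix entries. -/
theorem smul_std_le_smul_std {g h : GL (Fin 2) L} :
    (g • std).mod ≤ (h • std).mod ↔ IsIntegral (h⁻¹ * g) := by
  rw [← smul_std_le_std, ← smul_lattice_mono (g := h⁻¹), inv_smul_smul, smul_smul]

theorem smul_std_eq_smul_std {g h : GL (Fin 2) L} :
    g • std = h • std ↔ IsIntegral (h⁻¹ * g) ∧ IsIntegral (g⁻¹ * h) := by
  rw [← smul_std_le_smul_std, ← smul_std_le_smul_std, Lattice2.ext_iff, le_antisymm_iff]

/-- The variable `x` as a unit. -/
def xUnit : Lˣ := Units.mk0 x x_ne_zero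

/-- A nonzero scalar as a matrix. -/
abbrev sc (c : Lˣ) : GL (Fin 2) L := Matrix.GeneralLinearGroup.scalar (Fin 2) c

theorem sc_mul_apply (c : Lˣ) (g : GL (Fin 2) L) (i j : Fin 2) :
    ((sc c * g : GL (Fin 2) L) : Matrix (Fin 2) (Fin 2) L) i j
      = c * (g : Matrix (Fin 2) (Fin 2) L) i j := by
  rw [Units.val_mul]
  change (Matrix.scalar (Fin 2) (c : L) * (g : Matrix (Fin 2) (Fin 2) L)) i j = _
  simp

theorem X_smul_mod (M : Lattice2) : (PowerSeries.X : O) • M.mod = (sc xUnit • M).mod := by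
  have key : ∀ f : Fin 2 → L, (PowerSeries.X : O) • f = glMap (sc xUnit) f := by
    intro f
    change _ = Matrix.mulVec (Matrix.scalar (Fin 2) x) f
    funext i
    rw [Pi.smul_apply, Algebra.smul_def]
    change incl _ * _ = _
    rw [incl_X]
    simp [Matrix.scalar_apply, Matrix.mulVec_diagonal]
  ext f
  rw [Submodule.mem_smul_pointwise_iff_exists]
  constructor
  · rintro ⟨w, hw, rfl⟩
    exact ⟨w, hw, (key w).symm⟩
  · rintro ⟨w, hw, rfl⟩
    exact ⟨w, hw, key w⟩

/-- A lattice is free of rank two over the principal ideal domain `𝔽₂[[x]]`. The columns of `g` are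
a basis of it. -/
theorem exists_eq_smul_std (M : Lattice2) : ∃ g : GL (Fin 2) L, M = g • std := by
  have := M.isLattice
  have hf : Module.Finite O M.mod := inferInstance
  have hfr : Module.Free O M.mod := Submodule.IsLattice.free (K := L) M.mod
  have hr : Module.finrank O M.mod = 2 := by
    simpa using Submodule.IsLattice.finrank_of_pi (K := L) (ι := Fin 2) M.mod
  let b : Module.Basis (Fin 2) O M.mod := Module.finBasisOfFinrankEq O M.mod hr
  let B : Module.Basis (Fin 2) L (Fin 2 → L) := b.extendOfIsLattice L
  let m := (Pi.basisFun L (Fin 2)).toMatrix B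
  have hm : ∀ i j, m i j = (b j : Fin 2 → L) i := by
    intro i j
    change (Pi.basisFun L (Fin 2)).repr (B j) i = _
    rw [Pi.basisFun_repr]
    exact congrFun (Module.Basis.extendOfIsLattice_apply _ _ _) i
  let g : GL (Fin 2) L := ⟨m, B.toMatrix (Pi.basisFun L (Fin 2)),
    Module.Basis.toMatrix_mul_toMatrix_flip _ _, Module.Basis.toMatrix_mul_toMatrix_flip _ _⟩
  have hg : ∀ p : Fin 2 → O, Matrix.mulVec (g : Matrix (Fin 2) (Fin 2) L) (fun i => incl (p i))
      = ((∑ j, p j • b j : M.mod) : Fin 2 → L) := by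
    intro p
    funext i
    simp only [Matrix.mulVec, dotProduct, Fin.sum_univ_two, Submodule.coe_add, Submodule.coe_smul,
      Pi.add_apply]
    rw [Pi.smul_apply, Pi.smul_apply, Algebra.smul_def, Algebra.smul_def]
    change m i 0 * _ + m i 1 * _ = _
    rw [hm, hm]
    ring
  refine ⟨g, Lattice2.ext (le_antisymm ?_ ?_)⟩
  · intro f hf
    refine ⟨fun i => incl (b.repr ⟨f, hf⟩ i), fun i => incl_mem_fracIdeal _, ?_⟩
    exact (hg _).trans (congrArg Subtype.val (b.sum_repr ⟨f, hf⟩))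
  · rintro _ ⟨f, hf, rfl⟩
    choose p hp using fun i => mem_fracIdeal_zero.mp (hf i)
    obtain rfl : f = fun i => incl (p i) := funext hp
    change Matrix.mulVec (g : Matrix (Fin 2) (Fin 2) L) (fun i => incl (p i)) ∈ M.mod
    rw [hg p]
    exact Subtype.property _

/-- The homothety class of the standard lattice. -/
def stdV : BTVertex := Quotient.mk homothety std

theorem sc_one : sc 1 = 1 := map_one _

theorem sc_smul_vertex (c : Lˣ) (v : BTVertex) : sc c • v = v := by
  induction v using Quotient.inductionOn with
  | h M => exact Quotient.sound ⟨c⁻¹, by rw [map_inv, inv_smul_smul]⟩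

theorem exists_smul_stdV (v : BTVertex) : ∃ g : GL (Fin 2) L, v = g • stdV := by
  induction v using Quotient.inductionOn with
  | h M =>
    obtain ⟨g, rfl⟩ := exists_eq_smul_std M
    exact ⟨g, rfl⟩

/-- The stabiliser of the standard vertex consists of the products of a scalar and an element of
`GL₂(𝔽₂[[x]])`; the condition says that `h⁻¹ g` lies in it. -/
theorem smul_stdV_eq_smul_stdV {g h : GL (Fin 2) L} : g • stdV = h • stdV ↔
    ∃ c : Lˣ, IsIntegral (sc c * (h⁻¹ * g)) ∧ IsIntegral (sc c⁻¹ * (g⁻¹ * h)) := by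
  constructor
  · intro e
    obtain ⟨c, hc⟩ := Quotient.exact (s := homothety) e
    have h1 : h • std = (sc c * g) • std := by rw [mul_smul]; exact hc
    obtain ⟨h2, h3⟩ := smul_std_eq_smul_std.mp h1
    refine ⟨c, ?_, ?_⟩
    · rwa [← mul_assoc, ← scalar_mul_comm, mul_assoc]
    · rwa [mul_inv_rev, ← map_inv, scalar_mul_comm, mul_assoc] at h2
  · rintro ⟨c, h1, h2⟩
    refine Quotient.sound ⟨c, ?_⟩
    change h • std = sc c • g • std
    rw [← mul_smul, smul_std_eq_smul_std]
    constructor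
    · rwa [mul_inv_rev, ← map_inv, scalar_mul_comm, mul_assoc]
    · rwa [← mul_assoc, scalar_mul_comm, mul_assoc]

/-! ### Vertices of the tree as balls in `𝔽₂((x))` -/

/-- The matrix with rows `(xⁿ, u)` and `(0, 1)`. -/
def affMat (n : ℤ) (u : L) : GL (Fin 2) L where
  val := !![x ^ n, u; 0, 1]
  inv := !![x ^ (-n), -(x ^ (-n) * u); 0, 1]
  val_inv := by
    have := zpow_ne_zero n x_ne_zero
    rw [zpow_neg]
    ext i j : 2
    fin_cases i <;> fin_cases j <;> simp [Matrix.mul_apply, Fin.sum_univ_two, this]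
  inv_val := by
    have := zpow_ne_zero n x_ne_zero
    rw [zpow_neg]
    ext i j : 2
    fin_cases i <;> fin_cases j <;> simp [Matrix.mul_apply, Fin.sum_univ_two, this]

theorem affMat_mul (n m : ℤ) (u w : L) :
    affMat n u * affMat m w = affMat (n + m) (u + x ^ n * w) := by
  refine Units.ext ?_
  change !![x ^ n, u; 0, 1] * !![x ^ m, w; 0, 1] = !![x ^ (n + m), u + x ^ n * w; 0, 1]
  rw [zpow_add₀ x_ne_zero]
  ext i j : 2
  fin_cases i <;> fin_cases j <;> simp [Matrix.mul_apply, Fin.sum_univ_two, add_comm]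

theorem affMat_zero : affMat 0 0 = 1 := by
  refine Units.ext ?_
  change !![x ^ (0 : ℤ), 0; 0, 1] = 1
  rw [zpow_zero, Matrix.one_fin_two]

theorem affMat_inv (n : ℤ) (u : L) : (affMat n u)⁻¹ = affMat (-n) (-(x ^ (-n) * u)) := by
  rw [inv_eq_iff_mul_eq_one, affMat_mul, ← affMat_zero]
  have := zpow_ne_zero n x_ne_zero
  congr 1
  · ring
  · rw [zpow_neg]
    field_simp
    ring

theorem affMat_inv_mul (n m : ℤ) (u w : L) :
    (affMat n u)⁻¹ * affMat m w = affMat (m - n) (x ^ (-n) * (w - u)) := by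
  rw [affMat_inv, affMat_mul]
  congr 1
  · ring
  · ring

theorem isIntegral_sc_mul_affMat {c : Lˣ} {n : ℤ} {u : L} : IsIntegral (sc c * affMat n u) ↔
    (c : L) * x ^ n ∈ fracIdeal 0 ∧ (c : L) * u ∈ fracIdeal 0 ∧ (c : L) ∈ fracIdeal 0 := by
  unfold IsIntegral
  simp only [sc_mul_apply, Fin.forall_fin_two, affMat]
  simp [zero_mem_fracIdeal, and_assoc]

theorem isIntegral_affMat {n : ℤ} {u : L} : IsIntegral (affMat n u) ↔
    0 ≤ n ∧ u ∈ fracIdeal 0 := by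
  have := isIntegral_sc_mul_affMat (c := 1) (n := n) (u := u)
  rw [sc_one, one_mul] at this
  rw [this]
  simp [one_mem_fracIdeal, zpow_mem_fracIdeal_iff]

theorem exists_eq_zpow_mul_unit_units (c : Lˣ) : ∃ (n : ℤ) (u : Oˣ), (c : L) = x ^ n * incl u :=
  exists_eq_zpow_mul_unit c.ne_zero

theorem inv_eq_of_eq {c : Lˣ} {n : ℤ} {u : Oˣ} (h : (c : L) = x ^ n * incl u) :
    ((c⁻¹ : Lˣ) : L) = x ^ (-n) * incl ((u⁻¹ : Oˣ) : O) := by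
  rw [Units.val_inv_eq_inv_val, h, mul_inv, ← zpow_neg]
  congr 1
  exact inv_eq_of_mul_eq_one_right (by rw [← map_mul, Units.mul_inv, map_one])

/-- The vertex of the lattice spanned by `(xⁿ, 0)` and `(u, 1)`. -/
def vert (n : ℤ) (u : L) : BTVertex := affMat n u • stdV

theorem vert_zero : vert 0 0 = stdV := by rw [vert, affMat_zero, one_smul]

theorem affMat_smul_vert (n m : ℤ) (u w : L) :
    affMat n u • vert m w = vert (n + m) (u + x ^ n * w) := by
  rw [vert, ← mul_smul, affMat_mul, vert]

/-- The vertex `vert n u` corresponds to the ball `u + xⁿ 𝔽₂[[x]]`: equal radius and congruent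
centres characterise equality. -/
theorem vert_eq_iff {n m : ℤ} {u w : L} : vert n u = vert m w ↔ n = m ∧ w - u ∈ fracIdeal n := by
  unfold vert
  rw [smul_stdV_eq_smul_stdV]
  simp only [affMat_inv_mul, isIntegral_sc_mul_affMat]
  constructor
  · rintro ⟨c, ⟨h1, h2, h3⟩, h4, h5, h6⟩
    obtain ⟨k, e, hk⟩ := exists_eq_zpow_mul_unit_units c
    rw [inv_eq_of_eq hk] at h4 h5 h6
    rw [hk] at h1 h2 h3
    rw [zpow_mul_unit_mem] at h3 h6
    -- Both affine matrices have the lower right entry `1`, so `c` and `c⁻¹` are integral and `c` is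
    -- a unit.
    obtain rfl : k = 0 := by omega
    rw [zpow_zero, one_mul, mul_comm, mul_unit_mem_fracIdeal, zpow_mem_fracIdeal_iff] at h1
    rw [neg_zero, zpow_zero, one_mul, mul_comm, mul_unit_mem_fracIdeal] at h4 h5
    rw [zpow_mem_fracIdeal_iff] at h4
    rw [zpow_mul_mem_fracIdeal] at h5
    exact ⟨by omega, by simpa using h5⟩
  · rintro ⟨rfl, h⟩
    refine ⟨1, ?_⟩
    simp only [inv_one, Units.val_one, one_mul, sub_self, zpow_zero, zpow_mul_mem_fracIdeal,
      one_mem_fracIdeal, true_and, and_true]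
    rw [← neg_sub w u]
    constructor
    · simpa using neg_mem_fracIdeal h
    · simpa using h

theorem isIntegral_one : IsIntegral 1 := by
  rw [← affMat_zero, isIntegral_affMat]
  exact ⟨le_rfl, zero_mem_fracIdeal 0⟩

theorem smul_std_of_isIntegral {g : GL (Fin 2) L} (h : IsIntegral g) (h' : IsIntegral g⁻¹) :
    g • std = std := by
  have := smul_std_eq_smul_std (g := g) (h := 1)
  rw [one_smul, inv_one, one_mul, mul_one] at this
  exact this.mpr ⟨h, h'⟩

theorem smul_stdV_of_isIntegral {g : GL (Fin 2) L} (h : IsIntegral g) (h' : IsIntegral g⁻¹) :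
    g • stdV = stdV := congrArg (Quotient.mk homothety) (smul_std_of_isIntegral h h')

/-- The matrix that exchanges the coordinates. -/
def swapMat : GL (Fin 2) L where
  val := !![0, 1; 1, 0]
  inv := !![0, 1; 1, 0]
  val_inv := by simp [Matrix.one_fin_two]
  inv_val := by simp [Matrix.one_fin_two]

/-- A lower unitriangular matrix. -/
def lowMat (e : L) : GL (Fin 2) L where
  val := !![1, 0; e, 1]
  inv := !![1, 0; -e, 1]
  val_inv := by simp [Matrix.one_fin_two]
  inv_val := by simp [Matrix.one_fin_two]

theorem lowMat_inv (e : L) : (lowMat e)⁻¹ = lowMat (-e) := by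
  refine Units.ext ?_
  rfl

theorem isIntegral_lowMat {e : L} (h : e ∈ fracIdeal 0) : IsIntegral (lowMat e) := by
  intro i j
  fin_cases i <;> fin_cases j <;> simp [lowMat, zero_mem_fracIdeal, one_mem_fracIdeal, h]

theorem isIntegral_swapMat : IsIntegral swapMat := by
  intro i j
  fin_cases i <;> fin_cases j <;> simp [swapMat, zero_mem_fracIdeal, one_mem_fracIdeal]

/-- Right multiplication by `GL₂(𝔽₂[[x]])` does not change the vertex. It can exchange the columns,
so that the second bottom entry divides the first, and then clear the first. -/
theorem exists_upper_eq_smul_stdV (g : GL (Fin 2) L) : ∃ h : GL (Fin 2) L,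
    (h : Matrix (Fin 2) (Fin 2) L) 1 0 = 0 ∧ g • stdV = h • stdV := by
  have key : ∀ g : GL (Fin 2) L, (g : Matrix (Fin 2) (Fin 2) L) 1 1 ≠ 0 →
      (g : Matrix (Fin 2) (Fin 2) L) 1 0 * ((g : Matrix (Fin 2) (Fin 2) L) 1 1)⁻¹ ∈ fracIdeal 0 →
      ∃ h : GL (Fin 2) L, (h : Matrix (Fin 2) (Fin 2) L) 1 0 = 0 ∧ g • stdV = h • stdV := by
    intro g h0 h1
    set e := (g : Matrix (Fin 2) (Fin 2) L) 1 0 * ((g : Matrix (Fin 2) (Fin 2) L) 1 1)⁻¹ with he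
    refine ⟨g * lowMat (-e), ?_, ?_⟩
    · rw [Units.val_mul, Matrix.mul_apply, Fin.sum_univ_two]
      simp only [lowMat, Matrix.of_apply, Matrix.cons_val', Matrix.cons_val_zero,
        Matrix.cons_val_one]
      rw [he]
      field_simp
      simp
    · rw [mul_smul, smul_stdV_of_isIntegral (isIntegral_lowMat (neg_mem_fracIdeal h1))]
      rw [lowMat_inv, neg_neg]
      exact isIntegral_lowMat h1
  by_cases h0 : (g : Matrix (Fin 2) (Fin 2) L) 1 1 = 0
  · refine ⟨g * swapMat, ?_, ?_⟩
    · rw [Units.val_mul, Matrix.mul_apply, Fin.sum_univ_two]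
      simp [swapMat, h0]
    · rw [mul_smul, smul_stdV_of_isIntegral isIntegral_swapMat isIntegral_swapMat]
  · rcases mem_fracIdeal_total ((g : Matrix (Fin 2) (Fin 2) L) 1 0) _ h0 with h1 | ⟨h1, h2⟩
    · exact key g h0 h1
    · have e0 : ((g * swapMat : GL (Fin 2) L) : Matrix (Fin 2) (Fin 2) L) 1 0
          = (g : Matrix (Fin 2) (Fin 2) L) 1 1 := by
        rw [Units.val_mul, Matrix.mul_apply, Fin.sum_univ_two]
        simp [swapMat]
      have e1 : ((g * swapMat : GL (Fin 2) L) : Matrix (Fin 2) (Fin 2) L) 1 1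
          = (g : Matrix (Fin 2) (Fin 2) L) 1 0 := by
        rw [Units.val_mul, Matrix.mul_apply, Fin.sum_univ_two]
        simp [swapMat]
      obtain ⟨h, h3, h4⟩ := key (g * swapMat) (by rwa [e1]) (by rwa [e0, e1])
      refine ⟨h, h3, ?_⟩
      rw [← h4, mul_smul, smul_stdV_of_isIntegral isIntegral_swapMat isIntegral_swapMat]

/-- The diagonal matrix with entries `u` and `1`. -/
def unitMat (u : Oˣ) : GL (Fin 2) L where
  val := !![incl u, 0; 0, 1]
  inv := !![incl ((u⁻¹ : Oˣ) : O), 0; 0, 1]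
  val_inv := by
    have : incl (u : O) * incl ((u⁻¹ : Oˣ) : O) = 1 := by rw [← map_mul, Units.mul_inv, map_one]
    rw [Matrix.one_fin_two, Matrix.mul_fin_two, this]
    simp
  inv_val := by
    have : incl ((u⁻¹ : Oˣ) : O) * incl (u : O) = 1 := by rw [← map_mul, Units.inv_mul, map_one]
    rw [Matrix.one_fin_two, Matrix.mul_fin_two, this]
    simp

theorem isIntegral_unitMat (u : Oˣ) : IsIntegral (unitMat u) := by
  intro i j
  fin_cases i <;> fin_cases j
  · exact incl_mem_fracIdeal _
  all_goals simp [unitMat, zero_mem_fracIdeal, one_mem_fracIdeal]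

theorem unitMat_inv (u : Oˣ) : (unitMat u)⁻¹ = unitMat u⁻¹ := by
  refine Units.ext ?_
  rfl

/-- This is the Iwasawa decomposition: an upper triangular matrix is a scalar times an affine matrix
times a diagonal matrix of units. -/
theorem exists_eq_vert (v : BTVertex) : ∃ n u, v = vert n u := by
  obtain ⟨g, rfl⟩ := exists_smul_stdV v
  obtain ⟨h, h0, hv⟩ := exists_upper_eq_smul_stdV g
  rw [hv]
  have hdet : (h : Matrix (Fin 2) (Fin 2) L).det ≠ 0 := by
    have := Matrix.isUnits_det_units h
    exact this.ne_zero
  rw [Matrix.det_fin_two, h0, mul_zero, sub_zero] at hdet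
  set a := (h : Matrix (Fin 2) (Fin 2) L) 0 0 with ha
  set d := (h : Matrix (Fin 2) (Fin 2) L) 1 1 with hd
  have hd0 : d ≠ 0 := right_ne_zero_of_mul hdet
  have ha0 : a ≠ 0 := left_ne_zero_of_mul hdet
  obtain ⟨n, e, he⟩ := exists_eq_zpow_mul_unit (mul_ne_zero ha0 (inv_ne_zero hd0))
  refine ⟨n, (h : Matrix (Fin 2) (Fin 2) L) 0 1 * d⁻¹, ?_⟩
  have hfac : h = sc (Units.mk0 d hd0) * (affMat n ((h : Matrix (Fin 2) (Fin 2) L) 0 1 * d⁻¹) *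
      unitMat e) := by
    refine Units.ext ?_
    ext i j : 2
    rw [sc_mul_apply, Units.val_mul, Matrix.mul_apply, Fin.sum_univ_two]
    fin_cases i <;> fin_cases j
    · simp only [affMat, unitMat, Fin.zero_eta, Matrix.of_apply, Matrix.cons_val',
        Matrix.cons_val_zero,
        Matrix.cons_val_one, mul_zero, add_zero, Units.val_mk0, ← he]
      rw [← ha]
      field_simp
    · simp [affMat, unitMat]
      field_simp
    · simpa [affMat, unitMat] using h0
    · simp [affMat, unitMat, hd]
  have hu : unitMat e • stdV = stdV := smul_stdV_of_isIntegral (isIntegral_unitMat e)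
    (by rw [unitMat_inv]; exact isIntegral_unitMat _)
  conv_lhs => rw [hfac, mul_smul, sc_smul_vertex, mul_smul, hu]
  rfl

/-! ### Adjacency -/

/-- There are representatives `M`, `N` with `x M ⊊ N ⊊ M`. -/
def BTRel (v w : BTVertex) : Prop := ∃ M N : Lattice2, v = Quotient.mk homothety M ∧
    w = Quotient.mk homothety N ∧ (PowerSeries.X : O) • M.mod < N.mod ∧ N.mod < M.mod

theorem smul_lattice_strictMono {g : GL (Fin 2) L} {M N : Lattice2} :
    (g • M).mod < (g • N).mod ↔ M.mod < N.mod := by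
  rw [lt_iff_le_not_ge, lt_iff_le_not_ge, smul_lattice_mono, smul_lattice_mono]

theorem BTRel.smul {v w : BTVertex} (h : BTRel v w) (g : GL (Fin 2) L) : BTRel (g • v) (g • w) := by
  obtain ⟨M, N, rfl, rfl, h1, h2⟩ := h
  refine ⟨g • M, g • N, rfl, rfl, ?_, smul_lattice_strictMono.mpr h2⟩
  rw [X_smul_mod] at h1 ⊢
  rw [smul_smul, ← scalar_mul_comm, ← smul_smul]
  exact smul_lattice_strictMono.mpr h1

theorem BTRel.smul_iff {v w : BTVertex} (g : GL (Fin 2) L) : BTRel (g • v) (g • w) ↔ BTRel v w :=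
  ⟨fun h => by simpa using h.smul g⁻¹, fun h => h.smul g⟩

theorem btRel_stdV_vert {m : ℤ} {t : L} : BTRel stdV (vert m t) ↔
    (m = -1 ∧ t ∈ fracIdeal (-1)) ∨ (m = 1 ∧ t ∈ fracIdeal 0) := by
  -- After a homothety of both lattices `M` is the standard lattice, and the representative of the
  -- other class is determined up to the scalar `c`.
  have key : ∀ c : Lˣ, ((sc xUnit • std).mod < (sc c • affMat m t • std).mod ∧
      (sc c • affMat m t • std).mod < std.mod) →
      (m = -1 ∧ t ∈ fracIdeal (-1)) ∨ (m = 1 ∧ t ∈ fracIdeal 0) := by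
    rintro c ⟨h1, h2⟩
    rw [lt_iff_le_not_ge, smul_smul, smul_std_le_smul_std, smul_std_le_smul_std] at h1
    rw [lt_iff_le_not_ge, smul_smul, smul_std_le_std] at h2
    have e1 : (sc c * affMat m t)⁻¹ * sc xUnit = sc (xUnit * c⁻¹) * affMat (-m)
      (-(x ^ (-m) * t)) := by
      rw [mul_inv_rev, affMat_inv, ← map_inv, mul_assoc, ← map_mul, scalar_mul_comm, mul_comm xUnit]
    have e2 : (sc xUnit)⁻¹ * (sc c * affMat m t) = sc (xUnit⁻¹ * c) * affMat m t := by
      rw [← mul_assoc, ← map_inv, ← map_mul]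
    obtain ⟨h3, h4⟩ := h1
    obtain ⟨h5, h6⟩ := h2
    have e3 : ¬ IsIntegral (sc c⁻¹ * affMat (-m) (-(x ^ (-m) * t))) := by
      intro h
      apply h6
      have : std = (1 : GL (Fin 2) L) • std := (one_smul _ _).symm
      conv_lhs => rw [this]
      rw [smul_std_le_smul_std, mul_one, mul_inv_rev, affMat_inv, ← map_inv, scalar_mul_comm]
      exact h
    rw [e1] at h3
    rw [e2] at h4
    rw [isIntegral_sc_mul_affMat] at h3 h4 h5 e3
    obtain ⟨j, e, hj⟩ := exists_eq_zpow_mul_unit_units c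
    have hxu : ((xUnit * c⁻¹ : Lˣ) : L) = x ^ (1 - j) * incl ((e⁻¹ : Oˣ) : O) := by
      rw [Units.val_mul, inv_eq_of_eq hj, sub_eq_add_neg, zpow_add₀ x_ne_zero, zpow_one, mul_assoc]
      rfl
    have hxc : ((xUnit⁻¹ * c : Lˣ) : L) = x ^ (j - 1) * incl (e : O) := by
      rw [Units.val_mul, hj, sub_eq_add_neg, add_comm, zpow_add₀ x_ne_zero, zpow_neg_one, mul_assoc]
      rfl
    have red : ∀ (i : ℤ) (e : Oˣ) (a : L), x ^ i * incl e * a ∈ fracIdeal 0 ↔ a ∈ fracIdeal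
      (-i) := by
      intro i e a
      rw [mul_right_comm, mul_unit_mem_fracIdeal, zpow_mul_mem_fracIdeal, zero_sub]
    rw [hxu] at h3
    rw [hxc] at h4
    rw [hj] at h5
    rw [inv_eq_of_eq hj] at e3
    simp only [red, zpow_mem_fracIdeal_iff, zpow_mul_unit_mem] at h3 h4 h5 e3
    have hneg : ∀ k, -(x ^ (-m) * t) ∈ fracIdeal k ↔ t ∈ fracIdeal (k + m) := by
      intro k
      constructor
      · intro h
        have := neg_mem_fracIdeal h
        rwa [neg_neg, zpow_mul_mem_fracIdeal, sub_neg_eq_add] at this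
      · intro h
        apply neg_mem_fracIdeal
        rwa [zpow_mul_mem_fracIdeal, sub_neg_eq_add]
    rw [hneg] at h3 e3
    obtain ⟨a1, a2, a3⟩ := h3
    obtain ⟨a4, a5, a6⟩ := h5
    -- The diagonal of the matrix of `N` has the orders `j + m` and `j`, and both lie between `0`
    -- and `1` because `x M ⊆ N ⊆ M`. If the two orders agree, then `N = M` or `N = x M`, which is
    -- excluded.
    have hj01 : j = 0 ∨ j = 1 := by omega
    rcases hj01 with rfl | rfl
    · have hm01 : m = 0 ∨ m = 1 := by omega
      rcases hm01 with rfl | rfl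
      · exact absurd ⟨by omega, by simpa using a5, by omega⟩ e3
      · right
        exact ⟨rfl, by simpa using a5⟩
    · have hm01 : m = 0 ∨ m = -1 := by omega
      rcases hm01 with rfl | rfl
      · exact absurd ⟨by omega, by simpa using a2, by omega⟩ h4
      · left
        exact ⟨rfl, by simpa using a5⟩
  constructor
  · rintro ⟨M, N, hM, hN, h1, h2⟩
    obtain ⟨c, hc⟩ := Quotient.exact (s := homothety) hM
    obtain ⟨d, hd⟩ := Quotient.exact (s := homothety) hN
    change M = sc c • std at hc
    change N = sc d • affMat m t • std at hd
    subst hc hd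
    rw [X_smul_mod] at h1
    apply key (c⁻¹ * d)
    have e : sc d • affMat m t • std = sc c • sc (c⁻¹ * d) • affMat m t • std := by
      rw [← mul_smul (sc c), ← map_mul, mul_inv_cancel_left]
    rw [e] at h1 h2
    rw [smul_smul, ← map_mul, mul_comm, map_mul, mul_smul] at h1
    exact ⟨smul_lattice_strictMono.mp h1, smul_lattice_strictMono.mp h2⟩
  · have e1 : ∀ (h : GL (Fin 2) L), (sc xUnit)⁻¹ * h = sc xUnit⁻¹ * h := fun h => by rw [← map_inv]
    have e2 : ∀ (h : GL (Fin 2) L), h⁻¹ * sc xUnit = sc xUnit * h⁻¹ := fun h => scalar_mul_comm _ _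
    have one : ∀ N : Lattice2, (std.mod ≤ N.mod ↔ ((1 : GL (Fin 2) L) • std).mod ≤ N.mod) :=
      fun N => by rw [one_smul]
    have hx1 : (xUnit : L) = x ^ (1 : ℤ) := (zpow_one x).symm
    have hx2 : ((xUnit⁻¹ : Lˣ) : L) = x ^ (-1 : ℤ) := (zpow_neg_one x).symm
    rintro (⟨rfl, ht⟩ | ⟨rfl, ht⟩)
    · refine ⟨std, sc xUnit • affMat (-1) t • std, rfl, ?_, ?_, ?_⟩
      · exact (sc_smul_vertex xUnit (vert (-1) t)).symm
      · rw [X_smul_mod, smul_lattice_strictMono, lt_iff_le_not_ge, one, smul_std_le_smul_std,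
          smul_std_le_std, mul_one, affMat_inv, isIntegral_affMat, isIntegral_affMat]
        exact ⟨⟨by omega, neg_mem_fracIdeal (zpow_mul_mem_fracIdeal.mpr (by simpa using ht))⟩,
          by omega⟩
      · rw [lt_iff_le_not_ge, one, smul_smul, smul_std_le_std, smul_std_le_smul_std, mul_one,
          mul_inv_rev, ← map_inv, scalar_mul_comm, affMat_inv, isIntegral_sc_mul_affMat,
          isIntegral_sc_mul_affMat, hx1, hx2, zpow_mul_mem_fracIdeal, zpow_mul_mem_fracIdeal,
          zpow_mem_fracIdeal_iff, zpow_mem_fracIdeal_iff, zpow_mem_fracIdeal_iff]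
        exact ⟨⟨by omega, by simpa using ht, by omega⟩, by omega⟩
    · refine ⟨std, affMat 1 t • std, rfl, rfl, ?_, ?_⟩
      · rw [X_smul_mod, lt_iff_le_not_ge, smul_std_le_smul_std, smul_std_le_smul_std, e1, e2,
          affMat_inv, isIntegral_sc_mul_affMat, isIntegral_sc_mul_affMat, hx1, hx2,
          zpow_mul_mem_fracIdeal, zpow_mul_mem_fracIdeal,
          zpow_mem_fracIdeal_iff, zpow_mem_fracIdeal_iff, zpow_mem_fracIdeal_iff]
        exact ⟨⟨by omega, neg_mem_fracIdeal (zpow_mul_mem_fracIdeal.mpr (by simpa using ht)),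
          by omega⟩, by omega⟩
      · rw [lt_iff_le_not_ge, one, smul_std_le_std, smul_std_le_smul_std, mul_one, affMat_inv,
          isIntegral_affMat, isIntegral_affMat]
        exact ⟨⟨by omega, ht⟩, by omega⟩

theorem btRel_vert {n m : ℤ} {u w : L} : BTRel (vert n u) (vert m w) ↔
    (m = n - 1 ∧ w - u ∈ fracIdeal (n - 1)) ∨ (m = n + 1 ∧ w - u ∈ fracIdeal n) := by
  have h1 : vert n u = affMat n u • stdV := rfl
  have h2 : vert m w = affMat n u • vert (m - n) (x ^ (-n) * (w - u)) := by
    rw [affMat_smul_vert, ← mul_assoc, ← zpow_add₀ x_ne_zero]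
    congr 1
    · ring
    · rw [add_neg_cancel, zpow_zero]; ring
  rw [h2, h1, BTRel.smul_iff, btRel_stdV_vert, zpow_mul_mem_fracIdeal, zpow_mul_mem_fracIdeal,
    show (-1 - -n : ℤ) = n - 1 by ring, show (0 - -n : ℤ) = n by ring,
    show m - n = -1 ↔ m = n - 1 by omega, show m - n = 1 ↔ m = n + 1 by omega]

/-- In terms of balls, the neighbours are the next larger ball and the maximal proper subballs. The
relation is already symmetric, so the symmetrisation in `SimpleGraph.fromRel` adds no edges. -/
theorem adj_vert {n m : ℤ} {u w : L} : BTTree.Adj (vert n u) (vert m w) ↔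
    (m = n - 1 ∧ w - u ∈ fracIdeal (n - 1)) ∨ (m = n + 1 ∧ w - u ∈ fracIdeal n) := by
  have h : BTTree.Adj (vert n u) (vert m w) ↔ vert n u ≠ vert m w ∧
    (BTRel (vert n u) (vert m w) ∨ BTRel (vert m w) (vert n u)) := Iff.rfl
  rw [h, btRel_vert, btRel_vert, ne_eq, vert_eq_iff]
  constructor
  · rintro ⟨-, h1 | ⟨rfl, h1⟩ | ⟨rfl, h1⟩⟩
    · exact h1
    · right
      refine ⟨by ring, ?_⟩
      rw [← neg_sub u w]
      exact neg_mem_fracIdeal h1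
    · left
      refine ⟨by ring, ?_⟩
      rw [← neg_sub u w, add_sub_cancel_right]
      exact neg_mem_fracIdeal h1
  · intro h
    exact ⟨by omega, Or.inl h⟩

theorem adj_iff_btRel {v w : BTVertex} : BTTree.Adj v w ↔ BTRel v w := by
  obtain ⟨n, u, rfl⟩ := exists_eq_vert v
  obtain ⟨m, t, rfl⟩ := exists_eq_vert w
  rw [adj_vert, btRel_vert]

theorem adj_smul_iff (g : GL (Fin 2) L) {v w : BTVertex} :
    BTTree.Adj (g • v) (g • w) ↔ BTTree.Adj v w := by
  rw [adj_iff_btRel, adj_iff_btRel, BTRel.smul_iff]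

theorem sub_mem_fracIdeal_comm {n : ℤ} {a b : L} (h : a - b ∈ fracIdeal n) :
    b - a ∈ fracIdeal n := by
  rw [← neg_sub a b]
  exact neg_mem_fracIdeal h

/-! ### The graph is a tree of valency three -/

/-- The level of a vertex: the height of its lattice with respect to the end `(1, 0)`. -/
def level (v : BTVertex) : ℤ := (exists_eq_vert v).choose

theorem level_vert (n : ℤ) (u : L) : level (vert n u) = n := by
  obtain ⟨w, hw⟩ := (exists_eq_vert (vert n u)).choose_spec
  exact ((vert_eq_iff.mp hw).1).symm

/-- A graph with a level function such that every vertex has at most one lower neighbour and no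
neighbour on its own level has no cycles. -/
theorem isAcyclic_of_level {V : Type*} (G : SimpleGraph V) (l : V → ℤ)
    (hl : ∀ v w, G.Adj v w → l w ≠ l v)
    (hu : ∀ v w w', G.Adj v w → G.Adj v w' → l w < l v → l w' < l v → w = w') :
    G.IsAcyclic := by
  classical
  intro v c hc
  -- At a vertex of maximal level on a cycle, both neighbours on the cycle are lower and therefore
  -- equal.
  obtain ⟨t, ht, hmax⟩ := (c.support.toFinset).exists_max_image l ⟨v, by simp⟩
  rw [List.mem_toFinset] at ht
  have hc' := hc.rotate ht
  set d := c.rotate t ht with hd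
  have hsup : ∀ s ∈ d.support, l s ≤ l t := by
    intro s hs
    exact hmax s (by simpa [hd] using hs)
  have h1 : G.Adj t d.snd := d.adj_snd hc'.not_nil
  have h2 : G.Adj t d.penultimate := (d.adj_penultimate hc'.not_nil).symm
  have h3 := hsup d.snd (d.getVert_mem_support 1)
  have h4 := hsup d.penultimate (d.getVert_mem_support _)
  exact hc'.snd_ne_penultimate (hu t _ _ h1 h2 (lt_of_le_of_ne h3 (hl _ _ h1))
    (lt_of_le_of_ne h4 (hl _ _ h2)))

/-- The lower neighbour of a ball is unique: it is the next larger ball. -/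
theorem btTree_isAcyclic : BTTree.IsAcyclic := by
  refine isAcyclic_of_level BTTree level ?_ ?_
  · intro v w h
    obtain ⟨n, u, rfl⟩ := exists_eq_vert v
    obtain ⟨m, t, rfl⟩ := exists_eq_vert w
    rw [adj_vert] at h
    rw [level_vert, level_vert]
    omega
  · intro v w w' h h' hw hw'
    obtain ⟨n, u, rfl⟩ := exists_eq_vert v
    obtain ⟨m, t, rfl⟩ := exists_eq_vert w
    obtain ⟨m', t', rfl⟩ := exists_eq_vert w'
    rw [adj_vert] at h h'
    rw [level_vert, level_vert] at hw hw'
    obtain ⟨rfl, h1⟩ := h.resolve_right (fun h => by omega)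
    obtain ⟨rfl, h2⟩ := h'.resolve_right (fun h => by omega)
    rw [vert_eq_iff]
    refine ⟨rfl, ?_⟩
    simpa using sub_mem_fracIdeal h2 h1

theorem reachable_vert_sub (n : ℤ) (u : L) (k : ℕ) : BTTree.Reachable (vert n u)
    (vert (n - k) u) := by
  induction k with
  | zero => simp
  | succ k ih =>
    refine ih.trans (SimpleGraph.Adj.reachable ?_)
    rw [adj_vert]
    left
    refine ⟨by push_cast; ring, ?_⟩
    rw [sub_self]
    exact zero_mem_fracIdeal _

/-- Any two balls are contained in a common larger ball, which is reached from both by enlarging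
step by step. -/
theorem btTree_connected : BTTree.Connected := by
  have : Nonempty BTVertex := ⟨stdV⟩
  refine ⟨fun v w => ?_⟩
  obtain ⟨n, u, rfl⟩ := exists_eq_vert v
  obtain ⟨m, t, rfl⟩ := exists_eq_vert w
  obtain ⟨k, hk, h⟩ := exists_mem_fracIdeal (t - u) (min n m)
  obtain ⟨i, hi⟩ := Int.le.dest (hk.trans (min_le_left _ _))
  obtain ⟨j, hj⟩ := Int.le.dest (hk.trans (min_le_right _ _))
  have h1 := reachable_vert_sub n u i
  have h2 := reachable_vert_sub m t j
  rw [show n - i = k by omega] at h1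
  rw [show m - j = k by omega] at h2
  rw [vert_eq_iff.mpr ⟨rfl, h⟩] at h1
  exact h1.trans h2.symm

theorem btTree_isTree : BTTree.IsTree := ⟨btTree_connected, btTree_isAcyclic⟩

/-- Besides the next larger ball these are the two halves of the ball, with centres `u` and `u +
xⁿ`. -/
theorem ncard_neighborSet (v : BTVertex) : (BTTree.neighborSet v).ncard = 3 := by
  obtain ⟨n, u, rfl⟩ := exists_eq_vert v
  rw [Set.ncard_eq_three]
  refine ⟨vert (n - 1) u, vert (n + 1) u, vert (n + 1) (u + x ^ n), ?_, ?_, ?_, ?_⟩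
  · rw [ne_eq, vert_eq_iff]; omega
  · rw [ne_eq, vert_eq_iff]; omega
  · rw [ne_eq, vert_eq_iff, add_sub_cancel_left, zpow_mem_fracIdeal_iff]; omega
  · ext w
    obtain ⟨m, t, rfl⟩ := exists_eq_vert w
    rw [SimpleGraph.mem_neighborSet, adj_vert]
    simp only [Set.mem_insert_iff, Set.mem_singleton_iff, vert_eq_iff]
    constructor
    · rintro (⟨rfl, h⟩ | ⟨rfl, h⟩)
      · left
        exact ⟨rfl, sub_mem_fracIdeal_comm h⟩
      · right
        have h' : x ^ (-n) * (t - u) ∈ fracIdeal 0 := zpow_mul_mem_fracIdeal.mpr (by simpa using h)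
        rcases mem_fracIdeal_zero_cases h' with h1 | h1
        · left
          rw [zpow_mul_mem_fracIdeal] at h1
          refine ⟨rfl, ?_⟩
          rw [← neg_sub]
          apply neg_mem_fracIdeal
          convert h1 using 2
          ring
        · right
          refine ⟨rfl, ?_⟩
          have e : t - (u + x ^ n) = x ^ n * (x ^ (-n) * (t - u) - 1) := by
            rw [mul_sub, ← mul_assoc, ← zpow_add₀ x_ne_zero, add_neg_cancel, zpow_zero]
            ring
          rw [← neg_sub, e]
          apply neg_mem_fracIdeal
          rw [zpow_mul_mem_fracIdeal]
          convert h1 using 2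
          ring
    · rintro (⟨rfl, h⟩ | ⟨rfl, h⟩ | ⟨rfl, h⟩)
      · left
        exact ⟨rfl, sub_mem_fracIdeal_comm h⟩
      · right
        refine ⟨rfl, ?_⟩
        rw [← neg_sub]
        exact neg_mem_fracIdeal (fracIdeal_anti (by omega) h)
      · right
        refine ⟨rfl, ?_⟩
        have e : t - u = x ^ n - (u + x ^ n - t) := by ring
        rw [e]
        exact sub_mem_fracIdeal (zpow_mem_fracIdeal n) (fracIdeal_anti (by omega) h)

theorem pgl_mk_smul (g : GL (Fin 2) L) (v : BTVertex) :
    (Matrix.ProjGenLinGroup.mk g : PGL(2, L)) • v = g • v := rfl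

theorem pgl_adj_iff (g : PGL(2, L)) (v w : BTVertex) :
    BTTree.Adj (g • v) (g • w) ↔ BTTree.Adj v w := by
  obtain ⟨g, rfl⟩ := Matrix.ProjGenLinGroup.mk_surjective g
  rw [pgl_mk_smul, pgl_mk_smul, adj_smul_iff]

/-! ### Groups acting on trees -/

section Trees

variable {V : Type*} {G : SimpleGraph V}

theorem dist_eq_length_of_isPath (hG : G.IsTree) {v w : V} {p : G.Walk v w} (hp : p.IsPath) :
    G.dist v w = p.length := by
  obtain ⟨q, hq, hl⟩ := (hG.connected v w).exists_path_of_dist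
  rw [← hl]
  have := hG.isAcyclic.subsingleton_path v w
  exact congrArg (fun r : G.Path v w => r.1.length) (Subsingleton.elim ⟨q, hq⟩ ⟨p, hp⟩)

/-- A sequence of vertices of a tree without backtracking is a geodesic. -/
theorem dist_eq_of_not_backtracking (hG : G.IsTree) (s : ℕ → V) (n : ℕ)
    (h1 : ∀ i < n, G.Adj (s i) (s (i + 1))) (h2 : ∀ i, i + 2 ≤ n → s (i + 2) ≠ s i) :
    G.dist (s n) (s 0) = n := by
  -- The walk leads back from `s k` to `s 0`, so that each new edge is put in front. Absence of
  -- backtracking says that consecutive edges differ, and in an acyclic graph this makes the walk a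
  -- path. The description of the first edge is vacuous for `k = 0`.
  have key : ∀ k ≤ n, ∃ p : G.Walk (s k) (s 0), p.edges.IsChain (· ≠ ·) ∧ p.length = k ∧
      ∀ e ∈ p.edges.head?, e = s(s k, s (k - 1)) := by
    intro k
    induction k with
    | zero => exact fun _ => ⟨SimpleGraph.Walk.nil, by simp⟩
    | succ k ih =>
      intro hk
      obtain ⟨p, hp, hl, he⟩ := ih (by omega)
      refine ⟨SimpleGraph.Walk.cons (h1 k (by omega)).symm p, ?_, by simp [hl], by simp⟩
      rw [SimpleGraph.Walk.edges_cons, List.isChain_cons]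
      refine ⟨fun e hm => ?_, hp⟩
      have hk0 : k ≠ 0 := by
        rintro rfl
        rw [SimpleGraph.Walk.length_eq_zero_iff] at hl
        simp [SimpleGraph.Walk.edges, SimpleGraph.Walk.eq_nil_iff_nil.mpr hl] at hm
      rw [he e hm]
      intro heq
      obtain ⟨j, rfl⟩ := Nat.exists_eq_succ_of_ne_zero hk0
      rw [Sym2.eq_iff] at heq
      rcases heq with ⟨h3, h4⟩ | ⟨h3, h4⟩
      · exact (h1 (j + 1) (by omega)).ne h3.symm
      · exact h2 j (by omega) h3
  obtain ⟨p, hp, hl, -⟩ := key n le_rfl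
  rw [dist_eq_length_of_isPath hG ((hG.isAcyclic.isPath_iff_isChain p).mpr hp), hl]

variable {P : Type*} [Group P] [MulAction P V]

theorem dist_smul_le (hG : G.IsTree) (hact : ∀ (g : P) (v w : V), G.Adj v w → G.Adj (g • v) (g • w))
    (g : P) (v w : V) : G.dist (g • v) (g • w) ≤ G.dist v w := by
  obtain ⟨q, hl⟩ := (hG.connected v w).exists_walk_length_eq_dist
  let f : G →g G := ⟨fun v => g • v, fun {v w} h => hact g v w h⟩
  have := SimpleGraph.dist_le (q.map f)
  rwa [SimpleGraph.Walk.length_map, hl] at this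

/-- An automorphism of finite order of a tree which moves all vertices by an even distance has a
fixed vertex. -/
theorem exists_fixed_vertex (hG : G.IsTree)
    (hact : ∀ (g : P) (v w : V), G.Adj v w → G.Adj (g • v) (g • w)) (g : P) (n : ℕ) (hn : 0 < n)
    (hg : g ^ n = 1) (heven : ∀ v, Even (G.dist v (g • v))) : ∃ v : V, g • v = v := by
  obtain ⟨v₀⟩ := hG.connected.nonempty
  -- Choose a vertex of minimal displacement. If the displacement `d` is positive, the translates of
  -- the geodesic from `v` to `g v` join to a line without backtracking; then `gⁿ v` has distance `d
  -- n` from `v`, which contradicts `gⁿ = 1`.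
  obtain ⟨v, -, hv⟩ := exists_minimalFor_of_wellFoundedLT (fun _ : V => True)
    (fun v => G.dist v (g • v)) ⟨v₀, trivial⟩
  have hmin : ∀ w, G.dist v (g • v) ≤ G.dist w (g • w) := fun w => by
    rcases le_total (G.dist v (g • v)) (G.dist w (g • w)) with h | h
    · exact h
    · exact hv trivial h
  obtain ⟨p, hp, hl⟩ := (hG.connected v (g • v)).exists_path_of_dist
  by_cases hd0 : G.dist v (g • v) = 0
  · exact ⟨v, ((hG.connected.dist_eq_zero_iff).mp hd0).symm⟩
  exfalso
  set d := G.dist v (g • v) with hd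
  -- Evenness excludes `d = 1`, the inversion of an edge.
  have hd2 : 2 ≤ d := by
    obtain ⟨k, hk⟩ := heven v
    omega
  have hdpos : 0 < d := by omega
  have hinj : ∀ i j, i ≤ d → j ≤ d → p.getVert i = p.getVert j → i = j := by
    intro i j hi hj h
    exact hp.getVert_injOn (by simpa [hl] using hi) (by simpa [hl] using hj) h
  -- The concatenation of the translates: each block of `d` steps is a copy of the geodesic `p`,
  -- moved by the next power of `g`.
  let s : ℕ → V := fun i => g ^ (i / d) • p.getVert (i % d)
  have hs1 : ∀ i, s (i + 1) = g ^ (i / d) • p.getVert (i % d + 1) := by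
    intro i
    change g ^ ((i + 1) / d) • p.getVert ((i + 1) % d) = _
    have hlt := Nat.mod_lt i hdpos
    have hi := Nat.div_add_mod i d
    by_cases hr : i % d + 1 = d
    · have e : i + 1 = d * (i / d + 1) := by rw [mul_add, mul_one]; omega
      rw [hr, e, Nat.mul_div_cancel_left _ hdpos, Nat.mul_mod_right, SimpleGraph.Walk.getVert_zero,
        ← hl, SimpleGraph.Walk.getVert_length, smul_smul, pow_succ]
    · have e : i + 1 = (i % d + 1) + d * (i / d) := by omega
      have h3 : (i + 1) / d = i / d := by
        rw [e, Nat.add_mul_div_left _ _ hdpos, Nat.div_eq_of_lt (by omega), zero_add]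
      have h4 : (i + 1) % d = i % d + 1 := by
        rw [e, Nat.add_mul_mod_self_left, Nat.mod_eq_of_lt (by omega)]
      rw [h3, h4]
  have hadj : ∀ i, G.Adj (s i) (s (i + 1)) := by
    intro i
    rw [hs1]
    exact hact _ _ _ (p.adj_getVert_succ (by rw [hl]; exact Nat.mod_lt i hdpos))
  have hnb : ∀ i, s (i + 2) ≠ s i := by
    intro i h
    have hlt := Nat.mod_lt i hdpos
    have hi := Nat.div_add_mod i d
    rw [show i + 2 = (i + 1) + 1 from rfl, hs1] at h
    change _ = g ^ (i / d) • p.getVert (i % d) at h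
    -- Backtracking could only occur at the joint of two translates. There it would mean that `g`
    -- maps the first interior vertex of `p` to the last one, a displacement of at most `d - 2`,
    -- against minimality.
    by_cases hr : i % d + 1 = d
    · have e : i + 1 = d * (i / d + 1) := by rw [mul_add, mul_one]; omega
      rw [e, Nat.mul_div_cancel_left _ hdpos, Nat.mul_mod_right, pow_succ, mul_smul,
        smul_left_cancel_iff, zero_add, show i % d = d - 1 by omega] at h
      have h5 := hmin (p.getVert 1)
      rw [h] at h5
      have h6 : G.dist (p.getVert 1) (p.getVert (d - 1)) ≤ d - 2 := by
        have h7 : ∀ k, G.dist (p.getVert 1) (p.getVert (1 + k)) ≤ k := by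
          intro k
          induction k with
          | zero => simp
          | succ k ih =>
            refine (hG.connected.dist_triangle (v := p.getVert (1 + k))).trans ?_
            refine add_le_add ih ?_
            by_cases hk : 1 + k < p.length
            · exact (SimpleGraph.dist_eq_one_iff_adj.mpr (p.adj_getVert_succ hk)).le
            · rw [p.getVert_of_length_le (by omega), p.getVert_of_length_le (by omega)]
              simp
        have := h7 (d - 2)
        rwa [show 1 + (d - 2) = d - 1 by omega] at this
      omega
    · have e : i + 1 = (i % d + 1) + d * (i / d) := by omega
      have h3 : (i + 1) / d = i / d := by
        rw [e, Nat.add_mul_div_left _ _ hdpos, Nat.div_eq_of_lt (by omega), zero_add]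
      have h4 : (i + 1) % d = i % d + 1 := by
        rw [e, Nat.add_mul_mod_self_left, Nat.mod_eq_of_lt (by omega)]
      rw [h3, h4, smul_left_cancel_iff] at h
      have := hinj _ _ (by omega) (by omega) h
      omega
  have h := dist_eq_of_not_backtracking hG s (d * n) (fun i _ => hadj i) (fun i _ => hnb i)
  have e0 : s 0 = v := by simp [s]
  have e1 : s (d * n) = v := by
    change g ^ (d * n / d) • p.getVert (d * n % d) = v
    rw [Nat.mul_div_cancel_left _ hdpos, Nat.mul_mod_right, hg, one_smul,
      SimpleGraph.Walk.getVert_zero]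
  rw [e0, e1, SimpleGraph.dist_self] at h
  have : 0 < d * n := Nat.mul_pos hdpos hn
  omega

/-- A set `A` of group elements that is closed under inversion and maps a vertex `v` bijectively to
its neighbours. -/
structure IsLocallyTransitive (G : SimpleGraph V) (v : V) (A : Set P) : Prop where
  inv_mem : ∀ a ∈ A, a⁻¹ ∈ A
  image_eq : (fun a : P => a • v) '' A = G.neighborSet v
  injOn : Set.InjOn (fun a : P => a • v) A

/-- A word in `A` without cancellations. -/
def IsReduced (A : Set P) (l : List P) : Prop :=
  (∀ a ∈ l, a ∈ A) ∧ l.IsChain fun a b => a * b ≠ 1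

theorem exists_isReduced {A : Set P} (hA : ∀ a ∈ A, a⁻¹ ∈ A) {g : P}
    (hg : g ∈ Subgroup.closure A) : ∃ l, IsReduced A l ∧ l.prod = g := by
  have cons : ∀ a ∈ A, ∀ l, IsReduced A l → ∃ l', IsReduced A l' ∧ l'.prod = a * l.prod := by
    intro a ha l hl
    match l, hl with
    | [], _ => exact ⟨[a], ⟨by simpa using ha, by simp⟩, by simp⟩
    | b :: l, ⟨h1, h2⟩ =>
      by_cases hab : a * b = 1
      · refine ⟨l, ⟨fun c hc => h1 c (List.mem_cons_of_mem _ hc), h2.tail⟩, ?_⟩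
        rw [List.prod_cons, ← mul_assoc, hab, one_mul]
      · refine ⟨a :: b :: l, ⟨?_, List.isChain_cons_cons.mpr ⟨hab, h2⟩⟩, by simp⟩
        intro c hc
        rcases List.mem_cons.mp hc with rfl | hc
        · exact ha
        · exact h1 c hc
  induction hg using Subgroup.closure_induction_left with
  | one => exact ⟨[], ⟨by simp, by simp⟩, rfl⟩
  | mul_left a ha y _ ih =>
    obtain ⟨l, hl, rfl⟩ := ih
    exact cons a ha l hl
  | inv_mul_cancel a ha y _ ih =>
    obtain ⟨l, hl, rfl⟩ := ih
    exact cons _ (hA a ha) l hl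

/-- The partial products of the word move `v` along a sequence of adjacent vertices. It does not
turn back, because `a b v = v` gives `b v = a⁻¹ v`, hence `b = a⁻¹` by injectivity on `A`, a
cancellation. -/
theorem dist_prod_smul (hG : G.IsTree)
    (hact : ∀ (g : P) (v w : V), G.Adj v w → G.Adj (g • v) (g • w)) {v : V} {A : Set P}
    (hA : IsLocallyTransitive G v A) {l : List P} (hl : IsReduced A l) :
    G.dist (l.prod • v) v = l.length := by
  have h := dist_eq_of_not_backtracking hG (fun i => (l.take i).prod • v) l.length ?_ ?_
  · simpa using h
  · intro i hi
    have e : (l.take (i + 1)).prod = (l.take i).prod * l[i] := by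
      rw [List.prod_take_succ]
    change G.Adj _ _
    rw [e, mul_smul]
    apply hact
    have : l[i] • v ∈ (fun a : P => a • v) '' A := ⟨_, hl.1 _ (List.getElem_mem hi), rfl⟩
    rw [hA.image_eq] at this
    exact this
  · intro i hi h
    have e : (l.take (i + 2)).prod = (l.take i).prod * (l[i] * l[i + 1]) := by
      rw [List.prod_take_succ l (i + 1) (by omega), List.prod_take_succ l i (by omega), mul_assoc]
    change (l.take (i + 2)).prod • v = (l.take i).prod • v at h
    rw [e, mul_smul, smul_left_cancel_iff, mul_smul] at h
    have h2 : l[i + 1] • v = l[i]⁻¹ • v := by rw [← h, inv_smul_smul, h]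
    have h3 := hA.injOn (hl.1 _ (List.getElem_mem _))
      (hA.inv_mem _ (hl.1 _ (List.getElem_mem _))) h2
    exact (List.isChain_iff_getElem.mp hl.2 i (by omega)) (by rw [h3, mul_inv_cancel])

theorem exists_mem_closure_smul (hG : G.Connected)
    (hact : ∀ (g : P) (v w : V), G.Adj v w → G.Adj (g • v) (g • w)) {v : V} {A : Set P}
    (hA : IsLocallyTransitive G v A) (w : V) : ∃ g ∈ Subgroup.closure A, g • v = w := by
  obtain ⟨p⟩ := hG.preconnected w v
  induction p with
  | nil => exact ⟨1, one_mem _, one_smul _ _⟩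
  | @cons a b c h p ih =>
    obtain ⟨g, hg, rfl⟩ := ih hA
    have h1 : g⁻¹ • a ∈ G.neighborSet c := by
      have := hact g⁻¹ _ _ h
      rw [inv_smul_smul] at this
      exact this.symm
    rw [← hA.image_eq] at h1
    obtain ⟨a', ha', h2⟩ := h1
    refine ⟨g * a', mul_mem hg (Subgroup.subset_closure ha'), ?_⟩
    change a' • c = _ at h2
    rw [mul_smul, h2, smul_inv_smul]

/-- If `B A ⊆ A B`, then every element of the group generated by `A` and `B` is the product of a
word in `A` and a word in `B`. -/
theorem exists_mul_of_swap {A B : Set P} (hA : ∀ a ∈ A, a⁻¹ ∈ A) (hB : ∀ b ∈ B, b⁻¹ ∈ B)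
    (hgen : Subgroup.closure (A ∪ B) = ⊤)
    (hswap : ∀ b ∈ B, ∀ a ∈ A, ∃ a' ∈ A, ∃ b' ∈ B, b * a = a' * b') (g : P) :
    ∃ α ∈ Subgroup.closure A, ∃ β ∈ Subgroup.closure B, g = α * β := by
  -- One letter of `B` passes through a whole word in `A` and remains a single letter of `B`.
  have move : ∀ α ∈ Subgroup.closure A, ∀ b ∈ B, ∃ α' ∈ Subgroup.closure A, ∃ b' ∈ B,
      b * α = α' * b' := by
    intro α hα
    have step : ∀ a ∈ A, ∀ y, (∀ b ∈ B, ∃ α' ∈ Subgroup.closure A, ∃ b' ∈ B, b * y = α' * b') →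
        ∀ b ∈ B, ∃ α' ∈ Subgroup.closure A, ∃ b' ∈ B, b * (a * y) = α' * b' := by
      intro a ha y ih b hb
      obtain ⟨a', ha', b', hb', h⟩ := hswap b hb a ha
      obtain ⟨α', hα', b'', hb'', h'⟩ := ih b' hb'
      refine ⟨a' * α', mul_mem (Subgroup.subset_closure ha') hα', b'', hb'', ?_⟩
      rw [← mul_assoc, h, mul_assoc, h', mul_assoc]
    induction hα using Subgroup.closure_induction_left with
    | one => exact fun b hb => ⟨1, one_mem _, b, hb, by simp⟩
    | mul_left a ha y _ ih => exact step a ha y ih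
    | inv_mul_cancel a ha y _ ih => exact step _ (hA a ha) y ih
  have step : ∀ c ∈ A ∪ B, ∀ y, (∃ α ∈ Subgroup.closure A, ∃ β ∈ Subgroup.closure B, y = α * β) →
      ∃ α ∈ Subgroup.closure A, ∃ β ∈ Subgroup.closure B, c * y = α * β := by
    rintro c (hc | hc) _ ⟨α, hα, β, hβ, rfl⟩
    · exact ⟨c * α, mul_mem (Subgroup.subset_closure hc) hα, β, hβ, (mul_assoc _ _ _).symm⟩
    · obtain ⟨α', hα', b', hb', h⟩ := move α hα c hc
      exact ⟨α', hα', b' * β, mul_mem (Subgroup.subset_closure hb') hβ, by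
        rw [← mul_assoc, h, mul_assoc]⟩
  have hg : g ∈ Subgroup.closure (A ∪ B) := hgen ▸ Subgroup.mem_top g
  induction hg using Subgroup.closure_induction_left with
  | one => exact ⟨1, one_mem _, 1, one_mem _, by simp⟩
  | mul_left c hc y _ ih => exact step c hc y ih
  | inv_mul_cancel c hc y _ ih =>
    exact step _ (hc.imp (hA c) (hB c)) y ih

end Trees

/-! ### Normal forms and simple transitivity on a product of two trees -/

section TwoTrees

variable {V W : Type*} {G : SimpleGraph V} {H : SimpleGraph W} {P : Type*} [Group P]
  [MulAction P V] [MulAction P W]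

/-- A pair of sets which act locally simply transitively on two trees. -/
structure IsTreePair (G : SimpleGraph V) (H : SimpleGraph W) (v : V) (w : W) (A B : Set P) :
    Prop where
  treeL : G.IsTree
  treeR : H.IsTree
  adjL : ∀ (g : P) (a b : V), G.Adj a b → G.Adj (g • a) (g • b)
  adjR : ∀ (g : P) (a b : W), H.Adj a b → H.Adj (g • a) (g • b)
  locL : IsLocallyTransitive G v A
  locR : IsLocallyTransitive H w B
  fixL : ∀ b ∈ B, b • v = v
  fixR : ∀ a ∈ A, a • w = w
  gen : Subgroup.closure (A ∪ B) = ⊤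
  swap : ∀ b ∈ B, ∀ a ∈ A, ∃ a' ∈ A, ∃ b' ∈ B, b * a = a' * b'

namespace IsTreePair

variable {v : V} {w : W} {A B : Set P}

theorem exists_reduced (h : IsTreePair G H v w A B) (g : P) : ∃ l m, IsReduced A l ∧
    IsReduced B m ∧ g = l.prod * m.prod := by
  obtain ⟨α, hα, β, hβ, rfl⟩ := exists_mul_of_swap h.locL.inv_mem h.locR.inv_mem h.gen h.swap g
  obtain ⟨l, hl, rfl⟩ := exists_isReduced h.locL.inv_mem hα
  obtain ⟨m, hm, rfl⟩ := exists_isReduced h.locR.inv_mem hβ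
  exact ⟨l, m, hl, hm, rfl⟩

theorem smul_eq_of_mem_closure {X : Type*} [MulAction P X] {x : X} {S : Set P}
    (hS : ∀ b ∈ S, b • x = x) {g : P} (hg : g ∈ Subgroup.closure S) : g • x = x := by
  have : Subgroup.closure S ≤ MulAction.stabilizer P x := (Subgroup.closure_le _).mpr hS
  exact this hg

theorem prod_smul_left (h : IsTreePair G H v w A B) {m : List P} (hm : IsReduced B m) :
    m.prod • v = v :=
  smul_eq_of_mem_closure h.fixL
    (Subgroup.list_prod_mem _ fun b hb => Subgroup.subset_closure (hm.1 b hb))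

theorem prod_smul_right (h : IsTreePair G H v w A B) {l : List P} (hl : IsReduced A l) :
    l.prod • w = w :=
  smul_eq_of_mem_closure h.fixR
    (Subgroup.list_prod_mem _ fun b hb => Subgroup.subset_closure (hl.1 b hb))

/-- The word in `B` fixes `v`, so only the word in `A` contributes to the distance. -/
theorem dist_left (h : IsTreePair G H v w A B) {l m : List P} (hl : IsReduced A l)
    (hm : IsReduced B m) :
    G.dist ((l.prod * m.prod) • v) v = l.length := by
  rw [mul_smul, h.prod_smul_left hm, dist_prod_smul h.treeL h.adjL h.locL hl]

theorem dist_right (h : IsTreePair G H v w A B) {l m : List P} (hl : IsReduced A l)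
    (hm : IsReduced B m) :
    H.dist ((l.prod * m.prod) • w) w = m.length := by
  have h1 : H.dist ((l.prod * m.prod) • w) w = H.dist (l.prod • m.prod • w) (l.prod • w) := by
    rw [mul_smul, h.prod_smul_right hl]
  have h2 : H.dist (m.prod • w) w ≤ H.dist (l.prod • m.prod • w) (l.prod • w) := by
    have := dist_smul_le h.treeR h.adjR l.prod⁻¹ (l.prod • m.prod • w) (l.prod • w)
    rwa [inv_smul_smul, inv_smul_smul] at this
  rw [h1, le_antisymm (dist_smul_le h.treeR h.adjR _ _ _) h2,
    dist_prod_smul h.treeR h.adjR h.locR hm]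

/-- The lengths of both words of the normal form are distances, here zero. No faithfulness is
assumed, so this also detects when an abstract group acts faithfully. -/
theorem eq_one_of_smul_eq (h : IsTreePair G H v w A B) {g : P} (hv : g • v = v) (hw : g • w = w) :
    g = 1 := by
  obtain ⟨l, m, hl, hm, rfl⟩ := h.exists_reduced g
  have h1 := h.dist_left hl hm
  have h2 := h.dist_right hl hm
  rw [hv, SimpleGraph.dist_self] at h1
  rw [hw, SimpleGraph.dist_self] at h2
  rw [List.eq_nil_of_length_eq_zero h1.symm, List.eq_nil_of_length_eq_zero h2.symm]
  simp

/-- Reach `a` by `α` in the group of `A`, then correct in the other tree by `β` in the group of `B`.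
Since `β` acts first and fixes `v`, it does not disturb what was achieved. -/
theorem exists_smul_eq (h : IsTreePair G H v w A B) (a : V) (b : W) : ∃ g : P, g • v = a ∧ g • w =
    b := by
  obtain ⟨α, hα, rfl⟩ := exists_mem_closure_smul h.treeL.connected h.adjL h.locL a
  obtain ⟨β, hβ, hb⟩ := exists_mem_closure_smul h.treeR.connected h.adjR h.locR (α⁻¹ • b)
  refine ⟨α * β, ?_, ?_⟩
  · rw [mul_smul, smul_eq_of_mem_closure h.fixL hβ]
  · rw [mul_smul, hb, smul_inv_smul]

end IsTreePair

end TwoTrees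

/-! ### The generators in the two completions -/

/-- The hypothesis is a factorisation of `g` as scalar times affine matrix times an element of
`GL₂(𝔽₂[[x]])`. In the applications below the entries `a, b, c, d` are those of the third factor,
obtained by dividing out the first two. -/
theorem smul_stdV_eq_vert {g : GL (Fin 2) L} {n : ℤ} {u k : L} {a b c d : O} (hk : k ≠ 0)
    (hdet : IsUnit (a * d - b * c))
    (hg : (g : Matrix (Fin 2) (Fin 2) L) =
      k • !![x ^ n * incl a + u * incl c, x ^ n * incl b + u * incl d; incl c, incl d]) :
    g • stdV = vert n u := by
  obtain ⟨e, he⟩ := hdet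
  have he1 : incl (e : O) * incl ((e⁻¹ : Oˣ) : O) = 1 := by rw [← map_mul, Units.mul_inv, map_one]
  have he2 : incl (e : O) = incl a * incl d - incl b * incl c := by
    rw [he, map_sub, map_mul, map_mul]
  let m : GL (Fin 2) L :=
    { val := !![incl a, incl b; incl c, incl d]
      inv := incl ((e⁻¹ : Oˣ) : O) • !![incl d, -incl b; -incl c, incl a]
      val_inv := by
        rw [Matrix.mul_smul, Matrix.mul_fin_two, Matrix.one_fin_two]
        ext i j : 1
        fin_cases i <;> fin_cases j <;> simp only [Matrix.smul_apply, smul_eq_mul, Fin.zero_eta,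
          Fin.mk_one, Matrix.of_apply, Matrix.cons_val', Matrix.cons_val_zero, Matrix.cons_val_one]
        · linear_combination he1 - incl ((e⁻¹ : Oˣ) : O) * he2
        · ring
        · ring
        · linear_combination he1 - incl ((e⁻¹ : Oˣ) : O) * he2
      inv_val := by
        rw [Matrix.smul_mul, Matrix.mul_fin_two, Matrix.one_fin_two]
        ext i j : 1
        fin_cases i <;> fin_cases j <;> simp only [Matrix.smul_apply, smul_eq_mul, Fin.zero_eta,
          Fin.mk_one, Matrix.of_apply, Matrix.cons_val', Matrix.cons_val_zero, Matrix.cons_val_one]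
        · linear_combination he1 - incl ((e⁻¹ : Oˣ) : O) * he2
        · ring
        · ring
        · linear_combination he1 - incl ((e⁻¹ : Oˣ) : O) * he2 }
  have h1 : IsIntegral m := by
    intro i j
    fin_cases i <;> fin_cases j <;> exact incl_mem_fracIdeal _
  have h2 : IsIntegral m⁻¹ := by
    intro i j
    change (incl ((e⁻¹ : Oˣ) : O) • !![incl d, -incl b; -incl c, incl a]) i j ∈ _
    rw [Matrix.smul_apply, smul_eq_mul, ← zero_add (0 : ℤ)]
    refine mul_mem_fracIdeal (incl_mem_fracIdeal _) ?_
    fin_cases i <;> fin_cases j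
    · exact incl_mem_fracIdeal _
    · exact neg_mem_fracIdeal (incl_mem_fracIdeal _)
    · exact neg_mem_fracIdeal (incl_mem_fracIdeal _)
    · exact incl_mem_fracIdeal _
  have h3 : g = sc (Units.mk0 k hk) * (affMat n u * m) := by
    refine Units.ext ?_
    ext i j : 1
    rw [sc_mul_apply, hg, Units.val_mul]
    change _ = k * (!![x ^ n, u; 0, 1] * !![incl a, incl b; incl c, incl d]) i j
    rw [Matrix.mul_fin_two, Matrix.smul_apply, smul_eq_mul, zero_mul, zero_mul, zero_add, zero_add,
      one_mul, one_mul]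
  rw [h3, mul_smul, sc_smul_vertex, mul_smul, smul_stdV_of_isIntegral h1 h2, vert]

theorem liftQ_apply (φ MI MJ hI hJ hJI) (q : Q) :
    liftQ φ MI MJ hI hJ hJI q = φ q.re • (1 : Matrix (Fin 2) (Fin 2) L) + φ q.imI • MI
      + φ q.imJ • MJ + φ q.imK • (MI * MJ) := by
  let : Algebra K L := φ.toAlgebra
  have h : ∀ (c : K) (M : Matrix (Fin 2) (Fin 2) L), c • M = φ c • M := by
    intro c M
    ext i j : 1
    rfl
  change algebraMap K (Matrix (Fin 2) (Fin 2) L) q.re + q.imI • MI + q.imJ • MJ + q.imK •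
    (MI * MJ) = _
  rw [h, h, h, Algebra.algebraMap_eq_smul_one, h]

theorem rho0_apply (q : Q) : rho0 q =
    !![phi0 q.re + phi0 q.imI * x,
       (phi0 q.imJ + phi0 q.imK * x) * phi0 (1 + z ^ 3);
       phi0 q.imJ + phi0 q.imK * (1 + x), phi0 q.re + phi0 q.imI * (1 + x)] := by
  unfold rho0
  rw [liftQ_apply]
  ext i j : 1
  fin_cases i <;> fin_cases j <;> simp
  ring

/-- The variable `u = t² + t = z⁻¹`. -/
abbrev uInf : L := x ^ 2 + x

theorem rhoInf_apply (q : Q) : rhoInf q =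
    !![phiInf q.re + phiInf q.imI * (1 + uInf + x) + phiInf q.imK * ((1 + uInf ^ 3) * uInf⁻¹ ^ 2),
       phiInf q.imI * (1 + uInf ^ 3) + phiInf q.imJ * (uInf⁻¹ + uInf ^ 2)
        + phiInf q.imK * ((1 + uInf + x) * (uInf⁻¹ + uInf ^ 2));
       phiInf q.imI * uInf⁻¹ + phiInf q.imJ * uInf⁻¹ ^ 2 + phiInf q.imK * ((uInf + x) * uInf⁻¹ ^ 2),
       phiInf q.re + phiInf q.imI * (uInf + x) + phiInf q.imK *
         (uInf⁻¹ * (uInf⁻¹ + uInf ^ 2))] := by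
  unfold rhoInf
  rw [liftQ_apply]
  ext i j : 1
  fin_cases i <;> fin_cases j <;> simp

/-- The power series `(1 + X)⁻¹`. -/
def wSer : O := PowerSeries.invOfUnit (1 + PowerSeries.X) 1

theorem mul_wSer : (1 + PowerSeries.X) * wSer = 1 :=
  PowerSeries.mul_invOfUnit _ _ (by simp)

theorem constantCoeff_wSer : PowerSeries.constantCoeff wSer = 1 := by
  have := congrArg PowerSeries.constantCoeff mul_wSer
  simpa using this

theorem incl_wSer : (1 + x) * incl wSer = 1 := by
  have := congrArg incl mul_wSer
  rwa [map_mul, map_add, map_one, incl_X] at this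

theorem uInf_inv : uInf⁻¹ = x⁻¹ * incl wSer := by
  refine inv_eq_of_mul_eq_one_right ?_
  have h1 := incl_wSer
  have h2 := mul_inv_cancel₀ x_ne_zero
  linear_combination x * x⁻¹ * h1 + h2

/-- Over `𝔽₂[[x]]` a determinant is a unit as soon as its constant coefficient is `1`, so only the
constant coefficients of the witnesses matter. -/
theorem rho_unit_eq_vert {ρ : Q →+* Matrix (Fin 2) (Fin 2) L} {h} {U : Qˣ} {n : ℤ} {u k : L}
    {a b c d : O} (hk : k ≠ 0)
    (hdet : PowerSeries.constantCoeff a * PowerSeries.constantCoeff d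
      - PowerSeries.constantCoeff b * PowerSeries.constantCoeff c = 1)
    (hg : ρ (U : Q) =
      k • !![x ^ n * incl a + u * incl c, x ^ n * incl b + u * incl d; incl c, incl d]) :
    toPGL ρ h (QuotientGroup.mk' scalars U) • stdV = vert n u := by
  have e : toPGL ρ h (QuotientGroup.mk' scalars U)
      = Matrix.ProjGenLinGroup.mk (Units.map (ρ : Q →* Matrix (Fin 2) (Fin 2) L) U) := rfl
  rw [e, pgl_mk_smul]
  refine smul_stdV_eq_vert hk ?_ (hg := hg)
  rw [PowerSeries.isUnit_iff_constantCoeff, map_sub, map_mul, map_mul, hdet]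
  exact isUnit_one

/-- The uniformizer of `𝔽₂[[x]]`. -/
abbrev tSer : O := PowerSeries.X


theorem pgl0_b1 : pgl0 b1 • stdV = vert 0 0 := by
  have h2 := two_eq_zero_L
  refine rho_unit_eq_vert (k := 1) (a := (1 + (tSer ^ 2 + tSer)) * tSer)
    (b := 1 + (tSer ^ 2 + tSer) ^ 3) (c := 1)
    (d := (1 + (tSer ^ 2 + tSer)) * (1 + tSer)) one_ne_zero ?_ ?_
  · simp; try decide
  · change rho0 B1 = _
    rw [rho0_apply]
    simp only [B1, map_add, map_mul, map_pow, map_one, map_zero, phi0_z, incl_X]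
    ext i j : 1
    fin_cases i <;> fin_cases j <;> simp

theorem pgl0_c1 : pgl0 c1 • stdV = vert 0 0 := by
  have h2 := two_eq_zero_L
  refine rho_unit_eq_vert (k := 1) (a := 1 + (tSer ^ 2 + tSer) ^ 2)
    (b := tSer * (1 + (tSer ^ 2 + tSer) ^ 3))
    (c := 1 + tSer) (d := 1 + (tSer ^ 2 + tSer) ^ 2) one_ne_zero ?_ ?_
  · simp; try decide
  · change rho0 C1 = _
    rw [rho0_apply]
    simp only [C1, map_add, map_mul, map_pow, map_one, map_zero, phi0_z, incl_X]
    ext i j : 1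
    fin_cases i <;> fin_cases j <;> simp

theorem pgl0_b2 : pgl0 b2 • stdV = vert 1 1 := by
  have h2 := two_eq_zero_L
  refine rho_unit_eq_vert (k := 1) (a := (tSer + 1) * (1 + (tSer ^ 2 + tSer) + tSer))
    (b := (tSer + 1) * ((1 + tSer) * ((tSer ^ 2 + tSer) ^ 2 - 1) - 1 - (tSer ^ 2 + tSer)))
    (c := tSer) (d := (tSer ^ 2 + tSer) + (tSer ^ 2 + tSer) ^ 2 + (1 + (tSer ^ 2 + tSer)) *
      (1 + tSer)) one_ne_zero ?_ ?_
  · simp; try decide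
  · change rho0 B2 = _
    rw [rho0_apply]
    simp only [B2, map_add, map_sub, map_mul, map_pow, map_one, phi0_z, incl_X]
    ext i j : 1
    fin_cases i <;> fin_cases j <;> simp <;> grind

theorem pgl0_b2_inv : pgl0 b2⁻¹ • stdV = vert (-1) 0 := by
  have h2 := two_eq_zero_L
  have hn : phi0 (B2 * star B2).re⁻¹ ≠ 0 := by
    rw [norm_B2]
    exact (map_ne_zero phi0).mpr (inv_ne_zero (mul_ne_zero z_ne_zero one_add_z_ne_zero))
  -- The inverse class is represented by the conjugate divided by the norm. The norm goes into the
  -- scalar `k`, and the further factor `x` compensates the `x⁻¹` in the affine matrix of the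
  -- vertex.
  refine rho_unit_eq_vert (k := phi0 (B2 * star B2).re⁻¹ * x)
    (a := (tSer ^ 2 + tSer) + (tSer ^ 2 + tSer) ^ 2 + (1 + (tSer ^ 2 + tSer)) * (1 + tSer))
    (b := (1 + tSer) * (1 + (tSer ^ 2 + tSer) ^ 3))
    (c := 1) (d := (tSer + 1) * (1 + (tSer ^ 2 + tSer)) + (1 + (tSer ^ 2 + tSer)))
    (mul_ne_zero hn x_ne_zero) ?_ ?_
  · simp; try decide
  · change rho0 ((B2 * star B2).re⁻¹ • star B2) = _
    rw [rho0_apply]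
    have hx := mul_inv_cancel₀ x_ne_zero
    simp only [QuaternionAlgebra.re_smul, QuaternionAlgebra.imI_smul, QuaternionAlgebra.imJ_smul,
      QuaternionAlgebra.imK_smul, QuaternionAlgebra.re_star, QuaternionAlgebra.imI_star,
      QuaternionAlgebra.imJ_star, QuaternionAlgebra.imK_star, smul_eq_mul, map_mul, mul_smul]
    generalize phi0 (B2 * star B2).re⁻¹ = n
    simp only [B2, map_add, map_neg, map_mul, map_pow, map_one, phi0_z, incl_X]
    ext i j : 1
    fin_cases i <;> fin_cases j <;> simp <;> grind

theorem pgl0_c2 : pgl0 c2 • stdV = vert 1 0 := by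
  have h2 := two_eq_zero_L
  refine rho_unit_eq_vert (k := 1) (a := (tSer + 1) * (1 + (tSer ^ 2 + tSer)))
    (b := 1 + (tSer ^ 2 + tSer) ^ 3)
    (c := 1 + tSer) (d := (tSer ^ 2 + tSer) + (tSer ^ 2 + tSer) ^ 2) one_ne_zero ?_ ?_
  · simp; try decide
  · change rho0 C2 = _
    rw [rho0_apply]
    simp only [C2, map_add, map_mul, map_pow, map_one, map_zero, phi0_z, incl_X]
    ext i j : 1
    fin_cases i <;> fin_cases j <;> simp <;> grind

/-- The power series `x² + x`. -/
abbrev uSer : O := PowerSeries.X ^ 2 + PowerSeries.X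


/-- The variable `z` has a simple pole at infinity, with `z = u⁻¹ = x⁻¹ (1 + x)⁻¹`. Hence `x⁻¹`
appears as the scalar and the series `wSer` in the entries. -/
theorem pglInf_b1 : pglInf b1 • stdV = vert 1 1 := by
  have h2 := two_eq_zero_L
  refine rho_unit_eq_vert (k := x⁻¹) (a := 1 + tSer ^ 2 + wSer * tSer)
    (b := 1 + uSer ^ 3 - (tSer + wSer) * tSer)
    (c := wSer) (d := (tSer + wSer) * tSer ^ 2) (inv_ne_zero x_ne_zero) ?_ ?_
  · simp [constantCoeff_wSer]; try decide
  · change rhoInf B1 = _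
    rw [rhoInf_apply, uInf_inv]
    have hw := incl_wSer
    have hx := mul_inv_cancel₀ x_ne_zero
    simp only [B1, map_add, map_sub, map_mul, map_pow, map_one, map_zero, phiInf_z, incl_X,
      uInf_inv]
    generalize incl wSer = W at *
    generalize x⁻¹ = v at *
    ext i j : 1
    fin_cases i <;> fin_cases j <;> simp <;> grind

theorem pglInf_b1_inv : pglInf b1⁻¹ • stdV = vert 1 0 := by
  have h2 := two_eq_zero_L
  have hn : phiInf (B1 * star B1).re⁻¹ ≠ 0 := by
    rw [norm_B1]
    exact (map_ne_zero phiInf).mpr (inv_ne_zero one_add_z_ne_zero)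
  refine rho_unit_eq_vert (k := phiInf (B1 * star B1).re⁻¹ * x⁻¹) (a := (tSer + wSer) * tSer)
    (b := 1 + uSer ^ 3) (c := wSer) (d := (tSer + wSer) * (1 + tSer ^ 2))
    (mul_ne_zero hn (inv_ne_zero x_ne_zero)) ?_ ?_
  · simp [constantCoeff_wSer]; try decide
  · change rhoInf ((B1 * star B1).re⁻¹ • star B1) = _
    rw [rhoInf_apply, uInf_inv]
    have hw := incl_wSer
    have hx := mul_inv_cancel₀ x_ne_zero
    simp only [QuaternionAlgebra.re_smul, QuaternionAlgebra.imI_smul, QuaternionAlgebra.imJ_smul,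
      QuaternionAlgebra.imK_smul, QuaternionAlgebra.re_star, QuaternionAlgebra.imI_star,
      QuaternionAlgebra.imJ_star, QuaternionAlgebra.imK_star, smul_eq_mul, map_mul, mul_smul]
    generalize phiInf (B1 * star B1).re⁻¹ = n
    simp only [B1, map_add, map_neg, map_mul, map_pow, map_one, map_zero, phiInf_z, incl_X,
      uInf_inv]
    generalize incl wSer = W at *
    generalize x⁻¹ = v at *
    ext i j : 1
    fin_cases i <;> fin_cases j <;> simp <;> grind

theorem pglInf_c1 : pglInf c1 • stdV = vert (-1) 0 := by
  have h2 := two_eq_zero_L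
  refine rho_unit_eq_vert (k := 1) (a := tSer * (1 + uSer))
    (b := (1 + tSer ^ 2) * (wSer + tSer * uSer ^ 2)) (c := wSer ^ 2) (d := 1 + uSer) one_ne_zero
      ?_ ?_
  · simp [constantCoeff_wSer]; try decide
  · change rhoInf C1 = _
    rw [rhoInf_apply, uInf_inv]
    have hw := incl_wSer
    have hx := mul_inv_cancel₀ x_ne_zero
    simp only [C1, map_add, map_mul, map_pow, map_one, map_zero, phiInf_z, incl_X, uInf_inv,
      zpow_neg_one]
    generalize incl wSer = W at *
    generalize x⁻¹ = v at *
    ext i j : 1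
    fin_cases i <;> fin_cases j <;> simp <;> grind

theorem pglInf_b2 : pglInf b2 • stdV = vert 0 0 := by
  have h2 := two_eq_zero_L
  refine rho_unit_eq_vert (k := x⁻¹) (a := tSer * (1 + tSer + tSer * wSer))
    (b := tSer * (1 + uSer ^ 3) + (1 + tSer ^ 2) * (wSer + tSer * uSer ^ 2))
      (c := wSer + tSer * wSer ^ 2)
    (d := wSer + tSer ^ 3 + tSer ^ 2 * wSer + tSer * uSer) (inv_ne_zero x_ne_zero) ?_ ?_
  · simp [constantCoeff_wSer]; try decide
  · change rhoInf B2 = _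
    rw [rhoInf_apply, uInf_inv]
    have hw := incl_wSer
    have hx := mul_inv_cancel₀ x_ne_zero
    simp only [B2, map_add, map_mul, map_pow, map_one, phiInf_z, incl_X, uInf_inv]
    generalize incl wSer = W at *
    generalize x⁻¹ = v at *
    ext i j : 1
    fin_cases i <;> fin_cases j <;> simp <;> grind

theorem pglInf_c2 : pglInf c2 • stdV = vert 0 0 := by
  have h2 := two_eq_zero_L
  refine rho_unit_eq_vert (k := x⁻¹) (a := wSer + tSer * uSer)
    (b := (1 + tSer ^ 2) * (wSer + tSer * uSer ^ 2)) (c := tSer * wSer ^ 2)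
      (d := wSer + tSer * uSer)
    (inv_ne_zero x_ne_zero) ?_ ?_
  · simp [constantCoeff_wSer]; try decide
  · change rhoInf C2 = _
    rw [rhoInf_apply, uInf_inv]
    have hw := incl_wSer
    have hx := mul_inv_cancel₀ x_ne_zero
    simp only [C2, map_add, map_mul, map_pow, map_one, map_zero, phiInf_z, incl_X, uInf_inv]
    generalize incl wSer = W at *
    generalize x⁻¹ = v at *
    ext i j : 1
    fin_cases i <;> fin_cases j <;> simp <;> grind

/-! ### Simple transitivity -/

theorem toGK_eq {p q : Q} (hp : (p * star p).re ≠ 0) (hq : (q * star q).re ≠ 0) (c : K) (hc : c ≠ 0)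
    (h : p = c • q) : toGK p hp = toGK q hq := by
  unfold toGK
  rw [QuotientGroup.mk'_eq_mk']
  refine ⟨Units.map (algebraMap K Q : K →* Q) (Units.mk0 c hc)⁻¹, ⟨_, rfl⟩, Units.ext ?_⟩
  change p * algebraMap K Q c⁻¹ = q
  rw [h, ← Algebra.commutes, ← Algebra.smul_def, smul_smul, inv_mul_cancel₀ hc, one_smul]

theorem toGK_mul {p q : Q} (hp : (p * star p).re ≠ 0) (hq : (q * star q).re ≠ 0)
    (h : (p * q * star (p * q)).re ≠ 0) : toGK p hp * toGK q hq = toGK (p * q) h := by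
  unfold toGK
  rw [← map_mul]
  congr 1
  exact Units.ext rfl

theorem re_mul_star_mul (p q : Q) :
    (p * q * star (p * q)).re = (p * star p).re * (q * star q).re := by
  have h1 : p * q * star (p * q) = p * (q * star q) * star p := by
    rw [star_mul]
    simp only [mul_assoc]
  rw [h1, q.mul_star_eq_coe, QuaternionAlgebra.re_coe, ← QuaternionAlgebra.coe_commutes, mul_assoc,
    p.mul_star_eq_coe, QuaternionAlgebra.re_coe, ← QuaternionAlgebra.coe_mul,
    QuaternionAlgebra.re_coe, mul_comm]

theorem re_mul_star_mul_ne_zero {p q : Q} (hp : (p * star p).re ≠ 0) (hq : (q * star q).re ≠ 0) :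
    (p * q * star (p * q)).re ≠ 0 := by
  rw [re_mul_star_mul]
  exact mul_ne_zero hp hq

theorem one_mul_star_one_ne_zero : ((1 : Q) * star 1).re ≠ 0 := by
  rw [star_one, mul_one, QuaternionAlgebra.re_one]
  exact one_ne_zero

theorem toGK_one : toGK 1 one_mul_star_one_ne_zero = 1 := by
  unfold toGK
  rw [← map_one (QuotientGroup.mk' scalars)]
  congr 1
  exact Units.ext rfl

theorem C1_mul_C1 : C1 * C1 = (1 + z : K) • (1 : Q) := by
  have h2 := two_eq_zero_K
  ext <;> simp [C1] <;> grind

theorem C2_mul_C2 : C2 * C2 = (z * (1 + z) : K) • (1 : Q) := by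
  have h2 := two_eq_zero_K
  ext <;> simp [C2] <;> grind

theorem C1_mul_C2 : C1 * C2 = (1 : K) • (C2 * C1) := by
  have h2 := two_eq_zero_K
  rw [one_smul]
  ext <;> simp [C1, C2] <;> ring

theorem B2_mul_B1_mul_B2 : B2 * B1 * B2 = (z * (1 + z) : K) • C1 := by
  have h2 := two_eq_zero_K
  ext <;> simp [B1, B2, C1] <;> grind

theorem B1_mul_C2_mul_B1 : B1 * C2 * B1 = (1 + z : K) • B2 := by
  have h2 := two_eq_zero_K
  ext <;> simp [B1, B2, C2] <;> grind

/-- The defining relations of `Λ`. -/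
structure LamRels {P : Type*} [Group P] (b₁ b₂ c₁ c₂ : P) : Prop where
  cc₁ : c₁ * c₁ = 1
  cc₂ : c₂ * c₂ = 1
  comm : c₁ * c₂ = c₂ * c₁
  bcb : b₂ * b₁ * b₂ = c₁
  bbc : b₁ * c₂ * b₁ = b₂

theorem lamRels_GK : LamRels b1 b2 c1 c2 where
  cc₁ := by
    unfold c1
    rw [toGK_mul _ _ (re_mul_star_mul_ne_zero _ _), ← toGK_one]
    · exact toGK_eq _ _ _ one_add_z_ne_zero C1_mul_C1
    all_goals rw [norm_C1]; exact one_add_z_ne_zero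
  cc₂ := by
    unfold c2
    rw [toGK_mul _ _ (re_mul_star_mul_ne_zero _ _), ← toGK_one]
    · exact toGK_eq _ _ _ (mul_ne_zero z_ne_zero one_add_z_ne_zero) C2_mul_C2
    all_goals rw [norm_C2]; exact mul_ne_zero z_ne_zero one_add_z_ne_zero
  comm := by
    have h1 : (C1 * star C1).re ≠ 0 := by rw [norm_C1]; exact one_add_z_ne_zero
    have h2 : (C2 * star C2).re ≠ 0 := by
      rw [norm_C2]; exact mul_ne_zero z_ne_zero one_add_z_ne_zero
    unfold c1 c2
    rw [toGK_mul _ _ (re_mul_star_mul_ne_zero h1 h2), toGK_mul _ _ (re_mul_star_mul_ne_zero h2 h1)]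
    exact toGK_eq _ _ _ one_ne_zero C1_mul_C2
  bcb := by
    have h1 : (B1 * star B1).re ≠ 0 := by rw [norm_B1]; exact one_add_z_ne_zero
    have h2 : (B2 * star B2).re ≠ 0 := by
      rw [norm_B2]; exact mul_ne_zero z_ne_zero one_add_z_ne_zero
    unfold b1 b2 c1
    rw [toGK_mul _ _ (re_mul_star_mul_ne_zero h2 h1),
      toGK_mul _ _ (re_mul_star_mul_ne_zero (re_mul_star_mul_ne_zero h2 h1) h2)]
    exact toGK_eq _ _ _ (mul_ne_zero z_ne_zero one_add_z_ne_zero) B2_mul_B1_mul_B2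
  bbc := by
    have h1 : (B1 * star B1).re ≠ 0 := by rw [norm_B1]; exact one_add_z_ne_zero
    have h2 : (C2 * star C2).re ≠ 0 := by
      rw [norm_C2]; exact mul_ne_zero z_ne_zero one_add_z_ne_zero
    unfold b1 b2 c2
    rw [toGK_mul _ _ (re_mul_star_mul_ne_zero h1 h2),
      toGK_mul _ _ (re_mul_star_mul_ne_zero (re_mul_star_mul_ne_zero h1 h2) h1)]
    exact toGK_eq _ _ _ one_add_z_ne_zero B1_mul_C2_mul_B1

theorem lamRels_Lam : LamRels b1L b2L c1L c2L where
  cc₁ := Subtype.ext lamRels_GK.cc₁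
  cc₂ := Subtype.ext lamRels_GK.cc₂
  comm := Subtype.ext lamRels_GK.comm
  bcb := Subtype.ext lamRels_GK.bcb
  bbc := Subtype.ext lamRels_GK.bbc

namespace LamRels

variable {P : Type*} [Group P] {b₁ b₂ c₁ c₂ : P}

/-- `LamRels` has the last two relators solved for `c₁` and `b₂`; for the former `c₁ = c₁⁻¹` is
needed. -/
theorem lift_eq_one (h : LamRels b₁ b₂ c₁ c₂) :
    ∀ r ∈ relsLam, FreeGroup.lift ![b₁, b₂, c₁, c₂] r = 1 := by
  intro r hr
  simp only [relsLam, Set.mem_insert_iff, Set.mem_singleton_iff] at hr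
  rcases hr with rfl | rfl | rfl | rfl | rfl
  · simp [pow_two, h.cc₁]
  · simp [pow_two, h.cc₂]
  · simp [h.comm]
  · have : b₁ * b₂ * c₁ * b₂ = 1 := by
      have h1 : b₁ * b₂ = b₂⁻¹ * c₁ := by rw [← h.bcb]; group
      rw [h1, mul_assoc b₂⁻¹, h.cc₁, mul_one, inv_mul_cancel]
    simpa using this
  · have : b₁ * c₂ * b₁ * b₂⁻¹ = 1 := by rw [h.bbc, mul_inv_cancel]
    simpa using this

/-- These nine identities are the nine squares. Inverting and rotating `b₂ b₁ b₂ = c₁` gives `e1` to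
`e4`, doing so with `b₁ c₂ b₁ = b₂` gives `e5` to `e8`, and the ninth is the commutation of `c₁` and
`c₂`. -/
theorem swap (h : LamRels b₁ b₂ c₁ c₂) : ∀ b ∈ ({b₂, b₂⁻¹, c₂} : Set P),
    ∀ a ∈ ({b₁, b₁⁻¹, c₁} : Set P), ∃ a' ∈ ({b₁, b₁⁻¹, c₁} : Set P),
      ∃ b' ∈ ({b₂, b₂⁻¹, c₂} : Set P), b * a = a' * b' := by
  have i₁ : c₁⁻¹ = c₁ := inv_eq_of_mul_eq_one_right h.cc₁
  have i₂ : c₂⁻¹ = c₂ := inv_eq_of_mul_eq_one_right h.cc₂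
  have e1 : b₂⁻¹ * c₁ = b₁ * b₂ := by rw [← h.bcb]; group
  have e2 : b₂ * c₁ = b₁⁻¹ * b₂⁻¹ := by rw [← i₁, ← h.bcb]; group
  have e3 : b₂⁻¹ * b₁⁻¹ = c₁ * b₂ := by rw [← i₁, ← h.bcb]; group
  have e4 : b₂ * b₁ = c₁ * b₂⁻¹ := by rw [← h.bcb]; group
  have e5 : b₂ * b₁⁻¹ = b₁ * c₂ := by rw [← h.bbc]; group
  have e6 : c₂ * b₁ = b₁⁻¹ * b₂ := by rw [← h.bbc]; group
  have e7 : b₂⁻¹ * b₁ = b₁⁻¹ * c₂ := by rw [← h.bbc]; simp [mul_assoc, i₂]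
  have e8 : c₂ * b₁⁻¹ = b₁ * b₂⁻¹ := by rw [← h.bbc]; simp [i₂, ← mul_assoc]
  rintro b (rfl | rfl | rfl) a (rfl | rfl | rfl)
  · exact ⟨c₁, by simp, _, by simp, e4⟩
  · exact ⟨_, by simp, _, by simp, e5⟩
  · exact ⟨_, by simp, _, by simp, e2⟩
  · exact ⟨_, by simp, _, by simp, e7⟩
  · exact ⟨_, by simp, _, by simp, e3⟩
  · exact ⟨b₁, by simp, b₂, by simp, e1⟩
  · exact ⟨_, by simp, b₂, by simp, e6⟩
  · exact ⟨_, by simp, b₂⁻¹, by simp, e8⟩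
  · exact ⟨_, by simp, _, by simp, h.comm.symm⟩

theorem inv_mem {b c : P} (h : c * c = 1) : ∀ a ∈ ({b, b⁻¹, c} : Set P), a⁻¹ ∈
    ({b, b⁻¹, c} : Set P) := by
  have i : c⁻¹ = c := inv_eq_of_mul_eq_one_right h
  rintro a (rfl | rfl | rfl)
  · simp
  · simp
  · simp [i]

end LamRels

/-- The tree `T₀`, with the action of `G(K)`. -/
def TreeZero : Type := BTVertex

/-- The tree `T_∞`, with the action of `G(K)`. -/
def TreeInf : Type := BTVertex

/-- The two type synonyms keep the two actions of `G(K)` on the same set of vertices apart. -/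
instance : MulAction GK TreeZero := MulAction.compHom BTVertex pgl0

instance : MulAction GK TreeInf := MulAction.compHom BTVertex pglInf

/-- The graph structure of `T₀`. -/
def graphZero : SimpleGraph TreeZero := BTTree

/-- The graph structure of `T_∞`. -/
def graphInf : SimpleGraph TreeInf := BTTree

/-- The base point of `T₀`. -/
def baseZero : TreeZero := stdV

/-- The base point of `T_∞`. -/
def baseInf : TreeInf := stdV

theorem vert_pairwise : vert 1 1 ≠ vert 1 0 ∧ vert 1 1 ≠ vert (-1) 0 ∧ vert 1 0 ≠ vert (-1) 0 := by
  refine ⟨?_, ?_, ?_⟩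
  · rw [ne_eq, vert_eq_iff]
    rintro ⟨-, h⟩
    have := zpow_mem_fracIdeal_iff (n := 0) (k := 1)
    rw [zpow_zero] at this
    rw [zero_sub] at h
    have h2 := neg_mem_fracIdeal h
    rw [neg_neg, this] at h2
    omega
  · rw [ne_eq, vert_eq_iff]; omega
  · rw [ne_eq, vert_eq_iff]; omega

theorem neighborSet_stdV : BTTree.neighborSet stdV = {vert 1 1, vert 1 0, vert (-1) 0} := by
  symm
  apply Set.eq_of_subset_of_ncard_le
  · rw [← vert_zero]
    rintro w (rfl | rfl | rfl)
    · exact adj_vert.mpr (Or.inr ⟨rfl, by rw [sub_zero]; exact one_mem_fracIdeal⟩)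
    · exact adj_vert.mpr (Or.inr ⟨rfl, by rw [sub_zero]; exact zero_mem_fracIdeal 0⟩)
    · exact adj_vert.mpr (Or.inl ⟨rfl, by rw [sub_zero]; exact zero_mem_fracIdeal _⟩)
  · rw [ncard_neighborSet]
    exact (Set.ncard_eq_three.mpr ⟨_, _, _, vert_pairwise.1, vert_pairwise.2.1, vert_pairwise.2.2,
      rfl⟩).ge
  · exact Set.finite_of_ncard_ne_zero (by rw [ncard_neighborSet]; norm_num)

theorem isLocallyTransitive_of {V P : Type*} [Group P] [MulAction P V] {G : SimpleGraph V} {v : V}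
    {a b c : P} {x y z : V} (h : ∀ g ∈ ({a, b, c} : Set P), g⁻¹ ∈ ({a, b, c} : Set P))
    (hG : G.neighborSet v = {x, y, z}) (ha : a • v = x) (hb : b • v = y) (hc : c • v = z)
    (hxy : x ≠ y) (hxz : x ≠ z) (hyz : y ≠ z) : IsLocallyTransitive G v {a, b, c} := by
  subst ha hb hc
  refine ⟨h, ?_, ?_⟩
  · rw [hG, Set.image_insert_eq, Set.image_insert_eq, Set.image_singleton]
  · rintro g (rfl | rfl | rfl) g' (rfl | rfl | rfl) hg <;>
      first
      | rfl
      | exact absurd hg hxy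
      | exact absurd hg hxz
      | exact absurd hg hyz
      | exact absurd hg.symm hxy
      | exact absurd hg.symm hxz
      | exact absurd hg.symm hyz

/-- The group `P` is left open in order to serve both for `Λ` and for the abstractly presented
group. The norm `1 + z` of `B₁` and `C₁` has order `0` at `z = 0` and odd order at `∞`; the norm `z
(1 + z)` of `B₂` and `C₂` has odd order at `0` and even order at `∞`. Accordingly `T_∞` is the left
tree, moved by `A`. -/
theorem isTreePair {P : Type*} [Group P] [MulAction P TreeInf] [MulAction P TreeZero] (π : P →* GK)
    (hInf : ∀ (g : P) (v : TreeInf), g • v = π g • v)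
    (hZero : ∀ (g : P) (v : TreeZero), g • v = π g • v)
    {b₁ b₂ c₁ c₂ : P} (h : LamRels b₁ b₂ c₁ c₂) (hb₁ : π b₁ = b1) (hb₂ : π b₂ = b2)
      (hc₁ : π c₁ = c1)
    (hc₂ : π c₂ = c2) (hgen : Subgroup.closure {b₁, b₂, c₁, c₂} = ⊤) :
    IsTreePair graphInf graphZero baseInf baseZero
      ({b₁, b₁⁻¹, c₁} : Set P) ({b₂, b₂⁻¹, c₂} : Set P) where
  treeL := btTree_isTree
  treeR := btTree_isTree
  adjL := fun g a b hab => by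
    rw [hInf, hInf]
    exact (pgl_adj_iff _ _ _).mpr hab
  adjR := fun g a b hab => by
    rw [hZero, hZero]
    exact (pgl_adj_iff _ _ _).mpr hab
  locL := by
    refine isLocallyTransitive_of (LamRels.inv_mem h.cc₁) neighborSet_stdV ?_ ?_ ?_
      vert_pairwise.1 vert_pairwise.2.1 vert_pairwise.2.2
    · exact (hInf _ _).trans (hb₁.symm ▸ pglInf_b1)
    · exact (hInf _ _).trans ((map_inv π b₁).symm ▸ hb₁.symm ▸ pglInf_b1_inv)
    · exact (hInf _ _).trans (hc₁.symm ▸ pglInf_c1)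
  locR := by
    refine isLocallyTransitive_of (x := vert 1 1) (y := vert (-1) 0) (z := vert 1 0)
      (LamRels.inv_mem h.cc₂) (neighborSet_stdV.trans ?_) ?_ ?_ ?_
      vert_pairwise.2.1 vert_pairwise.1 vert_pairwise.2.2.symm
    · exact congrArg (insert _) (Set.pair_comm _ _)
    · rw [hZero, hb₂]; exact pgl0_b2
    · rw [hZero, map_inv, hb₂]; exact pgl0_b2_inv
    · rw [hZero, hc₂]; exact pgl0_c2
  fixL := by
    have e1 : b₂ • baseInf = baseInf := by
      rw [hInf, hb₂]; exact pglInf_b2.trans vert_zero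
    rintro b (rfl | rfl | rfl)
    · exact e1
    · rw [inv_smul_eq_iff, e1]
    · rw [hInf, hc₂]; exact pglInf_c2.trans vert_zero
  fixR := by
    have e1 : b₁ • baseZero = baseZero := by
      rw [hZero, hb₁]; exact pgl0_b1.trans vert_zero
    rintro b (rfl | rfl | rfl)
    · exact e1
    · rw [inv_smul_eq_iff, e1]
    · rw [hZero, hc₁]; exact pgl0_c1.trans vert_zero
  gen := by
    rw [eq_top_iff, ← hgen]
    apply Subgroup.closure_mono
    rintro g (rfl | rfl | rfl | rfl) <;> simp
  swap := h.swap

theorem closure_Lam : Subgroup.closure ({b1L, b2L, c1L, c2L} : Set Lam) = ⊤ := by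
  have h := Subgroup.closure_closure_coe_preimage (k := ({b1, b2, c1, c2} : Set GK))
  rw [← top_le_iff]
  refine h.ge.trans ?_
  apply Subgroup.closure_mono
  rintro ⟨g, hg⟩ (h | h | h | h)
  · left; exact Subtype.ext h
  · right; left; exact Subtype.ext h
  · right; right; left; exact Subtype.ext h
  · right; right; right; exact Subtype.ext h

theorem isTreePair_Lam :
    IsTreePair graphInf graphZero baseInf baseZero setA setB :=
  isTreePair Lam.subtype (fun _ _ => rfl) (fun _ _ => rfl) lamRels_Lam rfl rfl rfl rfl closure_Lam

/-- Both pairs are translates of the base pair, whose stabiliser is trivial. -/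
theorem btAct_existsUnique (v w : BTVertex × BTVertex) : ∃! g : Lam, btAct g v = w := by
  have h := isTreePair_Lam
  let vi : TreeInf := v.2
  let vz : TreeZero := v.1
  let wi : TreeInf := w.2
  let wz : TreeZero := w.1
  have key : ∀ l : Lam, btAct l v = w ↔ l • vi = wi ∧ l • vz = wz := by
    intro l
    rw [Prod.ext_iff, and_comm]
    rfl
  simp only [key]
  generalize vi = vi, vz = vz, wi = wi, wz = wz
  obtain ⟨g, rfl, rfl⟩ := h.exists_smul_eq vi vz
  obtain ⟨k, rfl, rfl⟩ := h.exists_smul_eq wi wz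
  refine ⟨k * g⁻¹, ?_, fun l hl => ?_⟩
  · constructor <;> rw [mul_smul, inv_smul_smul]
  · have e : k⁻¹ * (l * g) = 1 := by
      apply h.eq_one_of_smul_eq
      · rw [mul_smul, mul_smul, hl.1, inv_smul_smul]
      · rw [mul_smul, mul_smul, hl.2, inv_smul_smul]
    rw [inv_mul_eq_one] at e
    rw [e, mul_inv_cancel_right]

/-! ### The presentation of `Λ` -/

/-- The homomorphism from the group presented by the relations. -/
def presLam : PresentedGroup relsLam →* Lam := PresentedGroup.toGroup lamRels_Lam.lift_eq_one

theorem presLam_of (i : Fin 4) : presLam (PresentedGroup.of i) = ![b1L, b2L, c1L, c2L] i :=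
  PresentedGroup.toGroup.of lamRels_Lam.lift_eq_one

theorem lamRels_presented : LamRels (PresentedGroup.of 0 : PresentedGroup relsLam)
    (PresentedGroup.of 1) (PresentedGroup.of 2) (PresentedGroup.of 3) := by
  have key : ∀ r ∈ relsLam, PresentedGroup.mk relsLam r = 1 := fun r hr =>
    PresentedGroup.one_of_mem hr
  have h1 := key _ (Or.inl rfl)
  have h2 := key _ (Or.inr (Or.inl rfl))
  have h3 := key _ (Or.inr (Or.inr (Or.inl rfl)))
  have h4 := key _ (Or.inr (Or.inr (Or.inr (Or.inl rfl))))
  have h5 := key _ (Or.inr (Or.inr (Or.inr (Or.inr rfl))))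
  simp only [map_mul, map_pow, map_inv] at h1 h2 h3 h4 h5
  change PresentedGroup.of (rels := relsLam) 2 ^ 2 = 1 at h1
  change PresentedGroup.of (rels := relsLam) 3 ^ 2 = 1 at h2
  change PresentedGroup.of (rels := relsLam) 2 * PresentedGroup.of 3 *
    (PresentedGroup.of 3 * PresentedGroup.of 2)⁻¹ = 1 at h3
  change PresentedGroup.of (rels := relsLam) 0 * PresentedGroup.of 1 * PresentedGroup.of 2 *
    PresentedGroup.of 1 = 1 at h4
  change PresentedGroup.of (rels := relsLam) 0 * PresentedGroup.of 3 * PresentedGroup.of 0 *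
    (PresentedGroup.of 1)⁻¹ = 1 at h5
  generalize PresentedGroup.of (rels := relsLam) 0 = b₁ at *
  generalize PresentedGroup.of (rels := relsLam) 1 = b₂ at *
  generalize PresentedGroup.of (rels := relsLam) 2 = c₁ at *
  generalize PresentedGroup.of (rels := relsLam) 3 = c₂ at *
  rw [pow_two] at h1 h2
  refine ⟨h1, h2, mul_inv_eq_one.mp h3, ?_, mul_inv_eq_one.mp h5⟩
  have i₁ : c₁⁻¹ = c₁ := inv_eq_of_mul_eq_one_right h1
  have h6 : b₁ * b₂ = b₂⁻¹ * c₁⁻¹ := by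
    rw [← mul_inv_rev]
    apply eq_inv_of_mul_eq_one_left
    rw [← h4]
    group
  rw [mul_assoc, h6, mul_inv_cancel_left, i₁]

/-- The presented group acts on both trees through its map `π` to `G(K)` and satisfies `LamRels`, so
only its identity fixes both base vertices. An element of the kernel acts trivially, hence is the
identity. -/
theorem presLam_bijective : Function.Bijective presLam := by
  let P := PresentedGroup relsLam
  let π : P →* GK := Lam.subtype.comp presLam
  let _ : MulAction P TreeInf := MulAction.compHom TreeInf π
  let _ : MulAction P TreeZero := MulAction.compHom TreeZero π
  have hgen : Subgroup.closure ({PresentedGroup.of 0, PresentedGroup.of 1, PresentedGroup.of 2,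
      PresentedGroup.of 3} : Set P) = ⊤ := by
    rw [← PresentedGroup.closure_range_of relsLam]
    congr 1
    ext g
    simp only [Set.mem_insert_iff, Set.mem_singleton_iff, Set.mem_range, Fin.exists_fin_succ]
    simp [eq_comm]
  have h := isTreePair (P := P) π (fun _ _ => rfl) (fun _ _ => rfl) lamRels_presented
    (congrArg Subtype.val (presLam_of 0)) (congrArg Subtype.val (presLam_of 1))
      (congrArg Subtype.val (presLam_of 2))
    (congrArg Subtype.val (presLam_of 3)) hgen
  constructor
  · rw [injective_iff_map_eq_one]
    intro g hg
    have hπ : π g = 1 := congrArg Subtype.val hg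
    apply h.eq_one_of_smul_eq
    · change π g • baseInf = _
      rw [hπ, one_smul]
    · change π g • baseZero = _
      rw [hπ, one_smul]
  · rw [← MonoidHom.range_eq_top, eq_top_iff, ← closure_Lam, Subgroup.closure_le]
    rintro g (rfl | rfl | rfl | rfl)
    · exact ⟨_, presLam_of 0⟩
    · exact ⟨_, presLam_of 1⟩
    · exact ⟨_, presLam_of 2⟩
    · exact ⟨_, presLam_of 3⟩

theorem presentation_Lam : ∃ e : PresentedGroup relsLam ≃* Lam,
    e (PresentedGroup.of 0) = b1L ∧ e (PresentedGroup.of 1) = b2L ∧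
    e (PresentedGroup.of 2) = c1L ∧ e (PresentedGroup.of 3) = c2L :=
  ⟨MulEquiv.ofBijective presLam presLam_bijective, presLam_of 0, presLam_of 1, presLam_of 2,
    presLam_of 3⟩

/-- The universal property of the presentation of `Λ`. -/
theorem exists_hom_of_lamRels {P : Type*} [Group P] {b₁ b₂ c₁ c₂ : P} (h : LamRels b₁ b₂ c₁ c₂) :
    ∃ f : Lam →* P, f b1L = b₁ ∧ f b2L = b₂ ∧ f c1L = c₁ ∧ f c2L = c₂ := by
  obtain ⟨e, h1, h2, h3, h4⟩ := presentation_Lam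
  refine ⟨(PresentedGroup.toGroup h.lift_eq_one).comp e.symm.toMonoidHom, ?_, ?_, ?_, ?_⟩
  · rw [← h1]; simp
  · rw [← h2]; simp
  · rw [← h3]; simp
  · rw [← h4]; simp

/-! ### The `V₄`-structure -/

namespace IsTreePair

variable {V W P : Type} [Group P] [MulAction P V] [MulAction P W] {G : SimpleGraph V}
  {H : SimpleGraph W} {v : V} {w : W} {A B : Set P}

/-- Applied to `v`, which `B` fixes, the product shows the image `a v`, and this determines `a`. -/
theorem eq_of_mul_eq (h : IsTreePair G H v w A B) {a a' b b' : P} (ha : a ∈ A) (ha' : a' ∈ A)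
    (hb : b ∈ B) (hb' : b' ∈ B) (e : a * b = a' * b') : a = a' ∧ b = b' := by
  have : a = a' := by
    apply h.locL.injOn ha ha'
    change a • v = a' • v
    have := congrArg (· • v) e
    simpa only [mul_smul, h.fixL b hb, h.fixL b' hb'] using this
  subst this
  exact ⟨rfl, mul_left_cancel e⟩

theorem eq_of_mul_eq_swap (h : IsTreePair G H v w A B) {a a' b b' : P} (ha : a ∈ A) (ha' : a' ∈ A)
    (hb : b ∈ B) (hb' : b' ∈ B) (e : b * a = b' * a') : a = a' ∧ b = b' := by
  have : b = b' := by
    apply h.locR.injOn hb hb'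
    change b • w = b' • w
    have := congrArg (· • w) e
    simpa only [mul_smul, h.fixR a ha, h.fixR a' ha'] using this
  subst this
  exact ⟨mul_left_cancel e, rfl⟩

theorem mul_comm (h : IsTreePair G H v w A B) : A * B = B * A := by
  apply Set.Subset.antisymm
  · rintro _ ⟨a, ha, b, hb, rfl⟩
    obtain ⟨a', ha', b', hb', e⟩ := h.swap b⁻¹ (h.locR.inv_mem b hb) a⁻¹ (h.locL.inv_mem a ha)
    refine ⟨b'⁻¹, h.locR.inv_mem b' hb', a'⁻¹, h.locL.inv_mem a' ha', ?_⟩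
    change b'⁻¹ * a'⁻¹ = a * b
    rw [← mul_inv_rev, ← e, mul_inv_rev, inv_inv, inv_inv]
  · rintro _ ⟨b, hb, a, ha, rfl⟩
    obtain ⟨a', ha', b', hb', e⟩ := h.swap b hb a ha
    exact ⟨a', ha', b', hb', e.symm⟩

theorem isV4Structure (h : IsTreePair G H v w A B) (hA : A.Finite) (hB : B.Finite) :
    IsV4Structure A B where
  finite_left := hA
  finite_right := hB
  closure_union := h.gen
  inv_mem_left := h.locL.inv_mem
  inv_mem_right := h.locR.inv_mem
  mul_comm := h.mul_comm
  bijOn_mul := by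
    refine ⟨fun p hp => Set.mul_mem_mul hp.1 hp.2, fun p hp q hq e => ?_, ?_⟩
    · exact Prod.ext_iff.mpr (h.eq_of_mul_eq hp.1 hq.1 hp.2 hq.2 e)
    · rintro _ ⟨a, ha, b, hb, rfl⟩
      exact ⟨(a, b), ⟨ha, hb⟩, rfl⟩
  bijOn_mul_swap := by
    refine ⟨fun p hp => ?_, fun p hp q hq e => ?_, ?_⟩
    · rw [h.mul_comm]
      exact Set.mul_mem_mul hp.2 hp.1
    · exact Prod.ext_iff.mpr (h.eq_of_mul_eq_swap hp.1 hq.1 hp.2 hq.2 e)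
    · rw [h.mul_comm]
      rintro _ ⟨b, hb, a, ha, rfl⟩
      exact ⟨(a, b), ⟨ha, hb⟩, rfl⟩

theorem card_left (h : IsTreePair G H v w A B) : Nat.card A = (G.neighborSet v).ncard := by
  rw [← h.locL.image_eq, h.locL.injOn.ncard_image, Nat.card_coe_set_eq]

theorem card_right (h : IsTreePair G H v w A B) : Nat.card B = (H.neighborSet w).ncard := by
  rw [← h.locR.image_eq, h.locR.injOn.ncard_image, Nat.card_coe_set_eq]

end IsTreePair

theorem isV4Structure_Lam : IsV4Structure setA setB :=
  isTreePair_Lam.isV4Structure (by simp [setA]) (by simp [setB])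

theorem card_setA : Nat.card setA = 3 :=
  isTreePair_Lam.card_left.trans (ncard_neighborSet stdV)

theorem card_setB : Nat.card setB = 3 :=
  isTreePair_Lam.card_right.trans (ncard_neighborSet stdV)

namespace v4Complex

variable {Λ : Type} [Group Λ] {A B : Set Λ} (h : IsV4Structure A B)

theorem card_V : Nat.card (v4Complex h).V = 4 := by
  change Nat.card (Bool × Bool) = 4
  simp

/-- The unoriented edges are the vertical and the horizontal ones. -/
def unorientedEdgeEquiv : (v4Complex h).UnorientedEdge ≃ (A × Bool) ⊕ (B × Bool) where
  toFun := Quot.lift (fun e : V4Edge A B => match e with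
    | .v a i _ => Sum.inl (a, i)
    | .h b j _ => Sum.inr (b, j)) (by
      rintro (⟨a, i, r⟩ | ⟨b, j, r⟩) _ rfl <;> rfl)
  invFun := Sum.elim (fun p => Quot.mk _ (.v p.1 p.2 false)) fun p => Quot.mk _ (.h p.1 p.2 false)
  left_inv e := by
    induction e using Quot.ind with
    | mk e =>
      rcases e with ⟨a, i, _ | _⟩ | ⟨b, j, _ | _⟩
      · rfl
      · exact Quot.sound (r := fun e f : (v4Complex h).E => f = (v4Complex h).rev e)
          (a := V4Edge.v a i false) (b := V4Edge.v a i true) rfl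
      · rfl
      · exact Quot.sound (r := fun e f : (v4Complex h).E => f = (v4Complex h).rev e)
          (a := V4Edge.h b j false) (b := V4Edge.h b j true) rfl
  right_inv := by rintro (⟨a, i⟩ | ⟨b, j⟩) <;> rfl

theorem card_unorientedEdge :
    Nat.card (v4Complex h).UnorientedEdge = 2 * Nat.card A + 2 * Nat.card B := by
  have := h.finite_left.to_subtype
  have := h.finite_right.to_subtype
  rw [Nat.card_congr (unorientedEdgeEquiv h), Nat.card_sum, Nat.card_prod, Nat.card_prod]
  simp [mul_comm]

/-- A square is determined by its left and top labels: their product has exactly one expression in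
`B A`. -/
theorem card_S : Nat.card (v4Complex h).S = Nat.card A * Nat.card B := by
  rw [← Nat.card_prod]
  change Nat.card (V4Square A B) = _
  refine Nat.card_congr (Equiv.ofBijective (fun s => (s.left, s.top)) ⟨?_, ?_⟩)
  · intro s t hst
    obtain ⟨hl, ht⟩ := Prod.ext_iff.mp hst
    change s.left = t.left at hl
    change s.top = t.top at ht
    have e : (s.bottom : Λ) * s.right = t.bottom * t.right := by
      rw [← s.mul_eq, ← t.mul_eq, hl, ht]
    have := h.bijOn_mul_swap.injOn (x₁ := ((↑s.right : Λ), ↑s.bottom))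
      (x₂ := ((↑t.right : Λ), ↑t.bottom))
      ⟨s.right.2, s.bottom.2⟩ ⟨t.right.2, t.bottom.2⟩ e
    obtain ⟨h1, h2⟩ := Prod.ext_iff.mp this
    exact V4Square.ext hl ht (Subtype.ext h2) (Subtype.ext h1)
  · rintro ⟨a, b⟩
    obtain ⟨⟨a', b'⟩, ⟨ha, hb⟩, e⟩ := h.bijOn_mul_swap.surjOn (Set.mul_mem_mul a.2 b.2)
    exact ⟨⟨a, b, ⟨b', hb⟩, ⟨a', ha⟩, e.symm⟩, rfl⟩

end v4Complex

/-! ### `Λ = G(R₁)` -/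

/-- The polynomial ring in `K`. -/
abbrev pol : Polynomial F2 →+* K := algebraMap (Polynomial F2) K

theorem pol_injective : Function.Injective pol := RatFunc.algebraMap_injective F2

theorem pol_X : pol Polynomial.X = z := RatFunc.algebraMap_X

theorem pol_one_add_X : pol (1 + Polynomial.X) = 1 + z := by rw [map_add, map_one, pol_X]

theorem exists_mul_pow_eq_pol {f : K} (hf : f ∈ R1) :
    ∃ (m : ℕ) (p : Polynomial F2), f * (z * (1 + z)) ^ m = pol p := by
  have h0 : z * (1 + z) ≠ 0 := mul_ne_zero z_ne_zero one_add_z_ne_zero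
  induction hf using Algebra.adjoin_induction with
  | mem f hf =>
    rcases hf with rfl | rfl
    · exact ⟨0, Polynomial.X, by rw [pow_zero, mul_one, pol_X]⟩
    · exact ⟨1, 1, by rw [pow_one, inv_mul_cancel₀ h0, map_one]⟩
  | algebraMap r =>
    refine ⟨0, Polynomial.C r, ?_⟩
    rw [pow_zero, mul_one]
    exact (RatFunc.algebraMap_C r).symm
  | add f g _ _ hf hg =>
    obtain ⟨m, p, hp⟩ := hf
    obtain ⟨n, q, hq⟩ := hg
    refine ⟨m + n, p * (Polynomial.X * (1 + Polynomial.X)) ^ n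
      + q * (Polynomial.X * (1 + Polynomial.X)) ^ m, ?_⟩
    rw [map_add, map_mul, map_mul, ← hp, ← hq, map_pow, map_pow, map_mul, pol_X, pol_one_add_X]
    ring
  | mul f g _ _ hf hg =>
    obtain ⟨m, p, hp⟩ := hf
    obtain ⟨n, q, hq⟩ := hg
    refine ⟨m + n, p * q, ?_⟩
    rw [map_mul, ← hp, ← hq]
    ring

instance : Subsingleton (Polynomial F2)ˣ := by
  have key : ∀ u : (Polynomial F2)ˣ, u = 1 := by
    intro u
    obtain ⟨r, hr, e⟩ := Polynomial.isUnit_iff.mp u.isUnit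
    have : r = 1 := by
      have h0 : ∀ r : F2, r ≠ 0 → r = 1 := by decide
      exact h0 r hr.ne_zero
    exact Units.ext (by rw [← e, this, Polynomial.C_1, Units.val_one])
  exact ⟨fun u v => (key u).trans (key v).symm⟩

theorem prime_one_add_X : Prime (1 + Polynomial.X : Polynomial F2) := by
  have h := Polynomial.prime_X_sub_C (1 : F2)
  have e : (Polynomial.X - Polynomial.C 1 : Polynomial F2) = 1 + Polynomial.X := by
    rw [CharTwo.sub_eq_add, Polynomial.C_1, add_comm]
  rwa [e] at h

/-- After clearing denominators this is unique factorisation: a divisor of a power of `X (1 + X)` is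
again a product of powers of the two primes, and `1` is the only unit of `𝔽₂[X]`. -/
theorem exists_eq_zpow_of_mul_eq_one {f g : K} (hf : f ∈ R1) (hg : g ∈ R1) (hfg : f * g = 1) :
    ∃ i j : ℤ, f = z ^ i * (1 + z) ^ j := by
  obtain ⟨m, p, hp⟩ := exists_mul_pow_eq_pol hf
  obtain ⟨n, q, hq⟩ := exists_mul_pow_eq_pol hg
  have hz := z_ne_zero
  have hz1 := one_add_z_ne_zero
  have h1 : p * q = Polynomial.X ^ (m + n) * (1 + Polynomial.X) ^ (m + n) := by
    apply pol_injective
    rw [map_mul, ← hp, ← hq, map_mul, map_pow, map_pow, pol_X, pol_one_add_X]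
    rw [← mul_pow, pow_add]
    linear_combination (z * (1 + z)) ^ m * (z * (1 + z)) ^ n * hfg
  obtain ⟨d, e, hd, he, rfl⟩ := exists_dvd_and_dvd_of_dvd_mul (Dvd.intro _ h1)
  obtain ⟨i, -, hi⟩ := (dvd_prime_pow Polynomial.prime_X _).mp hd
  obtain ⟨j, -, hj⟩ := (dvd_prime_pow prime_one_add_X _).mp he
  rw [associated_iff_eq] at hi hj
  subst hi hj
  refine ⟨i - m, j - m, ?_⟩
  rw [map_mul, map_pow, map_pow, pol_X, pol_one_add_X] at hp
  rw [zpow_sub₀ hz, zpow_sub₀ hz1, zpow_natCast, zpow_natCast, zpow_natCast, zpow_natCast]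
  field_simp
  rw [mul_pow, ← mul_assoc] at hp
  exact hp

theorem zpow_mem_R1 (i : ℤ) : z ^ i ∈ R1 := by
  have hi : z⁻¹ ∈ R1 := by
    have h1 : (z * (1 + z))⁻¹ ∈ R1 := Algebra.subset_adjoin (by simp)
    have e : z⁻¹ = (1 + z) * (z * (1 + z))⁻¹ := by
      rw [mul_inv, mul_comm, mul_assoc, inv_mul_cancel₀ one_add_z_ne_zero, mul_one]
    rw [e]
    exact mul_mem (add_mem (one_mem _) z_mem_R1) h1
  obtain ⟨n, rfl | rfl⟩ := i.eq_nat_or_neg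
  · rw [zpow_natCast]; exact pow_mem z_mem_R1 n
  · rw [zpow_neg, zpow_natCast, ← inv_pow]; exact pow_mem hi n

theorem one_add_zpow_mem_R1 (i : ℤ) : (1 + z) ^ i ∈ R1 := by
  have hi : (1 + z)⁻¹ ∈ R1 := by
    have h1 : (z * (1 + z))⁻¹ ∈ R1 := Algebra.subset_adjoin (by simp)
    have e : (1 + z)⁻¹ = z * (z * (1 + z))⁻¹ := by
      rw [mul_inv, ← mul_assoc, mul_inv_cancel₀ z_ne_zero, one_mul]
    rw [e]
    exact mul_mem z_mem_R1 h1
  obtain ⟨n, rfl | rfl⟩ := i.eq_nat_or_neg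
  · rw [zpow_natCast]; exact pow_mem (add_mem (one_mem _) z_mem_R1) n
  · rw [zpow_neg, zpow_natCast, ← inv_pow]; exact pow_mem hi n

theorem re_mul_star (q : Q) : (q * star q).re = q.re ^ 2 + q.re * q.imI + z * q.imI ^ 2
    + (1 + z ^ 3) * (q.imJ ^ 2 + q.imJ * q.imK + z * q.imK ^ 2) := by
  have h2 := two_eq_zero_K
  simp only [QuaternionAlgebra.re_mul, QuaternionAlgebra.re_star,
    QuaternionAlgebra.imI_star, QuaternionAlgebra.imJ_star, QuaternionAlgebra.imK_star]
  grind

theorem star_mem_O1 {q : Q} (hq : q ∈ O1) : star q ∈ O1 := by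
  obtain ⟨h1, h2, h3, h4⟩ := hq
  refine ⟨?_, ?_, ?_, ?_⟩
  · rw [QuaternionAlgebra.re_star, one_mul]; exact add_mem h1 h2
  · rw [QuaternionAlgebra.imI_star]; exact neg_mem h2
  · rw [QuaternionAlgebra.imJ_star]; exact neg_mem h3
  · rw [QuaternionAlgebra.imK_star]; exact neg_mem h4

theorem smul_mem_O1 {c : K} (hc : c ∈ R1) {q : Q} (hq : q ∈ O1) : c • q ∈ O1 :=
  ⟨mul_mem hc hq.1, mul_mem hc hq.2.1, mul_mem hc hq.2.2.1, mul_mem hc hq.2.2.2⟩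

theorem toGK_mem_GR1 {q : Q} (hq : q ∈ O1) {i j : ℤ} (e : (q * star q).re = z ^ i * (1 + z) ^ j)
    (h : (q * star q).re ≠ 0) : toGK q h ∈ GR1 := by
  refine ⟨_, ?_, rfl⟩
  refine Submonoid.mem_units_iff _ _ |>.mpr ⟨hq, ?_⟩
  change (q * star q).re⁻¹ • star q ∈ O1
  refine smul_mem_O1 ?_ (star_mem_O1 hq)
  rw [e, mul_inv, ← zpow_neg, ← zpow_neg]
  exact mul_mem (zpow_mem_R1 _) (one_add_zpow_mem_R1 _)

theorem Lam_le_GR1 : Lam ≤ GR1 := by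
  have hz := z_mem_R1
  have h1 : (1 : K) ∈ R1 := one_mem _
  have h0 : (0 : K) ∈ R1 := zero_mem _
  refine (Subgroup.closure_le _).mpr ?_
  rintro g (rfl | rfl | rfl | rfl)
  · refine toGK_mem_GR1 (i := 0) (j := 1) ⟨?_, ?_, ?_, ?_⟩ (by rw [norm_B1]; simp) _
    exacts [h0, add_mem h1 hz, h1, h0]
  · refine toGK_mem_GR1 (i := 1) (j := 1) ⟨?_, ?_, ?_, ?_⟩ (by rw [norm_B2]; simp) _
    exacts [add_mem hz (pow_mem hz 2), add_mem h1 hz, h1, h1]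
  · refine toGK_mem_GR1 (i := 0) (j := 1) ⟨?_, ?_, ?_, ?_⟩ (by rw [norm_C1]; simp) _
    exacts [add_mem h1 (pow_mem hz 2), h0, h0, h1]
  · refine toGK_mem_GR1 (i := 1) (j := 1) ⟨?_, ?_, ?_, ?_⟩ (by rw [norm_C2]; simp) _
    exacts [add_mem hz (pow_mem hz 2), h0, h0, h1]

/-! ### Integrality at the places `0`, `1` and `∞` -/

theorem phi0_pol (p : Polynomial F2) :
    phi0 (pol p) = incl (Polynomial.aeval (PowerSeries.X ^ 2 + PowerSeries.X : O) p) := by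
  have h : phi0.comp pol = incl.comp (Polynomial.aeval
      (PowerSeries.X ^ 2 + PowerSeries.X : O) : Polynomial F2 →ₐ[F2] O).toRingHom := by
    refine Polynomial.ringHom_ext' (Subsingleton.elim _ _) ?_
    change phi0 (pol Polynomial.X) = incl (Polynomial.aeval _ Polynomial.X)
    rw [pol_X, phi0_z, Polynomial.aeval_X, map_add, map_pow, incl_X]
  exact RingHom.congr_fun h p

theorem constantCoeff_aeval (p : Polynomial F2) : PowerSeries.constantCoeff
    (Polynomial.aeval (PowerSeries.X ^ 2 + PowerSeries.X : O) p) = p.eval 0 := by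
  have h : (PowerSeries.constantCoeff (R := F2)).comp (Polynomial.aeval
      (PowerSeries.X ^ 2 + PowerSeries.X : O) : Polynomial F2 →ₐ[F2] O).toRingHom
      = Polynomial.evalRingHom 0 := by
    refine Polynomial.ringHom_ext' (Subsingleton.elim _ _) ?_
    simp
  exact RingHom.congr_fun h p

theorem constantCoeff_eq_zero_of_mem {p : O} (h : incl p ∈ fracIdeal 1) :
    PowerSeries.constantCoeff p = 0 := by
  obtain ⟨q, hq⟩ := h
  rw [zpow_one, ← incl_X, ← map_mul] at hq
  rw [incl_injective hq, map_mul, PowerSeries.constantCoeff_X, zero_mul]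

theorem x_mem_fracIdeal : x ∈ fracIdeal 1 := by simpa using zpow_mem_fracIdeal 1

theorem uInf_mem_fracIdeal : uInf ∈ fracIdeal 1 := by
  refine add_mem_fracIdeal ?_ x_mem_fracIdeal
  rw [pow_two]
  exact fracIdeal_anti (by norm_num) (mul_mem_fracIdeal x_mem_fracIdeal x_mem_fracIdeal)

theorem mul_mem_fracIdeal_zero {n : ℤ} {a b : L} (ha : a ∈ fracIdeal n) (hb : b ∈ fracIdeal 0) :
    a * b ∈ fracIdeal n := by
  simpa using mul_mem_fracIdeal ha hb

theorem zero_mul_mem_fracIdeal {n : ℤ} {a b : L} (ha : a ∈ fracIdeal 0) (hb : b ∈ fracIdeal n) :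
    a * b ∈ fracIdeal n := by
  simpa using mul_mem_fracIdeal ha hb

theorem pow_mem_fracIdeal_zero {a : L} (ha : a ∈ fracIdeal 0) (n : ℕ) : a ^ n ∈ fracIdeal 0 := by
  obtain ⟨p, rfl⟩ := mem_fracIdeal_zero.mp ha
  rw [← map_pow]
  exact incl_mem_fracIdeal _

/-- An element of `𝔽₂[z, 1 / (z (1 + z))]` that is integral at `z = 0` has no `z` in its
denominator. -/
theorem exists_mul_pow_eq_pol_of_integral {f : K} (hf : phi0 f ∈ fracIdeal 0) (m n : ℕ)
    (p : Polynomial F2) (h : f * (z ^ m * (1 + z) ^ n) = pol p) :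
    ∃ p' : Polynomial F2, f * (1 + z) ^ n = pol p' := by
  induction m generalizing p with
  | zero => exact ⟨p, by rw [← h, pow_zero, one_mul]⟩
  | succ m ih =>
    have h1 : phi0 (pol p) ∈ fracIdeal 1 := by
      have hz : (x ^ 2 + x) ∈ fracIdeal 1 := uInf_mem_fracIdeal
      have hz0 := fracIdeal_anti (by norm_num : (0 : ℤ) ≤ 1) hz
      rw [← h, map_mul, map_mul, map_pow, map_pow, map_add, map_one, phi0_z]
      refine zero_mul_mem_fracIdeal hf (mul_mem_fracIdeal_zero ?_ ?_)
      · rw [pow_succ]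
        exact zero_mul_mem_fracIdeal (pow_mem_fracIdeal_zero hz0 m) hz
      · exact pow_mem_fracIdeal_zero (add_mem_fracIdeal one_mem_fracIdeal hz0) n
    rw [phi0_pol] at h1
    have h2 := constantCoeff_eq_zero_of_mem h1
    rw [constantCoeff_aeval, ← Polynomial.coeff_zero_eq_eval_zero, ← Polynomial.X_dvd_iff] at h2
    obtain ⟨p', rfl⟩ := h2
    refine ih p' ?_
    rw [map_mul, pol_X] at h
    apply mul_left_cancel₀ z_ne_zero
    rw [← h]
    ring

theorem one_add_X_dvd_iff {p : Polynomial F2} : 1 + Polynomial.X ∣ p ↔ p.eval 1 = 0 := by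
  have e : (Polynomial.X - Polynomial.C 1 : Polynomial F2) = 1 + Polynomial.X := by
    rw [CharTwo.sub_eq_add, Polynomial.C_1, add_comm]
  rw [← e]
  exact Polynomial.dvd_iff_isRoot

theorem anisotropic : ∀ s t : F2, s ^ 2 + s * t + t ^ 2 = 0 → s = 0 ∧ t = 0 := by decide

/-- The norm form is anisotropic at `z = 1`, so that an element with integral norm is integral. -/
theorem exists_eq_pow_mul_of_form_eq (n : ℕ) (a b c d : Polynomial F2)
    (h : a ^ 2 + a * b + Polynomial.X * b ^ 2 + (1 + Polynomial.X ^ 3) *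
      (c ^ 2 + c * d + Polynomial.X * d ^ 2) = (1 + Polynomial.X) ^ (2 * n)) :
    ∃ a' b' c' d' : Polynomial F2, a = (1 + Polynomial.X) ^ n * a' ∧
      b = (1 + Polynomial.X) ^ n * b' ∧ c = (1 + Polynomial.X) ^ n * c' ∧
      d = (1 + Polynomial.X) ^ n * d' := by
  induction n generalizing a b c d with
  | zero => exact ⟨a, b, c, d, by simp, by simp, by simp, by simp⟩
  | succ n ih =>
    have h0 : (1 + Polynomial.X : Polynomial F2) ≠ 0 := prime_one_add_X.ne_zero
    have h2 : (2 : Polynomial F2) = 0 := CharTwo.two_eq_zero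
    have e2 : (1 + 1 : F2) = 0 := by decide
    have h3 : (1 + Polynomial.X ^ 3 : Polynomial F2)
        = (1 + Polynomial.X) * (1 + Polynomial.X + Polynomial.X ^ 2) := by
      linear_combination (-Polynomial.X - Polynomial.X ^ 2) * h2
    -- Descent at `z = 1`, where `1 + X³` has a simple zero. The value at `1` first involves `a` and
    -- `b` only, in the anisotropic form `s² + s t + t²`, so both are divisible by `1 + X`.
    have k1 := congrArg (Polynomial.eval 1) h
    simp only [Polynomial.eval_add, Polynomial.eval_mul, Polynomial.eval_pow, Polynomial.eval_X,
      Polynomial.eval_one, one_pow, e2, zero_mul, add_zero, one_mul] at k1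
    rw [zero_pow (by omega)] at k1
    obtain ⟨ka, kb⟩ := anisotropic _ _ k1
    obtain ⟨a, rfl⟩ := one_add_X_dvd_iff.mpr ka
    obtain ⟨b, rfl⟩ := one_add_X_dvd_iff.mpr kb
    have h4 : (1 + Polynomial.X) * (a ^ 2 + a * b + Polynomial.X * b ^ 2)
        + (1 + Polynomial.X + Polynomial.X ^ 2) * (c ^ 2 + c * d + Polynomial.X * d ^ 2)
        = (1 + Polynomial.X) * (1 + Polynomial.X) ^ (2 * n) := by
      apply mul_left_cancel₀ h0
      rw [h3] at h
      linear_combination h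
    -- With one factor `1 + X` divided out, the terms in `a` and `b` vanish at `1` and the same form
    -- appears in `c` and `d`.
    have k2 := congrArg (Polynomial.eval 1) h4
    simp only [Polynomial.eval_add, Polynomial.eval_mul, Polynomial.eval_pow, Polynomial.eval_X,
      Polynomial.eval_one, one_pow, e2, zero_mul, zero_add, one_mul] at k2
    obtain ⟨kc, kd⟩ := anisotropic _ _ k2
    obtain ⟨c, rfl⟩ := one_add_X_dvd_iff.mpr kc
    obtain ⟨d, rfl⟩ := one_add_X_dvd_iff.mpr kd
    have h5 : a ^ 2 + a * b + Polynomial.X * b ^ 2 + (1 + Polynomial.X ^ 3) *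
        (c ^ 2 + c * d + Polynomial.X * d ^ 2) = (1 + Polynomial.X) ^ (2 * n) := by
      apply mul_left_cancel₀ h0
      rw [h3]
      linear_combination h4
    obtain ⟨a', b', c', d', rfl, rfl, rfl, rfl⟩ := ih a b c d h5
    refine ⟨a', b', c', d', ?_, ?_, ?_, ?_⟩ <;> ring

theorem phiInf_pol_C (r : F2) : phiInf (pol (Polynomial.C r)) = incl (PowerSeries.C r) := by
  have h : (phiInf.comp pol).comp Polynomial.C = incl.comp PowerSeries.C := Subsingleton.elim _ _
  exact RingHom.congr_fun h r

theorem uInf_mul_inv : uInf * uInf⁻¹ = 1 := mul_inv_cancel₀ sq_add_ne_zero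

/-- A nonzero polynomial does not vanish at infinity. -/
theorem eq_zero_of_phiInf_mem (p : Polynomial F2) (h : phiInf (pol p) ∈ fracIdeal 1) : p = 0 := by
  have const : ∀ r : F2, phiInf (pol (Polynomial.C r)) ∈ fracIdeal 1 → r = 0 := by
    intro r hr
    rw [phiInf_pol_C] at hr
    simpa using constantCoeff_eq_zero_of_mem hr
  induction hn : p.natDegree generalizing p with
  | zero =>
    rw [Polynomial.eq_C_of_natDegree_eq_zero hn] at h ⊢
    rw [const _ h, Polynomial.C_0]
  | succ n ih =>
    -- With `p = X p' + p(0)`, multiplication by `u = z⁻¹` shows that `p'` vanishes at infinity too.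
    -- By induction `p' = 0`, which contradicts the positive degree of `p`.
    have e := Polynomial.X_mul_divX_add p
    have h1 : phiInf (pol p.divX) ∈ fracIdeal 1 := by
      have e1 : phiInf (pol p.divX) = uInf *
          (phiInf (pol p) - phiInf (pol (Polynomial.C (p.coeff 0)))) := by
        have e2 := congrArg (fun q => phiInf (pol q)) e
        simp only [map_add, map_mul, pol_X, phiInf_z] at e2
        rw [← e2, add_sub_cancel_right, ← mul_assoc, uInf_mul_inv, one_mul]
      rw [e1, phiInf_pol_C]
      exact mul_mem_fracIdeal_zero uInf_mem_fracIdeal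
        (sub_mem_fracIdeal (fracIdeal_anti (by norm_num) h) (incl_mem_fracIdeal _))
    have h2 := ih p.divX h1 (by rw [Polynomial.natDegree_divX_eq_natDegree_tsub_one, hn]; rfl)
    rw [h2, mul_zero, zero_add] at e
    rw [← e] at hn
    simp at hn

/-- A polynomial of positive order at infinity is zero. So it is enough to extract from the four
integral entries that first `d`, then `c`, then `b` has positive order. -/
theorem coeff_eq_zero_of_integral_inf {a b c d : Polynomial F2}
    (h : ∀ i j, rhoInf ⟨pol a, pol b, pol c, pol d⟩ i j ∈ fracIdeal 0) :
    b = 0 ∧ c = 0 ∧ d = 0 := by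
  have h2 := two_eq_zero_L
  have huv := uInf_mul_inv
  have hu := uInf_mem_fracIdeal
  rw [rhoInf_apply] at h
  have e11 := h 0 0
  have e12 := h 0 1
  have e21 := h 1 0
  have e22 := h 1 1
  simp only [Matrix.of_apply, Matrix.cons_val', Matrix.cons_val_zero,
    Matrix.cons_val_one] at e11 e12 e21 e22
  obtain ⟨w, hw⟩ : ∃ w : Oˣ, incl w = 1 + uInf ^ 3 := by
    have : IsUnit (1 + (PowerSeries.X ^ 2 + PowerSeries.X) ^ 3 : O) := by
      rw [PowerSeries.isUnit_iff_constantCoeff]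
      simp
    obtain ⟨w, hw⟩ := this
    exact ⟨w, by rw [hw, map_add, map_one, map_pow, map_add, map_pow, incl_X]⟩
  have hd := eq_zero_of_phiInf_mem d
  have hc := eq_zero_of_phiInf_mem c
  have hb := eq_zero_of_phiInf_mem b
  generalize phiInf (pol a) = A at *
  generalize phiInf (pol b) = B at *
  generalize hC : phiInf (pol c) = C at *
  generalize hD : phiInf (pol d) = D at *
  have hB : B ∈ fracIdeal 0 := by
    have := sub_mem_fracIdeal e11 e22
    convert this using 1
    grind
  -- This is `u²` times the lower left entry. The next expression is `u` times the upper right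
  -- entry, divided by the unit `1 + u³`; the two differ by `D`.
  have hE : B * uInf + C + D * (uInf + x) ∈ fracIdeal 2 := by
    have := mul_mem_fracIdeal (mul_mem_fracIdeal hu hu) e21
    norm_num only at this
    convert this using 1
    grind
  have hF : B * uInf + C + D * (1 + uInf + x) ∈ fracIdeal 1 := by
    rw [← mul_unit_mem_fracIdeal w, hw]
    have := mul_mem_fracIdeal_zero hu e12
    convert this using 1
    grind
  have hD1 : D ∈ fracIdeal 1 := by
    have := sub_mem_fracIdeal hF (fracIdeal_anti (by norm_num) hE)
    convert this using 1
    ring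
  have hd0 := hd hD1
  have hD0 : D = 0 := by rw [← hD, hd0, map_zero, map_zero]
  rw [hD0, zero_mul, add_zero] at hE
  have hBu := zero_mul_mem_fracIdeal hB hu
  have hc0 := hc (by
    have := sub_mem_fracIdeal (fracIdeal_anti (by norm_num) hE) hBu
    rwa [add_sub_cancel_left] at this)
  have hC0 : C = 0 := by rw [← hC, hc0, map_zero, map_zero]
  rw [hC0, add_zero] at hE
  refine ⟨hb ?_, hc0, hd0⟩
  have hv : uInf⁻¹ ∈ fracIdeal (-1) := ⟨wSer, by rw [zpow_neg_one, uInf_inv]⟩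
  have := mul_mem_fracIdeal hE hv
  rwa [mul_assoc, huv, mul_one] at this

theorem det_rho0 (q : Q) : (rho0 q).det = phi0 (q * star q).re := by
  have h2 := two_eq_zero_L
  rw [rho0_apply, Matrix.det_fin_two_of, re_mul_star]
  simp only [map_add, map_mul, map_pow, map_one, phi0_z]
  grind

theorem det_rhoInf (q : Q) : (rhoInf q).det = phiInf (q * star q).re := by
  have h2 := two_eq_zero_L
  have huv := uInf_mul_inv
  rw [rhoInf_apply, Matrix.det_fin_two_of, re_mul_star]
  simp only [map_add, map_mul, map_pow, map_one, phiInf_z]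
  generalize phiInf q.re = A, phiInf q.imI = B, phiInf q.imJ = C, phiInf q.imK = D
  have hu : uInf = x ^ 2 + x := rfl
  generalize (x ^ 2 + x)⁻¹ = v at *
  generalize x = t at *
  grind

theorem det_mem_fracIdeal {m : GL (Fin 2) L} (hm : IsIntegral m) :
    (m : Matrix (Fin 2) (Fin 2) L).det ∈ fracIdeal 0 := by
  rw [Matrix.det_fin_two]
  exact sub_mem_fracIdeal (mul_mem_fracIdeal_zero (hm _ _) (hm _ _))
    (mul_mem_fracIdeal_zero (hm _ _) (hm _ _))

theorem det_sc_mul (c : Lˣ) (g : GL (Fin 2) L) :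
    ((sc c * g : GL (Fin 2) L) : Matrix (Fin 2) (Fin 2) L).det
      = c ^ 2 * (g : Matrix (Fin 2) (Fin 2) L).det := by
  rw [Matrix.det_fin_two, Matrix.det_fin_two, sc_mul_apply, sc_mul_apply, sc_mul_apply,
    sc_mul_apply]
  ring

theorem inv_zpow_mul_unit (n : ℤ) (u : Oˣ) :
    (x ^ n * incl u)⁻¹ = x ^ (-n) * incl ((u⁻¹ : Oˣ) : O) := by
  rw [mul_inv, ← zpow_neg]
  congr 1
  exact inv_eq_of_mul_eq_one_right (by rw [← map_mul, Units.mul_inv, map_one])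

theorem det_inv (g : GL (Fin 2) L) : ((g⁻¹ : GL (Fin 2) L) : Matrix (Fin 2) (Fin 2) L).det
    = ((g : Matrix (Fin 2) (Fin 2) L).det)⁻¹ := by
  rw [Matrix.coe_units_inv, Matrix.det_nonsing_inv, Ring.inverse_eq_inv]

/-- Such a `g` is a scalar of some order `n` times an element of `GL₂(𝔽₂[[x]])`, so its determinant
has the even order `2 n`. -/
theorem exists_det_eq_of_smul_stdV_eq {g : GL (Fin 2) L} (h : g • stdV = stdV) :
    ∃ (n : ℤ) (u : Oˣ), (g : Matrix (Fin 2) (Fin 2) L).det = x ^ (2 * n) * incl u ∧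
      ∀ i j, (g : Matrix (Fin 2) (Fin 2) L) i j ∈ fracIdeal n := by
  have h' : g • stdV = (1 : GL (Fin 2) L) • stdV := by rw [h, one_smul]
  obtain ⟨c, h1, h2⟩ := smul_stdV_eq_smul_stdV.mp h'
  rw [inv_one, one_mul] at h1
  rw [mul_one] at h2
  obtain ⟨k, w, hc⟩ := exists_eq_zpow_mul_unit c.ne_zero
  have hdet : (g : Matrix (Fin 2) (Fin 2) L).det ≠ 0 :=
    ((Matrix.isUnit_iff_isUnit_det _).mp g.isUnit).ne_zero
  obtain ⟨m, u, hu⟩ := exists_eq_zpow_mul_unit hdet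
  have d1 := det_mem_fracIdeal h1
  have d2 := det_mem_fracIdeal h2
  -- The determinants of the integral matrix `c g` and of its integral inverse have opposite orders,
  -- both nonnegative.
  have hm : m = 2 * -k := by
    rw [det_sc_mul, hc, hu] at d1
    rw [det_sc_mul, det_inv, Units.val_inv_eq_inv_val, hc, hu, inv_zpow_mul_unit,
      inv_zpow_mul_unit] at d2
    have e : ∀ (a b : ℤ) (v y : L), (x ^ a * v) ^ 2 * (x ^ b * y) = x ^
      (2 * a + b) * y * v * v := by
      intro a b v y
      rw [zpow_add₀ x_ne_zero, mul_comm 2 a, zpow_mul, zpow_ofNat]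
      ring
    rw [e, mul_unit_mem_fracIdeal, mul_unit_mem_fracIdeal, zpow_mul_unit_mem] at d1 d2
    omega
  refine ⟨-k, u, by rw [hu, hm], fun i j => ?_⟩
  have := h1 i j
  rwa [sc_mul_apply, hc, mul_right_comm, mul_unit_mem_fracIdeal, zpow_mul_mem_fracIdeal,
    zero_sub] at this

theorem pgl_mk_map_smul {ρ : Q →+* Matrix (Fin 2) (Fin 2) L} {h} {U : Qˣ}
    (hU : toPGL ρ h (QuotientGroup.mk' scalars U) • stdV = stdV) :
    ∃ (n : ℤ) (u : Oˣ), (ρ U).det = x ^ (2 * n) * incl u ∧ ∀ i j, ρ U i j ∈ fracIdeal n :=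
  exists_det_eq_of_smul_stdV_eq (g := Units.map (ρ : Q →* Matrix (Fin 2) (Fin 2) L) U) hU

theorem rho0_smul_apply (c : K) (q : Q) (i j : Fin 2) :
    rho0 (c • q) i j = phi0 c * rho0 q i j := by
  rw [rho0_apply, rho0_apply]
  simp only [QuaternionAlgebra.re_smul, QuaternionAlgebra.imI_smul, QuaternionAlgebra.imJ_smul,
    QuaternionAlgebra.imK_smul, smul_eq_mul, map_mul]
  fin_cases i <;> fin_cases j <;> simp <;> ring

theorem rhoInf_smul_apply (c : K) (q : Q) (i j : Fin 2) :
    rhoInf (c • q) i j = phiInf c * rhoInf q i j := by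
  rw [rhoInf_apply, rhoInf_apply]
  simp only [QuaternionAlgebra.re_smul, QuaternionAlgebra.imI_smul, QuaternionAlgebra.imJ_smul,
    QuaternionAlgebra.imK_smul, smul_eq_mul, map_mul]
  fin_cases i <;> fin_cases j <;> simp <;> ring

/-- At `z = 0` the factor `1 + z³` is a unit, and the coordinates can be recovered integrally: the
difference of the diagonal entries gives `imI`, and that of the lower left and the reduced upper
right entry gives `imK`. -/
theorem integral_of_rho0 {q : Q} (h : ∀ i j, rho0 q i j ∈ fracIdeal 0) :
    phi0 q.re ∈ fracIdeal 0 ∧ phi0 q.imI ∈ fracIdeal 0 ∧ phi0 q.imJ ∈ fracIdeal 0 ∧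
      phi0 q.imK ∈ fracIdeal 0 := by
  have h2 := two_eq_zero_L
  have hx : x ∈ fracIdeal 0 := fracIdeal_anti (by norm_num) x_mem_fracIdeal
  rw [rho0_apply] at h
  have e11 := h 0 0
  have e12 := h 0 1
  have e21 := h 1 0
  have e22 := h 1 1
  simp only [Matrix.of_apply, Matrix.cons_val', Matrix.cons_val_zero, Matrix.cons_val_one]
    at e11 e12 e21 e22
  obtain ⟨w, hw⟩ : ∃ w : Oˣ, incl w = phi0 (1 + z ^ 3) := by
    have : IsUnit (1 + (PowerSeries.X ^ 2 + PowerSeries.X) ^ 3 : O) := by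
      rw [PowerSeries.isUnit_iff_constantCoeff]
      simp
    obtain ⟨w, hw⟩ := this
    refine ⟨w, ?_⟩
    rw [hw, map_add, map_one, map_pow, map_add, map_pow, incl_X, map_add, map_one, map_pow, phi0_z]
  rw [← hw, mul_unit_mem_fracIdeal] at e12
  generalize phi0 q.re = A, phi0 q.imI = B, phi0 q.imJ = C, phi0 q.imK = D at *
  have hB : B ∈ fracIdeal 0 := by
    have := sub_mem_fracIdeal e22 e11
    convert this using 1
    ring
  have hD : D ∈ fracIdeal 0 := by
    have := sub_mem_fracIdeal e21 e12
    convert this using 1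
    ring
  refine ⟨?_, hB, ?_, hD⟩
  · have := sub_mem_fracIdeal e11 (mul_mem_fracIdeal_zero hB hx)
    rwa [add_sub_cancel_right] at this
  · have := sub_mem_fracIdeal e12 (mul_mem_fracIdeal_zero hD hx)
    rwa [add_sub_cancel_right] at this

theorem exists_mul_one_add_pow_eq_pol {f : K} (hf : f ∈ R1) (h0 : phi0 f ∈ fracIdeal 0) :
    ∃ (n : ℕ) (p : Polynomial F2), f * (1 + z) ^ n = pol p := by
  obtain ⟨m, p, hp⟩ := exists_mul_pow_eq_pol hf
  rw [mul_pow] at hp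
  exact ⟨m, exists_mul_pow_eq_pol_of_integral h0 m m p hp⟩

/-- Elements of `R₁` have finite poles only at `0` and `1`. The former are excluded by integrality
at `z = 0`, the latter by the anisotropy of the norm form at `z = 1`. -/
theorem exists_eq_pol_of_integral {q : Q} (hq : q ∈ O1) (hn : (q * star q).re = 1)
    (h0 : ∀ i j, rho0 q i j ∈ fracIdeal 0) :
    ∃ a b c d : Polynomial F2, q = ⟨pol a, pol b, pol c, pol d⟩ := by
  obtain ⟨q1, q2, q3, q4⟩ := hq
  obtain ⟨i1, i2, i3, i4⟩ := integral_of_rho0 h0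
  obtain ⟨n1, p1, e1⟩ := exists_mul_one_add_pow_eq_pol q1 i1
  obtain ⟨n2, p2, e2⟩ := exists_mul_one_add_pow_eq_pol q2 i2
  obtain ⟨n3, p3, e3⟩ := exists_mul_one_add_pow_eq_pol q3 i3
  obtain ⟨n4, p4, e4⟩ := exists_mul_one_add_pow_eq_pol q4 i4
  have key : ∀ (f : K) (m l n : ℕ) (p : Polynomial F2), m + l = n → f * (1 + z) ^ m = pol p →
      f * (1 + z) ^ n = pol (p * (1 + Polynomial.X) ^ l) := by
    rintro f m l n p rfl e
    rw [map_mul, ← e, map_pow, pol_one_add_X, pow_add, mul_assoc]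
  have k1 := key _ n1 (n2 + n3 + n4) (n1 + n2 + n3 + n4) _ (by omega) e1
  have k2 := key _ n2 (n1 + n3 + n4) (n1 + n2 + n3 + n4) _ (by omega) e2
  have k3 := key _ n3 (n1 + n2 + n4) (n1 + n2 + n3 + n4) _ (by omega) e3
  have k4 := key _ n4 (n1 + n2 + n3) (n1 + n2 + n3 + n4) _ (by omega) e4
  generalize n1 + n2 + n3 + n4 = n, p1 * (1 + Polynomial.X) ^ (n2 + n3 + n4) = r1,
    p2 * (1 + Polynomial.X) ^ (n1 + n3 + n4) = r2, p3 * (1 + Polynomial.X) ^ (n1 + n2 + n4) = r3,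
    p4 * (1 + Polynomial.X) ^ (n1 + n2 + n3) = r4 at k1 k2 k3 k4
  have hform : r1 ^ 2 + r1 * r2 + Polynomial.X * r2 ^ 2 + (1 + Polynomial.X ^ 3) *
      (r3 ^ 2 + r3 * r4 + Polynomial.X * r4 ^ 2) = (1 + Polynomial.X) ^ (2 * n) := by
    apply pol_injective
    rw [re_mul_star] at hn
    rw [map_pow, pol_one_add_X]
    simp only [map_add, map_mul, map_pow, map_one, pol_X, ← k1, ← k2, ← k3, ← k4]
    linear_combination (1 + z) ^ (2 * n) * hn
  obtain ⟨a, b, c, d, rfl, rfl, rfl, rfl⟩ := exists_eq_pow_mul_of_form_eq n r1 r2 r3 r4 hform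
  have cancel : ∀ (f : K) (p : Polynomial F2),
      f * (1 + z) ^ n = pol ((1 + Polynomial.X) ^ n * p) → f = pol p := by
    intro f p e
    rw [map_mul, map_pow, pol_one_add_X, mul_comm] at e
    exact mul_left_cancel₀ (pow_ne_zero n one_add_z_ne_zero) e
  refine ⟨a, b, c, d, ?_⟩
  ext
  exacts [cancel _ _ k1, cancel _ _ k2, cancel _ _ k3, cancel _ _ k4]

theorem exists_phi0_eq (i j : ℤ) : ∃ u : Oˣ, phi0 (z ^ i * (1 + z) ^ j) = x ^ i * incl u := by
  have h1 : IsUnit (1 + PowerSeries.X : O) := by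
    rw [PowerSeries.isUnit_iff_constantCoeff]; simp
  have h3 : IsUnit (1 + (PowerSeries.X ^ 2 + PowerSeries.X) : O) := by
    rw [PowerSeries.isUnit_iff_constantCoeff]; simp
  obtain ⟨u, hu⟩ := h1
  obtain ⟨w, hw⟩ := h3
  refine ⟨u ^ i * w ^ j, ?_⟩
  have e : ∀ (v : Oˣ) (k : ℤ), incl ((v ^ k : Oˣ) : O) = incl (v : O) ^ k := fun v k => by
    have := map_zpow (Units.map (incl : O →* L)) v k
    have h := congrArg Units.val this
    rw [Units.val_zpow_eq_zpow_val] at h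
    exact h
  rw [Units.val_mul, map_mul incl, e, e, hu, hw, map_mul, map_zpow₀, map_zpow₀, map_add, map_one,
    phi0_z]
  simp only [map_add, map_one, map_pow, incl_X]
  rw [← mul_assoc, ← mul_zpow]
  congr 2
  ring

theorem exists_phiInf_eq (i j : ℤ) :
    ∃ u : Oˣ, phiInf (z ^ i * (1 + z) ^ j) = x ^ (-(i + j)) * incl u := by
  have h3 : IsUnit (1 + (PowerSeries.X ^ 2 + PowerSeries.X) : O) := by
    rw [PowerSeries.isUnit_iff_constantCoeff]; simp
  have h1 : IsUnit wSer := IsUnit.of_mul_eq_one_right _ mul_wSer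
  obtain ⟨u, hu⟩ := h1
  obtain ⟨w, hw⟩ := h3
  refine ⟨u ^ (i + j) * w ^ j, ?_⟩
  have e : ∀ (v : Oˣ) (k : ℤ), incl ((v ^ k : Oˣ) : O) = incl (v : O) ^ k := fun v k => by
    have := map_zpow (Units.map (incl : O →* L)) v k
    have h := congrArg Units.val this
    rw [Units.val_zpow_eq_zpow_val] at h
    exact h
  have h4 : 1 + uInf⁻¹ = uInf⁻¹ * (1 + uInf) := by
    rw [mul_add, mul_one, mul_comm, uInf_mul_inv, add_comm]
  rw [Units.val_mul, map_mul incl, e, e, hu, hw, map_mul, map_zpow₀, map_zpow₀, map_add, map_one,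
    phiInf_z, h4, mul_zpow, ← mul_assoc, ← zpow_add₀ (inv_ne_zero sq_add_ne_zero), uInf_inv,
    mul_zpow, inv_zpow, zpow_neg]
  simp only [map_add, map_one, map_pow, incl_X, mul_assoc]

/-- The stabiliser of the base vertex of `T₀ × T_∞` in `G(R₁)` is trivial. -/
theorem eq_one_of_mem_GR1 {g : GK} (hg : g ∈ GR1) (h0 : pgl0 g • stdV = stdV)
    (hInf : pglInf g • stdV = stdV) : g = 1 := by
  obtain ⟨U, hU, rfl⟩ := hg
  obtain ⟨hU1, hU2⟩ := (Submonoid.mem_units_iff _ _).mp hU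
  obtain ⟨n, u, hdet, hint⟩ := pgl_mk_map_smul h0
  obtain ⟨n', u', hdet', hint'⟩ := pgl_mk_map_smul hInf
  have norm_mem : ∀ q ∈ O1, (q * star q).re ∈ R1 := fun q hq => (mul_mem hq (star_mem_O1 hq)).1
  have hNN : ((U : Q) * star (U : Q)).re * (((U⁻¹ : Qˣ) : Q) * star ((U⁻¹ : Qˣ) : Q)).re = 1 := by
    rw [← re_mul_star_mul, Units.mul_inv, star_one, mul_one, QuaternionAlgebra.re_one]
  obtain ⟨i, j, hN⟩ := exists_eq_zpow_of_mul_eq_one (norm_mem _ hU1) (norm_mem _ hU2) hNN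
  rw [det_rho0, hN] at hdet
  rw [det_rhoInf, hN] at hdet'
  obtain ⟨w, hw⟩ := exists_phi0_eq i j
  obtain ⟨w', hw'⟩ := exists_phiInf_eq i j
  -- Fixing both base vertices makes the orders of the norm at `0` and at `∞` even, so both
  -- exponents of `z ^ i * (1 + z) ^ j` are even and the norm is a square.
  have hi := zpow_mul_unit_injective (hw.symm.trans hdet)
  have hj := zpow_mul_unit_injective (hw'.symm.trans hdet')
  obtain rfl : j = 2 * (-n - n') := by omega
  subst hi
  have hz := z_ne_zero
  have hz1 := one_add_z_ne_zero
  -- This factor is the inverse square root of the norm. It has order `-n` at `0` and `-n'` at `∞`,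
  -- just what makes both matrices integral.
  have hs0 : z ^ (-n) * (1 + z) ^ (n + n') ≠ 0 :=
    mul_ne_zero (zpow_ne_zero _ hz) (zpow_ne_zero _ hz1)
  have hs1 : z ^ (-n) * (1 + z) ^ (n + n') ∈ R1 := mul_mem (zpow_mem_R1 _) (one_add_zpow_mem_R1 _)
  obtain ⟨v, hv⟩ := exists_phi0_eq (-n) (n + n')
  obtain ⟨v', hv'⟩ := exists_phiInf_eq (-n) (n + n')
  have hnorm : (z ^ (-n) * (1 + z) ^ (n + n')) ^ 2 * ((U : Q) * star (U : Q)).re = 1 := by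
    rw [hN, mul_pow, ← zpow_natCast, ← zpow_natCast, ← zpow_mul, ← zpow_mul, mul_mul_mul_comm,
      ← zpow_add₀ hz, ← zpow_add₀ hz1]
    have e1 : -n * ((2 : ℕ) : ℤ) + 2 * n = 0 := by push_cast; ring
    have e2 : (n + n') * ((2 : ℕ) : ℤ) + 2 * (-n - n') = 0 := by push_cast; ring
    rw [e1, e2, zpow_zero, zpow_zero, one_mul]
  generalize z ^ (-n) * (1 + z) ^ (n + n') = s at *
  have k0 : ∀ i j, rho0 (s • (U : Q)) i j ∈ fracIdeal 0 := by
    intro i j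
    rw [rho0_smul_apply, hv, mul_right_comm, mul_unit_mem_fracIdeal, zpow_mul_mem_fracIdeal,
      zero_sub, neg_neg]
    exact hint i j
  have kInf : ∀ i j, rhoInf (s • (U : Q)) i j ∈ fracIdeal 0 := by
    intro i j
    rw [rhoInf_smul_apply, hv', mul_right_comm, mul_unit_mem_fracIdeal, zpow_mul_mem_fracIdeal]
    convert hint' i j using 2
    ring
  have knorm : ((s • (U : Q)) * star (s • (U : Q))).re = 1 := by
    refine Eq.trans ?_ hnorm
    rw [re_mul_star, re_mul_star]
    simp only [QuaternionAlgebra.re_smul, QuaternionAlgebra.imI_smul, QuaternionAlgebra.imJ_smul,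
      QuaternionAlgebra.imK_smul, smul_eq_mul]
    ring
  obtain ⟨a, b, c, d, e⟩ := exists_eq_pol_of_integral (smul_mem_O1 hs1 hU1) knorm k0
  rw [e] at kInf knorm
  obtain ⟨rfl, rfl, rfl⟩ := coeff_eq_zero_of_integral_inf kInf
  have ha : pol a ≠ 0 := by
    intro ha
    rw [re_mul_star] at knorm
    simp [ha] at knorm
  refine (QuotientGroup.eq_one_iff U).mpr ⟨Units.mk0 (s⁻¹ * pol a)
    (mul_ne_zero (inv_ne_zero hs0) ha),
    Units.ext ?_⟩
  change algebraMap K Q (s⁻¹ * pol a) = U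
  have e' : (U : Q) = s⁻¹ • (s • (U : Q)) := by rw [smul_smul, inv_mul_cancel₀ hs0, one_smul]
  rw [e', e, map_mul, Algebra.smul_def]
  congr 1
  simp only [map_zero]
  rfl

/-- The subgroup `Λ` is already transitive on the vertices and the stabiliser in `G(R₁)` is trivial.
-/
theorem Lam_eq_GR1 : Lam = GR1 := by
  refine le_antisymm Lam_le_GR1 fun g hg => ?_
  obtain ⟨l, hl, -⟩ := btAct_existsUnique (stdV, stdV) (btAct g (stdV, stdV))
  have h : (l : GK)⁻¹ * g = 1 := by
    refine eq_one_of_mem_GR1 (mul_mem (inv_mem (Lam_le_GR1 l.2)) hg) ?_ ?_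
    · rw [map_mul, mul_smul, map_inv, inv_smul_eq_iff]
      exact (congrArg Prod.fst hl).symm
    · rw [map_mul, mul_smul, map_inv, inv_smul_eq_iff]
      exact (congrArg Prod.snd hl).symm
  rw [inv_mul_eq_one] at h
  exact h ▸ l.2

/-! ### The subgroup `Γ` -/

namespace LamRels

variable {P : Type*} [Group P] {b₁ b₂ c₁ c₂ : P}

/-- The two relators of `Γ`. -/
def relOne {P : Type*} [Group P] (a b : P) : P := b * a⁻¹ * b ^ 2 * a * b * a * b ^ 2 * a⁻¹ * b * a

/-- The second relator of `Γ`. -/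
def relTwo {P : Type*} [Group P] (a b : P) : P :=
  a * b ^ 2 * a⁻¹ * b ^ 2 * a⁻¹ * b ^ 2 * a * b * a⁻¹ * b

/-- The elements `w` of `Γ` with `b₁ r = r' w` for the coset representatives `1, c₁, c₂, c₁ c₂`. -/
def uOne {P : Type*} [Group P] (a b : P) : Bool → Bool → P
  | false, false => a * b * a⁻¹ * b
  | true, false => a⁻¹
  | false, true => a * b⁻¹
  | true, true => b * a * b * a⁻¹

/-- The elements `w` of `Γ` with `b₂ r = r' w` for the coset representatives `1, c₁, c₂, c₁ c₂`. -/
def uTwo {P : Type*} [Group P] (a b : P) : Bool → Bool → P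
  | false, false => b * a * b * b * a⁻¹ * b
  | true, false => a * b⁻¹ * a⁻¹
  | false, true => b⁻¹
  | true, true => a * b * a⁻¹ * b * b * a * b * a⁻¹

/-- The coset representatives of `Γ` in `Λ`. -/
def rep {P : Type*} [Group P] (c₁ c₂ : P) (i j : Bool) : P :=
  (if i then c₁ else 1) * (if j then c₂ else 1)

/-- The relation `b₁ c₂ b₁ = b₂` rewritten over each coset; it holds already in the free group and
may serve to define `uTwo`. -/
theorem uTwo_eq (a b : P) (i j : Bool) : uOne a b (!i) (!j) * uOne a b i j = uTwo a b i j := by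
  cases i <;> cases j <;> simp [uOne, uTwo, mul_assoc]

/-- The relation `b₂ b₁ b₂ = c₁` rewritten over each coset. For the representatives `1` and `c₁ c₂`
conjugates of the two relators appear; for `c₁` and `c₂` the word cancels freely. -/
theorem uTwo_mul (a b : P) (h1 : relOne a b = 1) (h2 : relTwo a b = 1) (i j : Bool) :
    uTwo a b (!i) (!j) * uOne a b i (!j) * uTwo a b i j = 1 := by
  cases i <;> cases j
  · have e : uTwo a b true true * uOne a b false true * uTwo a b false false
        = a * relOne a b * a⁻¹ := by
      simp [uOne, uTwo, relOne, mul_assoc, pow_two]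
    rw [Bool.not_false, e, h1]
    simp
  · simp [uOne, uTwo, mul_assoc]
  · simp [uOne, uTwo, mul_assoc]
  · have e : uTwo a b false false * uOne a b true false * uTwo a b true true
        = b * relTwo a b * b⁻¹ := by
      simp [uOne, uTwo, relTwo, mul_assoc, pow_two]
    rw [Bool.not_true, e, h2]
    simp

theorem inv_c₁ (h : LamRels b₁ b₂ c₁ c₂) : c₁⁻¹ = c₁ := inv_eq_of_mul_eq_one_right h.cc₁

theorem inv_c₂ (h : LamRels b₁ b₂ c₁ c₂) : c₂⁻¹ = c₂ := inv_eq_of_mul_eq_one_right h.cc₂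

theorem c₁_mul_rep (h : LamRels b₁ b₂ c₁ c₂) (i j : Bool) :
    c₁ * rep c₁ c₂ i j = rep c₁ c₂ (!i) j := by
  cases i <;> simp [rep, ← mul_assoc, h.cc₁]

theorem c₂_mul_rep (h : LamRels b₁ b₂ c₁ c₂) (i j : Bool) :
    c₂ * rep c₁ c₂ i j = rep c₁ c₂ i !j := by
  cases i <;> cases j <;> simp [rep, h.cc₂, h.comm, ← mul_assoc]

/-- Substituting the definitions of the generators turns the right side into a word in `b₁, b₂, c₁,
c₂`. The rules `k1` to `k5`, which are forms of the square relations, shorten it to the left side.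
-/
theorem b₁_mul_rep (h : LamRels b₁ b₂ c₁ c₂) (i j : Bool) :
    b₁ * rep c₁ c₂ i j = rep c₁ c₂ (!i) j * uOne (c₁ * b₁⁻¹) (c₂ * b₂⁻¹) i j := by
  have i₁ := h.inv_c₁
  have i₂ := h.inv_c₂
  have c11 : ∀ y, c₁ * (c₁ * y) = y := fun y => by rw [← mul_assoc, h.cc₁, one_mul]
  have c22 : ∀ y, c₂ * (c₂ * y) = y := fun y => by rw [← mul_assoc, h.cc₂, one_mul]
  have c21 : ∀ y, c₂ * (c₁ * y) = c₁ * (c₂ * y) := fun y => by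
    rw [← mul_assoc, ← h.comm, mul_assoc]
  have k1 : ∀ y, b₂⁻¹ * (b₁ * y) = b₁⁻¹ * (c₂ * y) := fun y => by
    rw [← h.bbc]; simp [mul_assoc, i₂]
  have k2 : ∀ y, b₁⁻¹ * (b₂ * y) = c₂ * (b₁ * y) := fun y => by
    rw [← h.bbc]; simp [mul_assoc]
  have k3 : ∀ y, b₁⁻¹ * (c₂ * (b₁⁻¹ * y)) = b₂⁻¹ * y := fun y => by
    rw [← h.bbc]; simp [mul_assoc, i₂]
  have k4 : b₂⁻¹ * (c₁ * b₂⁻¹) = b₁ := by rw [← h.bcb]; group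
  have k5 : ∀ y, b₂⁻¹ * (c₁ * (b₂⁻¹ * y)) = b₁ * y := fun y => by
    rw [← k4]; simp only [mul_assoc]
  cases i <;> cases j
  · simp only [rep, uOne, Bool.not_false, if_true, Bool.false_eq_true, if_false, mul_one,
      mul_inv_rev, inv_inv, mul_assoc, i₁, c11, c21, c22, k1, k3, k4]
  · simp only [rep, uOne, Bool.not_false, if_true, Bool.false_eq_true, if_false, one_mul,
      mul_inv_rev, inv_inv, mul_assoc, i₂, c11, c21, c22, k2]
  · simp [rep, uOne, i₁]
  · simp only [rep, uOne, Bool.not_true, if_true, Bool.false_eq_true, if_false, one_mul,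
      mul_inv_rev, inv_inv, mul_assoc, i₁, c22, k1, k3, k5, h.comm]

theorem b₂_mul_rep (h : LamRels b₁ b₂ c₁ c₂) (i j : Bool) :
    b₂ * rep c₁ c₂ i j = rep c₁ c₂ i (!j) * uTwo (c₁ * b₁⁻¹) (c₂ * b₂⁻¹) i j := by
  have e : b₁ * (c₂ * (b₁ * rep c₁ c₂ i j)) = b₂ * rep c₁ c₂ i j := by
    conv_rhs => rw [← h.bbc]
    simp only [mul_assoc]
  rw [← e, h.b₁_mul_rep, ← mul_assoc c₂, h.c₂_mul_rep, ← mul_assoc, h.b₁_mul_rep, Bool.not_not,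
    mul_assoc, uTwo_eq]

/-- Comparing `b₂ b₁ b₂ r` with `c₁ r` for a representative `r`, which yields the relators as
identities in `Λ`. -/
theorem uTwo_mul_uOne_mul_uTwo (h : LamRels b₁ b₂ c₁ c₂) (i j : Bool) :
    uTwo (c₁ * b₁⁻¹) (c₂ * b₂⁻¹) (!i) (!j) * uOne (c₁ * b₁⁻¹) (c₂ * b₂⁻¹) i (!j) *
      uTwo (c₁ * b₁⁻¹) (c₂ * b₂⁻¹) i j = 1 := by
  have e : b₂ * (b₁ * (b₂ * rep c₁ c₂ i j)) = rep c₁ c₂ (!i) j := by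
    rw [← h.c₁_mul_rep, ← h.bcb]
    simp only [mul_assoc]
  rw [h.b₂_mul_rep, ← mul_assoc b₁, h.b₁_mul_rep, ← mul_assoc, ← mul_assoc, h.b₂_mul_rep,
    Bool.not_not, mul_assoc, mul_assoc, ← mul_assoc (uTwo _ _ _ _)] at e
  exact mul_eq_left.mp e

theorem relOne_eq_one (h : LamRels b₁ b₂ c₁ c₂) : relOne (c₁ * b₁⁻¹) (c₂ * b₂⁻¹) = 1 := by
  have e := h.uTwo_mul_uOne_mul_uTwo false false
  generalize c₁ * b₁⁻¹ = a at *
  generalize c₂ * b₂⁻¹ = b at *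
  have e' : relOne a b = a⁻¹ * (uTwo a b (!false) (!false) * uOne a b false (!false) *
      uTwo a b false false) * a := by
    simp [uOne, uTwo, relOne, mul_assoc, pow_two]
  rw [e', e, mul_one, inv_mul_cancel]

theorem relTwo_eq_one (h : LamRels b₁ b₂ c₁ c₂) : relTwo (c₁ * b₁⁻¹) (c₂ * b₂⁻¹) = 1 := by
  have e := h.uTwo_mul_uOne_mul_uTwo true true
  generalize c₁ * b₁⁻¹ = a at *
  generalize c₂ * b₂⁻¹ = b at *
  have e' : relTwo a b = b⁻¹ * (uTwo a b (!true) (!true) * uOne a b true (!true) *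
      uTwo a b true true) * b := by
    simp [uOne, uTwo, relTwo, mul_assoc, pow_two]
  rw [e', e, mul_one, inv_mul_cancel]

end LamRels

open LamRels

theorem dist_smul_eq {V P : Type*} [Group P] [MulAction P V] {G : SimpleGraph V} (hG : G.IsTree)
    (hact : ∀ (g : P) (v w : V), G.Adj v w → G.Adj (g • v) (g • w)) (g : P) (v w : V) :
    G.dist (g • v) (g • w) = G.dist v w := by
  refine le_antisymm (dist_smul_le hG hact g v w) ?_
  have := dist_smul_le hG hact g⁻¹ (g • v) (g • w)
  rwa [inv_smul_smul, inv_smul_smul] at this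

theorem relsGam_eq : relsGam = {relOne (FreeGroup.of 0) (FreeGroup.of 1),
    relTwo (FreeGroup.of 0) (FreeGroup.of 1)} := rfl

theorem map_relOne {P P' : Type*} [Group P] [Group P'] (f : P →* P') (a b : P) :
    f (relOne a b) = relOne (f a) (f b) := by simp [relOne]

theorem map_relTwo {P P' : Type*} [Group P] [Group P'] (f : P →* P') (a b : P) :
    f (relTwo a b) = relTwo (f a) (f b) := by simp [relTwo]

theorem lift_relsGam_eq_one : ∀ r ∈ relsGam, FreeGroup.lift ![a1, a2] r = 1 := by
  rw [relsGam_eq]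
  rintro r (rfl | rfl)
  · rw [map_relOne, FreeGroup.lift_apply_of, FreeGroup.lift_apply_of]
    exact lamRels_Lam.relOne_eq_one
  · rw [map_relTwo, FreeGroup.lift_apply_of, FreeGroup.lift_apply_of]
    exact lamRels_Lam.relTwo_eq_one

/-- The group with the presentation of `Γ`. -/
abbrev PGam : Type := PresentedGroup relsGam

/-- The homomorphism from the presented group to `Λ`. -/
def presGam : PGam →* Lam := PresentedGroup.toGroup lift_relsGam_eq_one

theorem presGam_zero : presGam (PresentedGroup.of 0) = a1 :=
  PresentedGroup.toGroup.of lift_relsGam_eq_one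

theorem presGam_one : presGam (PresentedGroup.of 1) = a2 :=
  PresentedGroup.toGroup.of lift_relsGam_eq_one

theorem range_presGam : presGam.range = Gam := by
  rw [MonoidHom.range_eq_map, ← PresentedGroup.closure_range_of relsGam, MonoidHom.map_closure]
  unfold Gam
  congr 1
  ext g
  constructor
  · rintro ⟨_, ⟨i, rfl⟩, rfl⟩
    fin_cases i
    · exact Or.inl presGam_zero
    · exact Or.inr presGam_one
  · rintro (rfl | rfl)
    · exact ⟨_, ⟨0, rfl⟩, presGam_zero⟩
    · exact ⟨_, ⟨1, rfl⟩, presGam_one⟩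

theorem relOne_of : relOne (PresentedGroup.of 0 : PGam) (PresentedGroup.of 1) = 1 := by
  have h : PresentedGroup.mk relsGam (relOne (FreeGroup.of 0) (FreeGroup.of 1)) = 1 :=
    PresentedGroup.one_of_mem (Or.inl rfl)
  rwa [map_relOne] at h

theorem relTwo_of : relTwo (PresentedGroup.of 0 : PGam) (PresentedGroup.of 1) = 1 := by
  have h : PresentedGroup.mk relsGam (relTwo (FreeGroup.of 0) (FreeGroup.of 1)) = 1 :=
    PresentedGroup.one_of_mem (Or.inr rfl)
  rwa [map_relTwo] at h

/-! ### The induced action and the presentation of `Γ` -/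

/-- The permutation of `{0,1}² × H` given by a shift and a family of elements of `H`. -/
def monomial {H : Type*} [Group H] (s t : Bool) (u : Bool → Bool → H) :
    Equiv.Perm ((Bool × Bool) × H) where
  toFun p := ((xor s p.1.1, xor t p.1.2), u p.1.1 p.1.2 * p.2)
  invFun p := ((xor s p.1.1, xor t p.1.2), (u (xor s p.1.1) (xor t p.1.2))⁻¹ * p.2)
  left_inv p := by simp
  right_inv p := by simp

theorem monomial_mul {H : Type*} [Group H] (s t s' t' : Bool) (u u' : Bool → Bool → H) :
    monomial s t u * monomial s' t' u' =
      monomial (xor s s') (xor t t') fun i j => u (xor s' i) (xor t' j) * u' i j := by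
  ext p : 1
  simp [monomial, mul_assoc]

/-- This imitates the left action of `Λ` on its cosets `r Γ`, with `H` in place of `Γ`. The two
relators are the only facts about `H` used, and only for `bcb`. -/
theorem lamRels_monomial {H : Type*} [Group H] (a b : H) (h1 : relOne a b = 1)
    (h2 : relTwo a b = 1) :
    LamRels (monomial true false (uOne a b)) (monomial false true (uTwo a b))
      (monomial true false fun _ _ => (1 : H)) (monomial false true fun _ _ => 1) where
  cc₁ := by
    rw [monomial_mul]
    ext p : 1
    simp [monomial]
  cc₂ := by
    rw [monomial_mul]
    ext p : 1
    simp [monomial]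
  comm := by
    rw [monomial_mul, monomial_mul]
    ext p : 1
    simp [monomial]
  bcb := by
    rw [monomial_mul, monomial_mul]
    congr 1
    funext i j
    simpa using uTwo_mul a b h1 h2 i j
  bbc := by
    rw [monomial_mul, monomial_mul]
    congr 1
    funext i j
    simpa using uTwo_eq a b i j

/-- The action of `Λ` on `Λ = ⋃ r Γ`. -/
theorem exists_actGam : ∃ f : Lam →* Equiv.Perm ((Bool × Bool) × PGam),
    f b1L = monomial true false (uOne (.of 0) (.of 1)) ∧
    f b2L = monomial false true (uTwo (.of 0) (.of 1)) ∧
    f c1L = monomial true false (fun _ _ => 1) ∧ f c2L = monomial false true fun _ _ => 1 :=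
  exists_hom_of_lamRels (lamRels_monomial _ _ relOne_of relTwo_of)

/-- An induction principle for `Λ`. -/
theorem Lam_induction {p : Lam → Prop} (hb1 : p b1L) (hb2 : p b2L) (hc1 : p c1L) (hc2 : p c2L)
    (hone : p 1) (hmul : ∀ g k, p g → p k → p (g * k)) (hinv : ∀ g, p g → p g⁻¹) (g : Lam) :
    p g := by
  have hg : g ∈ Subgroup.closure ({b1L, b2L, c1L, c2L} : Set Lam) := by
    rw [closure_Lam]; trivial
  induction hg using Subgroup.closure_induction with
  | mem g hg => rcases hg with rfl | rfl | rfl | rfl <;> assumption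
  | one => exact hone
  | mul g k _ _ hg hk => exact hmul g k hg hk
  | inv g _ hg => exact hinv g hg

/-- The first half gives the coset decomposition of `Λ`, hence an upper bound for the index of `Γ`.
The second half recovers `h` from its image in `Λ`, hence injectivity of `presGam`. -/
theorem exists_actGam_spec : ∃ f : Lam →* Equiv.Perm ((Bool × Bool) × PGam),
    (∀ g, g = rep c1L c2L (f g ((false, false), 1)).1.1 (f g ((false, false), 1)).1.2 *
      presGam (f g ((false, false), 1)).2) ∧
    ∀ h, f (presGam h) ((false, false), 1) = ((false, false), h) := by
  obtain ⟨f, hb1, hb2, hc1, hc2⟩ := exists_actGam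
  refine ⟨f, fun g => ?_, fun h => ?_⟩
  · have e1 : ∀ i j, presGam (uOne (.of 0) (.of 1) i j) = uOne (c1L * b1L⁻¹) (c2L * b2L⁻¹) i j := by
      intro i j
      cases i <;> cases j <;> simp [uOne, presGam_zero, presGam_one, a1, a2]
    have e2 : ∀ i j, presGam (uTwo (.of 0) (.of 1) i j) = uTwo (c1L * b1L⁻¹) (c2L * b2L⁻¹) i j := by
      intro i j
      cases i <;> cases j <;> simp [uTwo, presGam_zero, presGam_one, a1, a2]
    -- The map `(r, h) ↦ r h` intertwines the monomial action with left multiplication; it is then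
    -- evaluated at the orbit of the base point.
    let τ : (Bool × Bool) × PGam → Lam := fun p => rep c1L c2L p.1.1 p.1.2 * presGam p.2
    have key : ∀ g p, τ (f g p) = g * τ p := by
      intro g
      induction g using Lam_induction with
      | hb1 => 
        rintro ⟨⟨i, j⟩, h⟩
        rw [hb1]
        simp [τ, monomial, e1, ← mul_assoc, lamRels_Lam.b₁_mul_rep]
      | hb2 =>
        rintro ⟨⟨i, j⟩, h⟩
        rw [hb2]
        simp [τ, monomial, e2, ← mul_assoc, lamRels_Lam.b₂_mul_rep]
      | hc1 =>
        rintro ⟨⟨i, j⟩, h⟩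
        rw [hc1]
        simp [τ, monomial, ← mul_assoc, lamRels_Lam.c₁_mul_rep]
      | hc2 =>
        rintro ⟨⟨i, j⟩, h⟩
        rw [hc2]
        simp [τ, monomial, ← mul_assoc, lamRels_Lam.c₂_mul_rep]
      | hone => intro p; rw [map_one, one_mul]; rfl
      | hmul g k hg hk =>
        intro p
        rw [map_mul, Equiv.Perm.mul_apply, hg, hk, mul_assoc]
      | hinv g hg =>
        intro p
        rw [eq_inv_mul_iff_mul_eq, ← hg, ← Equiv.Perm.mul_apply, ← map_mul, mul_inv_cancel, map_one]
        rfl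
    have h1 := key g ((false, false), 1)
    simp only [τ, rep, Bool.false_eq_true, if_false, map_one, mul_one] at h1
    exact h1.symm
  · have key : ∀ h k, f (presGam h) ((false, false), k) = ((false, false), h * k) := by
      intro h
      have hh : h ∈ Subgroup.closure (Set.range (PresentedGroup.of (rels := relsGam))) := by
        rw [PresentedGroup.closure_range_of]; trivial
      induction hh using Subgroup.closure_induction with
      | mem h hh =>
        intro k
        obtain ⟨i, rfl⟩ := hh
        fin_cases i
        · change f (presGam (.of 0)) _ = ((false, false), PresentedGroup.of 0 * k)
          rw [presGam_zero, a1, map_mul, map_inv, hb1, hc1, Equiv.Perm.mul_apply]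
          change monomial true false (fun _ _ => 1) ((monomial true false _).symm _) = _
          simp [monomial, uOne]
        · change f (presGam (.of 1)) _ = ((false, false), PresentedGroup.of 1 * k)
          rw [presGam_one, a2, map_mul, map_inv, hb2, hc2, Equiv.Perm.mul_apply]
          change monomial false true (fun _ _ => 1) ((monomial false true _).symm _) = _
          simp [monomial, uTwo]
      | one => intro k; rw [map_one, map_one, one_mul]; rfl
      | mul h l _ _ hh hl =>
        intro k
        rw [map_mul, map_mul, Equiv.Perm.mul_apply, hl, hh, mul_assoc]
      | inv h _ hh =>
        intro k
        rw [map_inv, map_inv, Equiv.Perm.inv_eq_iff_eq, hh, mul_inv_cancel_left]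
    rw [key, mul_one]

theorem presGam_injective : Function.Injective presGam := by
  obtain ⟨f, -, hf⟩ := exists_actGam_spec
  intro h k e
  have := hf h
  rw [e, hf] at this
  exact (congrArg Prod.snd this).symm

theorem presentation_Gam : ∃ e : PresentedGroup relsGam ≃* Gam,
    e (PresentedGroup.of 0) = a1G ∧ e (PresentedGroup.of 1) = a2G :=
  ⟨(MonoidHom.ofInjective presGam_injective).trans (MulEquiv.subgroupCongr range_presGam),
    Subtype.ext presGam_zero, Subtype.ext presGam_one⟩

/-! ### The quotient `V₄` and torsion-freeness -/

theorem exists_delta : ∃ δ : Lam →* V4, δ b1L = γv ∧ δ b2L = γh ∧ δ c1L = γv ∧ δ c2L = γh := by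
  apply exists_hom_of_lamRels
  constructor <;> decide

/-- The homomorphism `Λ → V₄` that sends `𝒜` to `γ_v` and `ℬ` to `γ_h`. -/
def delta : Lam →* V4 := exists_delta.choose

theorem delta_b1 : delta b1L = γv := exists_delta.choose_spec.1

theorem delta_b2 : delta b2L = γh := exists_delta.choose_spec.2.1

theorem delta_c1 : delta c1L = γv := exists_delta.choose_spec.2.2.1

theorem delta_c2 : delta c2L = γh := exists_delta.choose_spec.2.2.2

theorem delta_setA {a : Lam} (ha : a ∈ setA) : delta a = γv := by
  rcases ha with rfl | rfl | rfl
  · exact delta_b1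
  · rw [map_inv, delta_b1]; decide
  · exact delta_c1

theorem delta_setB {b : Lam} (hb : b ∈ setB) : delta b = γh := by
  rcases hb with rfl | rfl | rfl
  · exact delta_b2
  · rw [map_inv, delta_b2]; decide
  · exact delta_c2

/-- Both generators of `Γ` are quotients of elements with equal image. Conversely, in the
decomposition `g = r h` with `h ∈ Γ` the image of `g` is that of `r`, and the four representatives
have different images. -/
theorem ker_delta : delta.ker = Gam := by
  apply le_antisymm
  · intro g hg
    obtain ⟨f, hf, -⟩ := exists_actGam_spec
    have h1 := hf g
    have hp : ∀ h, delta (presGam h) = 1 := by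
      intro h
      have : presGam h ∈ Gam := range_presGam ▸ ⟨h, rfl⟩
      have hle : Gam ≤ delta.ker := by
        refine (Subgroup.closure_le _).mpr ?_
        rintro _ (rfl | rfl)
        · change delta (c1L * b1L⁻¹) = 1
          rw [map_mul, map_inv, delta_b1, delta_c1, mul_inv_cancel]
        · change delta (c2L * b2L⁻¹) = 1
          rw [map_mul, map_inv, delta_b2, delta_c2, mul_inv_cancel]
      exact hle this
    generalize f g ((false, false), 1) = p at h1
    obtain ⟨⟨i, j⟩, h⟩ := p
    have h2 : delta g = 1 := hg
    rw [h1, map_mul, hp, mul_one] at h2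
    have h3 : i = false ∧ j = false := by
      have e1 : γv ≠ 1 := by decide
      have e2 : γh ≠ 1 := by decide
      have e3 : γv * γh ≠ 1 := by decide
      cases i <;> cases j <;> simp [rep, delta_c1, delta_c2, e1, e2, e3] at h2 ⊢
    rw [h1, h3.1, h3.2, ← range_presGam]
    simp [rep]
  · refine (Subgroup.closure_le _).mpr ?_
    rintro _ (rfl | rfl)
    · change delta (c1L * b1L⁻¹) = 1
      rw [map_mul, map_inv, delta_b1, delta_c1, mul_inv_cancel]
    · change delta (c2L * b2L⁻¹) = 1
      rw [map_mul, map_inv, delta_b2, delta_c2, mul_inv_cancel]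

theorem mem_Gam_iff {g : Lam} : g ∈ Gam ↔ delta g = 1 := by rw [← ker_delta, MonoidHom.mem_ker]

theorem delta_surjective : Function.Surjective delta := by
  have key : ∀ g : V4, g = 1 ∨ g = γv ∨ g = γh ∨ g = γv * γh := by decide
  intro g
  rcases key g with rfl | rfl | rfl | rfl
  · exact ⟨1, map_one _⟩
  · exact ⟨_, delta_b1⟩
  · exact ⟨_, delta_b2⟩
  · exact ⟨b1L * b2L, by rw [map_mul, delta_b1, delta_b2]⟩

theorem normal_Gam : ∃ _ : Gam.Normal, Nonempty (Lam ⧸ Gam ≃* V4) := by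
  rw [← ker_delta]
  exact ⟨inferInstance, ⟨QuotientGroup.quotientKerEquivOfSurjective _ delta_surjective⟩⟩

/-- All of `A` maps to `γ_v` and all of `B` to `γ_h`, so `δ` gives the parities of the word lengths,
which are the distances. -/
theorem even_dist {g : Lam} (hg : delta g = 1) :
    Even (graphInf.dist (g • baseInf) baseInf) ∧ Even (graphZero.dist (g • baseZero) baseZero) := by
  obtain ⟨l, m, hl, hm, rfl⟩ := isTreePair_Lam.exists_reduced g
  rw [isTreePair_Lam.dist_left hl hm, isTreePair_Lam.dist_right hl hm]
  have hprod : ∀ (t : V4) (n : List Lam), (∀ a ∈ n, delta a = t) → delta n.prod = t ^ n.length := by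
    intro t n hn
    induction n with
    | nil => simp
    | cons a n ih =>
      rw [List.prod_cons, map_mul, hn a (by simp), ih fun b hb => hn b (by simp [hb])]
      exact (pow_succ' t n.length).symm
  rw [map_mul, hprod γv l fun a ha => delta_setA (hl.1 a ha),
    hprod γh m fun a ha => delta_setB (hm.1 a ha)] at hg
  have hv : γv ^ 2 = 1 := by decide
  have hh : γh ^ 2 = 1 := by decide
  rw [pow_eq_pow_mod _ hv, pow_eq_pow_mod _ hh] at hg
  rw [Nat.even_iff, Nat.even_iff]
  rcases Nat.mod_two_eq_zero_or_one l.length with h1 | h1 <;>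
  rcases Nat.mod_two_eq_zero_or_one m.length with h2 | h2 <;> rw [h1, h2] at hg <;>
  first
  | exact ⟨h1, h2⟩
  | exact absurd hg (by decide)

/-- By normality all vertices, not only the base vertices, are moved by even distances. So an
element of finite order has a fixed vertex in each tree and fixes a vertex of the product, where the
action is free. -/
theorem torsionFree_Gam (g : Gam) (hg : g ≠ 1) : ¬ IsOfFinOrder g := by
  intro hfin
  obtain ⟨n, hn, hgn⟩ := isOfFinOrder_iff_pow_eq_one.mp hfin
  obtain ⟨g, hG⟩ := g
  have hgn' : g ^ n = 1 := congrArg Subtype.val hgn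
  have h := isTreePair_Lam
  have heven : ∀ l : Lam, Even (graphInf.dist (l • baseInf) (g • l • baseInf)) ∧
      Even (graphZero.dist (l • baseZero) (g • l • baseZero)) := by
    intro l
    have h1 : delta (l⁻¹ * g * l) = 1 := by
      rw [map_mul, map_mul, mem_Gam_iff.mp hG, mul_one, ← map_mul, inv_mul_cancel, map_one]
    have h2 := even_dist h1
    have d1 := dist_smul_eq h.treeL h.adjL l ((l⁻¹ * g * l) • baseInf) baseInf
    have d2 := dist_smul_eq h.treeR h.adjR l ((l⁻¹ * g * l) • baseZero) baseZero
    rw [smul_smul, mul_assoc, mul_inv_cancel_left, mul_smul, SimpleGraph.dist_comm] at d1 d2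
    rw [mul_assoc] at h2
    rw [d1, d2]
    exact h2
  obtain ⟨v, hv⟩ := exists_fixed_vertex h.treeL h.adjL g n hn hgn' fun v => by
    obtain ⟨l, rfl, -⟩ := h.exists_smul_eq v baseZero
    exact (heven l).1
  obtain ⟨w, hw⟩ := exists_fixed_vertex h.treeR h.adjR g n hn hgn' fun w => by
    obtain ⟨l, -, rfl⟩ := h.exists_smul_eq baseInf w
    exact (heven l).2
  obtain ⟨l, rfl, rfl⟩ := h.exists_smul_eq v w
  have h1 : l⁻¹ * (g * l) = 1 := by
    apply h.eq_one_of_smul_eq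
    · rw [mul_smul, mul_smul, hv, inv_smul_smul]
    · rw [mul_smul, mul_smul, hw, inv_smul_smul]
  rw [inv_mul_eq_one, eq_comm, mul_eq_right] at h1
  exact hg (Subtype.ext h1)

/-! ### `Λ` as a lattice -/

open Topology

theorem fracIdeal_zero_eq : fracIdeal 0 = {a : L | Valued.v a ≤
    (1 : WithZero (Multiplicative ℤ))} := by
  ext a
  rw [mem_fracIdeal_zero, Set.mem_ofPred_eq, LaurentSeries.val_le_one_iff_eq_coe]
  exact exists_congr fun p => eq_comm

theorem isOpen_fracIdeal_zero : IsOpen (fracIdeal 0) := by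
  rw [fracIdeal_zero_eq]
  exact Valued.isOpen_valuationSubring L

/-- Exhibits `𝔽₂[[x]]` as a continuous image of the compact product of copies of `𝔽₂`. -/
theorem continuous_incl_mk : Continuous fun f : ℕ → F2 => incl (PowerSeries.mk f) := by
  rw [continuous_iff_continuousAt]
  intro f s hs
  obtain ⟨γ, hγ⟩ := Valued.mem_nhds.mp hs
  obtain ⟨N, hN⟩ : ∃ N : ℕ, ∀ g : ℕ → F2, (∀ n < N, g n = f n) → incl (PowerSeries.mk g) ∈ s := by
    have hne : MonoidWithZeroHom.ValueGroup₀.embedding γ.1 ≠ (0 : WithZero (Multiplicative ℤ)) := by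
      simp
    -- The shift by `1` turns the bound `≤` that comes from vanishing coefficients into the strict
    -- inequality of the neighbourhood.
    refine ⟨(1 - WithZero.log (MonoidWithZeroHom.ValueGroup₀.embedding γ.1)).toNat,
      fun g hg => hγ ?_⟩
    rw [Set.mem_ofPred_eq, Valuation.restrict_lt_iff_lt_embedding, ← WithZero.exp_log hne]
    refine lt_of_le_of_lt (b := WithZero.exp (-(1 - WithZero.log
      (MonoidWithZeroHom.ValueGroup₀.embedding γ.1)))) ?_ ?_
    · rw [LaurentSeries.valuation_le_iff_coeff_lt_eq_zero]
      intro n hn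
      rw [← map_sub]
      change HahnSeries.coeff (HahnSeries.ofPowerSeries ℤ F2 _) n = 0
      rw [PowerSeries.coeff_coe]
      split_ifs with h0
      · rfl
      · rw [map_sub, PowerSeries.coeff_mk, PowerSeries.coeff_mk, hg _ (by omega), sub_self]
    · rw [WithZero.exp_lt_exp]
      omega
  have h1 : ∀ᶠ g in 𝓝 f, ∀ n ∈ Set.Iio N, g n = f n :=
    (Filter.eventually_all_finite (Set.finite_Iio N)).mpr fun n _ =>
      (continuous_apply n).continuousAt.eventually ((isOpen_discrete {f n}).mem_nhds rfl)
  exact Filter.mem_map.mpr (h1.mono fun g hg => hN g hg)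

theorem isCompact_fracIdeal_zero : IsCompact (fracIdeal 0) := by
  have h : fracIdeal 0 = Set.range fun f : ℕ → F2 => incl (PowerSeries.mk f) := by
    ext a
    rw [mem_fracIdeal_zero]
    constructor
    · rintro ⟨p, rfl⟩
      exact ⟨fun n => PowerSeries.coeff n p, congrArg incl (by ext n; simp)⟩
    · rintro ⟨f, rfl⟩
      exact ⟨_, rfl⟩
  rw [h]
  exact isCompact_range continuous_incl_mk

/-- The group `GL₂(𝔽₂[[x]])`. -/
def integralGL : Set (GL (Fin 2) L) := {g | IsIntegral g ∧ IsIntegral g⁻¹}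

theorem isOpen_isIntegral : IsOpen {m : Matrix (Fin 2) (Fin 2) L | ∀ i j, m i j ∈ fracIdeal 0} := by
  simp only [Set.ofPred_forall]
  exact isOpen_iInter_of_finite fun i => isOpen_iInter_of_finite fun j =>
    isOpen_fracIdeal_zero.preimage (continuous_id.matrix_elem i j)

theorem isCompact_isIntegral :
    IsCompact {m : Matrix (Fin 2) (Fin 2) L | ∀ i j, m i j ∈ fracIdeal 0} := by
  have h := isCompact_univ_pi (s := fun _ : Fin 2 => Set.univ.pi fun _ : Fin 2 => fracIdeal 0)
    fun _ => isCompact_univ_pi fun _ => isCompact_fracIdeal_zero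
  have e : {m : Matrix (Fin 2) (Fin 2) L | ∀ i j, m i j ∈ fracIdeal 0}
      = (Set.univ.pi fun _ : Fin 2 => Set.univ.pi fun _ : Fin 2 => fracIdeal 0 :
        Set (Fin 2 → Fin 2 → L)) := by
    exact Set.ext fun m => ⟨fun hm i _ j _ => hm i j, fun hm i j => hm i trivial j trivial⟩
  exact e ▸ h

theorem isOpen_integralGL : IsOpen integralGL :=
  (isOpen_isIntegral.preimage Units.continuous_val).inter
    (isOpen_isIntegral.preimage Units.continuous_coe_inv)

/-- The unit group is closed in the product of the matrix ring with its opposite; there the set is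
cut out by integrality of the matrix and of its inverse. -/
theorem isCompact_integralGL : IsCompact integralGL := by
  have h := isCompact_isIntegral.prod
    (isCompact_isIntegral.image MulOpposite.continuous_op)
  have e : integralGL = Units.embedProduct _ ⁻¹'
      ({m : Matrix (Fin 2) (Fin 2) L | ∀ i j, m i j ∈ fracIdeal 0} ×ˢ
        (MulOpposite.op '' {m : Matrix (Fin 2) (Fin 2) L | ∀ i j, m i j ∈ fracIdeal 0})) := by
    ext g
    simp only [integralGL, IsIntegral, Set.mem_ofPred_eq, Set.mem_preimage,
      Units.embedProduct_apply,
      Set.mem_prod, Set.mem_image, MulOpposite.op_inj, exists_eq_right]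
  rw [e]
  exact Units.isClosedEmbedding_embedProduct.isCompact_preimage h

/-- The stabiliser of the standard vertex contains the open group `GL₂(𝔽₂[[x]])`, and the set is a
coset of it. Openness in `PGL₂` is openness of the preimage in `GL₂`. -/
theorem isOpen_smul_stdV_eq (v : BTVertex) : IsOpen {p : PGL(2, L) | p • stdV = v} := by
  have h : IsOpen {g : GL (Fin 2) L | g • stdV = v} := by
    obtain ⟨k, rfl⟩ := exists_smul_stdV v
    have e : {g : GL (Fin 2) L | g • stdV = k • stdV}
        = (fun g => k⁻¹ * g) ⁻¹' (MulAction.stabilizer (GL (Fin 2) L) stdV : Set _) := by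
      ext g
      change _ ↔ (k⁻¹ * g) • stdV = stdV
      rw [mul_smul, inv_smul_eq_iff]
      rfl
    rw [e]
    refine IsOpen.preimage (continuous_const.mul continuous_id) ?_
    refine Subgroup.isOpen_of_mem_nhds _ (g := 1) (Filter.mem_of_superset
      (isOpen_integralGL.mem_nhds ⟨isIntegral_one, by rw [inv_one]; exact isIntegral_one⟩) ?_)
    exact fun g hg => smul_stdV_of_isIntegral hg.1 hg.2
  exact h

theorem diag_injective : Function.Injective diag := by
  rw [injective_iff_map_eq_one]
  intro g hg
  have h1 : pgl0 g = 1 := congrArg Prod.fst hg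
  have h2 : pglInf g = 1 := congrArg Prod.snd hg
  apply isTreePair_Lam.eq_one_of_smul_eq
  · change pglInf g • stdV = stdV
    rw [h2, one_smul]
  · change pgl0 g • stdV = stdV
    rw [h1, one_smul]

/-- The open set of pairs that move the base vertex to the same place as `g` contains no other
element of `Λ`. -/
theorem discreteTopology_diag : DiscreteTopology diag.range := by
  rw [discreteTopology_iff_isOpen_singleton]
  rintro ⟨_, g, rfl⟩
  refine isOpen_induced_iff.mpr ⟨{p | p.1 • stdV = pgl0 g • stdV} ∩
    {p | p.2 • stdV = pglInf g • stdV},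
    ((isOpen_smul_stdV_eq _).preimage continuous_fst).inter
      ((isOpen_smul_stdV_eq _).preimage continuous_snd), ?_⟩
  ext ⟨_, k, rfl⟩
  constructor
  · rintro ⟨h1, h2⟩
    obtain ⟨l, -, hl⟩ := btAct_existsUnique (stdV, stdV) (btAct g (stdV, stdV))
    have hk : k = g := (hl k (Prod.ext h1 h2)).trans (hl g rfl).symm
    subst hk
    rfl
  · intro h
    have e : k = g := diag_injective (congrArg Subtype.val h)
    subst e
    exact ⟨rfl, rfl⟩

theorem exists_integralGL {p : PGL(2, L)} (h : p • stdV = stdV) :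
    ∃ g ∈ integralGL, Matrix.ProjGenLinGroup.mk g = p := by
  obtain ⟨g, rfl⟩ := Matrix.ProjGenLinGroup.mk_surjective p
  have h' : g • stdV = (1 : GL (Fin 2) L) • stdV := by rw [one_smul]; exact h
  obtain ⟨c, h1, h2⟩ := smul_stdV_eq_smul_stdV.mp h'
  rw [inv_one, one_mul] at h1
  rw [mul_one] at h2
  refine ⟨sc c * g, ⟨h1, ?_⟩, ?_⟩
  · rwa [mul_inv_rev, ← map_inv, scalar_mul_comm]
  · rw [map_mul, Matrix.ProjGenLinGroup.mk_scalar, one_mul]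

/-- Since `Λ` is transitive on vertices, the compact stabiliser of the base vertex meets every
coset. -/
theorem compactSpace_quotient : CompactSpace ((PGL(2, L) × PGL(2, L)) ⧸ diag.range) := by
  have hmk : Continuous (Matrix.ProjGenLinGroup.mk : GL (Fin 2) L → PGL(2, L)) :=
    continuous_quot_mk
  have hf : Continuous fun m : GL (Fin 2) L × GL (Fin 2) L =>
      (QuotientGroup.mk (Matrix.ProjGenLinGroup.mk m.1, Matrix.ProjGenLinGroup.mk m.2) :
        (PGL(2, L) × PGL(2, L)) ⧸ diag.range) :=
    continuous_quot_mk.comp ((hmk.comp continuous_fst).prodMk (hmk.comp continuous_snd))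
  refine ⟨?_⟩
  rw [← Set.eq_univ_of_univ_subset (s := (fun m : GL (Fin 2) L × GL (Fin 2) L =>
      (QuotientGroup.mk (Matrix.ProjGenLinGroup.mk m.1, Matrix.ProjGenLinGroup.mk m.2) :
        (PGL(2, L) × PGL(2, L)) ⧸ diag.range)) '' (integralGL ×ˢ integralGL))]
  · exact (isCompact_integralGL.prod isCompact_integralGL).image hf
  rintro c -
  induction c using QuotientGroup.induction_on with
  | H p =>
    obtain ⟨p, q⟩ := p
    -- Choose `l` with `l` and `(p, q)⁻¹` moving the base vertex to the same vertex; then `(p, q) l`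
    -- fixes it.
    obtain ⟨l, hl, -⟩ := btAct_existsUnique (stdV, stdV) (p⁻¹ • stdV, q⁻¹ • stdV)
    have h1 : pgl0 l • stdV = p⁻¹ • stdV := congrArg Prod.fst hl
    have h2 : pglInf l • stdV = q⁻¹ • stdV := congrArg Prod.snd hl
    obtain ⟨g, hg, eg⟩ := exists_integralGL (p := p * pgl0 l) (by rw [mul_smul, h1, smul_inv_smul])
    obtain ⟨k, hk, ek⟩ := exists_integralGL (p := q * pglInf l)
      (by rw [mul_smul, h2, smul_inv_smul])
    refine ⟨(g, k), ⟨hg, hk⟩, ?_⟩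
    change QuotientGroup.mk (Matrix.ProjGenLinGroup.mk g, Matrix.ProjGenLinGroup.mk k) = _
    rw [eg, ek, eq_comm, QuotientGroup.eq]
    refine ⟨l, ?_⟩
    exact Prod.ext (inv_mul_cancel_left p (pgl0 l)).symm (inv_mul_cancel_left q (pglInf l)).symm

/-! ### Paths in a square complex -/

section Paths

variable {X Y : Type} [TopologicalSpace X] [TopologicalSpace Y]

instance : ContractibleSpace I :=
  (convex_Icc (0 : ℝ) 1).contractibleSpace ⟨0, by simp⟩

/-- Paths that factor through a simply connected space compose as their end points tell. -/
theorem mk_trans_mk_of_factor [SimplyConnectedSpace Y] (f : C(Y, X)) (p' q' r' : C(I, Y))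
    (hpq : p' 1 = q' 0) (hr0 : r' 0 = p' 0) (hr1 : r' 1 = q' 1) {x y z : X} (p : Path x y)
    (q : Path y z) (r : Path x z) (hp : ∀ t, p t = f (p' t)) (hq : ∀ t, q t = f (q' t))
    (hr : ∀ t, r t = f (r' t)) :
    (Path.Homotopic.Quotient.mk p).trans (.mk q) = .mk r := by
  obtain rfl : x = f (p' 0) := by rw [← hp, p.source]
  obtain rfl : y = f (p' 1) := by rw [← hp, p.target]
  obtain rfl : z = f (q' 1) := by rw [← hq, q.target]
  let P : Path (p' 0) (p' 1) := ⟨p', rfl, rfl⟩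
  let Q : Path (p' 1) (q' 1) := ⟨q', hpq.symm, rfl⟩
  let R : Path (p' 0) (q' 1) := ⟨r', hr0, hr1⟩
  obtain rfl : p = P.map f.continuous := Path.ext (funext hp)
  obtain rfl : q = Q.map f.continuous := Path.ext (funext hq)
  obtain rfl : r = R.map f.continuous := Path.ext (funext hr)
  rw [← Path.Homotopic.Quotient.mk_trans, ← Path.map_trans, Path.Homotopic.Quotient.mk_map,
    Path.Homotopic.Quotient.mk_map]
  exact congrArg (Path.Homotopic.Quotient.map · f) (Subsingleton.elim _ _)

theorem subpath_trans_subpath {x y : X} (γ : Path x y) (a b c : I) :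
    (Path.Homotopic.Quotient.mk (γ.subpath a b)).trans (.mk (γ.subpath b c))
      = .mk (γ.subpath a c) := by
  rw [← Path.Homotopic.Quotient.mk_trans]
  exact Path.Homotopic.Quotient.eq.mpr ⟨Path.Homotopy.subpathTransSubpath γ a b c⟩

end Paths

/-! ### Open stars of the vertices and their contractions -/

/-- The parameter `t`, counted from the end `b` of the unit interval. -/
def fromEnd (b : Bool) (t : I) : I := if b then σ t else t

/-- The end `b` of the unit interval. -/
def endPt (b : Bool) : I := if b then 1 else 0

/-- The deformation of the unit interval to the end `0` of the part `t ≤ 2 / 3`. -/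
def shrink (τ t : I) : I :=
  ⟨max 0 (t - 2 * τ * (1 - t)), le_max_left _ _, max_le zero_le_one (by
    have h1 := t.2.2
    have h2 := mul_nonneg τ.2.1 (sub_nonneg.mpr h1)
    linarith)⟩

/-- The deformation of the unit interval to its end `b`. -/
def pull (b : Bool) (τ t : I) : I := fromEnd b (shrink τ (fromEnd b t))

theorem continuous_shrink : Continuous fun p : I × I => shrink p.1 p.2 := by
  unfold shrink
  fun_prop

theorem continuous_fromEnd (b : Bool) : Continuous (fromEnd b) := by
  cases b
  · exact continuous_id
  · exact unitInterval.continuous_symm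

theorem continuous_pull (b : Bool) : Continuous fun p : I × I => pull b p.1 p.2 :=
  (continuous_fromEnd b).comp (continuous_shrink.comp
    (continuous_fst.prodMk ((continuous_fromEnd b).comp continuous_snd)))

theorem shrink_zero_left (t : I) : shrink 0 t = t := by
  ext
  simp [shrink, t.2.1]

/-- At time `1` the deformation is `max 0 (3 t - 2)`. Any bound strictly between `1/2` and `1` would
serve instead of `2/3`: the parts belonging to the two ends must overlap. -/
theorem shrink_one_left {t : I} (ht : (t : ℝ) < 2 / 3) : shrink 1 t = 0 := by
  ext
  simp only [shrink, Set.Icc.coe_one, Set.Icc.coe_zero, max_eq_left_iff]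
  linarith

theorem shrink_zero (τ : I) : shrink τ 0 = 0 := by
  ext
  simp [shrink, τ.2.1]

theorem shrink_one (τ : I) : shrink τ 1 = 1 := by
  ext
  simp [shrink]

theorem fromEnd_fromEnd (b : Bool) (t : I) : fromEnd b (fromEnd b t) = t := by
  cases b <;> simp [fromEnd]

theorem fromEnd_symm (b : Bool) (t : I) : fromEnd b (σ t) = fromEnd (!b) t := by
  cases b <;> simp [fromEnd]

theorem symm_fromEnd (b : Bool) (t : I) : σ (fromEnd b t) = fromEnd (!b) t := by
  cases b <;> simp [fromEnd]

theorem pull_zero_left (b : Bool) (t : I) : pull b 0 t = t := by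
  rw [pull, shrink_zero_left, fromEnd_fromEnd]

theorem pull_one_left {b : Bool} {t : I} (ht : (fromEnd b t : ℝ) < 2 / 3) :
    pull b 1 t = endPt b := by
  rw [pull, shrink_one_left ht]
  cases b <;> simp [fromEnd, endPt]

theorem pull_zero (b : Bool) (τ : I) : pull b τ 0 = 0 := by
  cases b <;> simp [pull, fromEnd, shrink_zero, shrink_one]

theorem pull_one (b : Bool) (τ : I) : pull b τ 1 = 1 := by
  cases b <;> simp [pull, fromEnd, shrink_zero, shrink_one]

theorem pull_symm (b : Bool) (τ t : I) : pull b τ (σ t) = σ (pull (!b) τ t) := by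
  rw [pull, pull, fromEnd_symm, symm_fromEnd, Bool.not_not]

theorem fromEnd_zero_lt {b : Bool} : (fromEnd b 0 : ℝ) < 2 / 3 ↔ b = false := by
  cases b <;> norm_num [fromEnd]

theorem fromEnd_one_lt {b : Bool} : (fromEnd b 1 : ℝ) < 2 / 3 ↔ b = true := by
  cases b <;> norm_num [fromEnd]

theorem exists_fromEnd_lt (t : I) : ∃ b, (fromEnd b t : ℝ) < 2 / 3 := by
  rcases lt_or_ge (t : ℝ) (2 / 3) with h | h
  · exact ⟨false, h⟩
  · refine ⟨true, ?_⟩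
    simp only [fromEnd, if_true, unitInterval.coe_symm_eq]
    linarith

namespace v4Complex

open SquareComplex

variable {Λ : Type} [Group Λ] {A B : Set Λ} (h : IsV4Structure A B)

/-- The vertex `s_{ij}` as a point. -/
def pt (v : Bool × Bool) : (v4Complex h).Realization :=
  (v4Complex h).proj (vtx (X := v4Complex h) v)

/-- The label of the side of a square from `s_{i0}` to `s_{i1}`. -/
def sideV (s : V4Square A B) (i : Bool) : A := if i then s.right else s.left

/-- The label of the side of a square from `s_{0j}` to `s_{1j}`. -/
def sideH (s : V4Square A B) (j : Bool) : B := if j then s.top else s.bottom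

/-- A point on an edge. -/
def onEdge (e : V4Edge A B) (t : I) : (v4Complex h).Realization :=
  (v4Complex h).proj (edg (X := v4Complex h) e t)

/-- A point in a square. -/
def onSquare (s : V4Square A B) (p : I × I) : (v4Complex h).Realization :=
  (v4Complex h).proj (sqr (X := v4Complex h) s p)

theorem continuous_onEdge (e : V4Edge A B) : Continuous (onEdge h e) :=
  (v4Complex h).continuous_proj.comp
    (continuous_inr.comp (continuous_inl.comp continuous_sigmaMk))

theorem continuous_onSquare (s : V4Square A B) : Continuous (onSquare h s) :=
  (v4Complex h).continuous_proj.comp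
    (continuous_inr.comp (continuous_inr.comp continuous_sigmaMk))

theorem onEdge_v (a : A) (i r : Bool) (t : I) :
    onEdge h (.v a i r) t = onEdge h (.v a i false) (fromEnd r t) := by
  cases r
  · rfl
  · exact proj_rev (X := v4Complex h) (.v a i false) t

theorem onEdge_h (b : B) (j r : Bool) (t : I) :
    onEdge h (.h b j r) t = onEdge h (.h b j false) (fromEnd r t) := by
  cases r
  · rfl
  · exact proj_rev (X := v4Complex h) (.h b j false) t

theorem onEdge_v_zero (a : A) (i r : Bool) : onEdge h (.v a i r) 0 = pt h (i, r) :=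
  proj_src (X := v4Complex h) (.v a i r)

theorem onEdge_h_zero (b : B) (j r : Bool) : onEdge h (.h b j r) 0 = pt h (r, j) :=
  proj_src (X := v4Complex h) (.h b j r)

theorem onEdge_v_endPt (a : A) (i j : Bool) : onEdge h (.v a i false) (endPt j) = pt h (i, j) := by
  rw [← onEdge_v_zero h a i j, onEdge_v h a i j]
  cases j <;> simp [endPt, fromEnd]

theorem onEdge_h_endPt (b : B) (j i : Bool) : onEdge h (.h b j false) (endPt i) = pt h (i, j) := by
  rw [← onEdge_h_zero h b j i, onEdge_h h b j i]
  cases i <;> simp [endPt, fromEnd]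

theorem onSquare_sideV (s : V4Square A B) (i : Bool) (t : I) :
    onSquare h s (t, endPt i) = onEdge h (.v (sideV s i) i false) t := by
  cases i
  · exact proj_bd0 (X := v4Complex h) s t
  · have := proj_bd2 (X := v4Complex h) s (σ t)
    rw [unitInterval.symm_symm] at this
    refine this.trans ((onEdge_v h s.right true true (σ t)).trans ?_)
    rw [fromEnd, if_pos rfl, unitInterval.symm_symm]
    rfl

theorem onSquare_sideH (s : V4Square A B) (j : Bool) (t : I) :
    onSquare h s (endPt j, t) = onEdge h (.h (sideH s j) j false) t := by
  cases j
  · have := proj_bd3 (X := v4Complex h) s (σ t)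
    rw [unitInterval.symm_symm] at this
    refine this.trans ((onEdge_h h s.bottom false true (σ t)).trans ?_)
    rw [fromEnd, if_pos rfl, unitInterval.symm_symm]
    rfl
  · exact proj_bd1 (X := v4Complex h) s t

theorem onSquare_endPt (s : V4Square A B) (i j : Bool) :
    onSquare h s (endPt j, endPt i) = pt h (i, j) := by
  rw [onSquare_sideV, onEdge_v_endPt]

/-- Being in the open star of a vertex, for the points of the cells. -/
def inStar (v : Bool × Bool) : (v4Complex h).Cells → Prop
  | .inl ⟨u, _⟩ => u = v
  | .inr (.inl ⟨.v _ i r, t⟩) => i = v.1 ∧ (fromEnd (xor r v.2) t : ℝ) < 2 / 3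
  | .inr (.inl ⟨.h _ j r, t⟩) => j = v.2 ∧ (fromEnd (xor r v.1) t : ℝ) < 2 / 3
  | .inr (.inr ⟨_, p⟩) => (fromEnd v.2 p.1 : ℝ) < 2 / 3 ∧ (fromEnd v.1 p.2 : ℝ) < 2 / 3

/-- An edge joins two different vertices, so a vertex tells which end of the edge is meant, and the
distance to that end does not depend on the cell in which it is measured. -/
theorem inStar_iff_of_glue (v : Bool × Bool) {p q : (v4Complex h).Cells}
    (hpq : (v4Complex h).Glue p q) : inStar h v p ↔ inStar h v q := by
  obtain ⟨i, j⟩ := v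
  cases hpq with
  | src e =>
    rcases e with ⟨a, i', r⟩ | ⟨b, j', r⟩
    · change i' = i ∧ (fromEnd (xor r j) 0 : ℝ) < 2 / 3 ↔ (i', r) = (i, j)
      rw [fromEnd_zero_lt, Prod.mk.injEq, bne_eq_false_iff_eq]
    · change j' = j ∧ (fromEnd (xor r i) 0 : ℝ) < 2 / 3 ↔ (r, j') = (i, j)
      rw [fromEnd_zero_lt, Prod.mk.injEq, bne_eq_false_iff_eq, and_comm]
  | rev e t =>
    rcases e with ⟨a, i', r⟩ | ⟨b, j', r⟩
    · change i' = i ∧ (fromEnd (xor (!r) j) t : ℝ) < 2 / 3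
        ↔ i' = i ∧ (fromEnd (xor r j) (σ t) : ℝ) < 2 / 3
      rw [fromEnd_symm, Bool.not_xor]
    · change j' = j ∧ (fromEnd (xor (!r) i) t : ℝ) < 2 / 3
        ↔ j' = j ∧ (fromEnd (xor r i) (σ t) : ℝ) < 2 / 3
      rw [fromEnd_symm, Bool.not_xor]
  | bd0 s t =>
    change (fromEnd j t : ℝ) < 2 / 3 ∧ (fromEnd i 0 : ℝ) < 2 / 3
      ↔ false = i ∧ (fromEnd (xor false j) t : ℝ) < 2 / 3
    rw [fromEnd_zero_lt, Bool.false_xor, and_comm, eq_comm]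
  | bd1 s t =>
    change (fromEnd j 1 : ℝ) < 2 / 3 ∧ (fromEnd i t : ℝ) < 2 / 3
      ↔ true = j ∧ (fromEnd (xor false i) t : ℝ) < 2 / 3
    rw [fromEnd_one_lt, Bool.false_xor, eq_comm]
  | bd2 s t =>
    change (fromEnd j (σ t) : ℝ) < 2 / 3 ∧ (fromEnd i 1 : ℝ) < 2 / 3
      ↔ true = i ∧ (fromEnd (xor true j) t : ℝ) < 2 / 3
    rw [fromEnd_one_lt, fromEnd_symm, Bool.true_xor, and_comm, eq_comm]
  | bd3 s t =>
    change (fromEnd j 0 : ℝ) < 2 / 3 ∧ (fromEnd i (σ t) : ℝ) < 2 / 3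
      ↔ false = j ∧ (fromEnd (xor true i) t : ℝ) < 2 / 3
    rw [fromEnd_zero_lt, fromEnd_symm, Bool.true_xor, eq_comm]

/-- The open star of a vertex. -/
def openStar (v : Bool × Bool) : Set (v4Complex h).Realization :=
  {x | Quot.lift (inStar h v) (fun _ _ hpq => propext (inStar_iff_of_glue h v hpq)) x}

theorem isOpen_inStar (v : Bool × Bool) : IsOpen {p | inStar h v p} := by
  have key (b : Bool) : IsOpen {t : I | (fromEnd b t : ℝ) < 2 / 3} :=
    isOpen_lt (continuous_subtype_val.comp (continuous_fromEnd b)) continuous_const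
  refine isOpen_sum_iff.mpr ⟨isOpen_sigma_iff.mpr fun u => isOpen_discrete _,
    isOpen_sum_iff.mpr ⟨isOpen_sigma_iff.mpr fun e => ?_, isOpen_sigma_iff.mpr fun s => ?_⟩⟩
  · rcases e with ⟨a, i, r⟩ | ⟨b, j, r⟩
    · exact isOpen_const.inter (key _)
    · exact isOpen_const.inter (key _)
  · exact ((key _).preimage continuous_fst).inter ((key _).preimage continuous_snd)

theorem isOpen_openStar (v : Bool × Bool) : IsOpen (openStar h v) := isOpen_inStar h v

theorem exists_mem_openStar (x : (v4Complex h).Realization) : ∃ v, x ∈ openStar h v := by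
  induction x using Quot.ind with
  | mk p =>
    rcases p with ⟨u, ⟨⟩⟩ | ⟨⟨a, i, r⟩ | ⟨b, j, r⟩, t⟩ | ⟨s, p, q⟩
    · exact ⟨u, rfl⟩
    · obtain ⟨b, hb⟩ := exists_fromEnd_lt t
      refine ⟨(i, xor r b), rfl, ?_⟩
      simpa using hb
    · obtain ⟨b, hb⟩ := exists_fromEnd_lt t
      refine ⟨(xor r b, j), rfl, ?_⟩
      simpa using hb
    · obtain ⟨b, hb⟩ := exists_fromEnd_lt p
      obtain ⟨c, hc⟩ := exists_fromEnd_lt q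
      exact ⟨(c, b), hb, hc⟩

/-- The deformation of the cells to the vertex `v`. -/
def pullCell (v : Bool × Bool) (τ : I) : (v4Complex h).Cells → (v4Complex h).Cells
  | .inl u => .inl u
  | .inr (.inl ⟨.v a i r, t⟩) => .inr (.inl ⟨.v a i r, pull (xor r v.2) τ t⟩)
  | .inr (.inl ⟨.h b j r, t⟩) => .inr (.inl ⟨.h b j r, pull (xor r v.1) τ t⟩)
  | .inr (.inr ⟨s, p⟩) => .inr (.inr ⟨s, pull v.2 τ p.1, pull v.1 τ p.2⟩)

/-- The deformation fixes the ends of every edge, acts on squares coordinate by coordinate and is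
compatible with reversal, so it preserves the gluing. -/
theorem proj_pullCell (v : Bool × Bool) (τ : I) {p q : (v4Complex h).Cells}
    (hpq : (v4Complex h).Glue p q) :
    (v4Complex h).proj (pullCell h v τ p) = (v4Complex h).proj (pullCell h v τ q) := by
  obtain ⟨i, j⟩ := v
  cases hpq with
  | src e =>
    rcases e with ⟨a, i', r⟩ | ⟨b, j', r⟩
    · change onEdge h (.v a i' r) (pull (xor r j) τ 0) = pt h (i', r)
      rw [pull_zero, onEdge_v_zero]
    · change onEdge h (.h b j' r) (pull (xor r i) τ 0) = pt h (r, j')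
      rw [pull_zero, onEdge_h_zero]
  | rev e t =>
    rcases e with ⟨a, i', r⟩ | ⟨b, j', r⟩
    · refine (proj_rev (X := v4Complex h) (.v a i' r) (pull (xor (!r) j) τ t)).trans ?_
      change onEdge h (.v a i' r) _ = onEdge h (.v a i' r) (pull (xor r j) τ (σ t))
      rw [pull_symm, Bool.not_xor]
    · refine (proj_rev (X := v4Complex h) (.h b j' r) (pull (xor (!r) i) τ t)).trans ?_
      change onEdge h (.h b j' r) _ = onEdge h (.h b j' r) (pull (xor r i) τ (σ t))
      rw [pull_symm, Bool.not_xor]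
  | bd0 s t =>
    refine Eq.trans ?_ (proj_bd0 (X := v4Complex h) s (pull (xor false j) τ t))
    change onSquare h s (pull j τ t, pull i τ 0) = onSquare h s _
    rw [pull_zero, Bool.false_xor]
  | bd1 s t =>
    refine Eq.trans ?_ (proj_bd1 (X := v4Complex h) s (pull (xor false i) τ t))
    change onSquare h s (pull j τ 1, pull i τ t) = onSquare h s _
    rw [pull_one, Bool.false_xor]
  | bd2 s t =>
    refine Eq.trans ?_ (proj_bd2 (X := v4Complex h) s (pull (xor true j) τ t))
    change onSquare h s (pull j τ (σ t), pull i τ 1) = onSquare h s _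
    rw [pull_one, pull_symm, Bool.true_xor]
  | bd3 s t =>
    refine Eq.trans ?_ (proj_bd3 (X := v4Complex h) s (pull (xor true i) τ t))
    change onSquare h s (pull j τ 0, pull i τ (σ t)) = onSquare h s _
    rw [pull_zero, pull_symm, Bool.true_xor]

/-- The deformation of the square complex that contracts the open star of `v` to `v`. -/
def contraction (v : Bool × Bool) : (v4Complex h).Realization → C(I, (v4Complex h).Realization) :=
  Quot.lift (fun p => ⟨fun τ => (v4Complex h).proj (pullCell h v τ p), by
      rcases p with ⟨u, ⟨⟩⟩ | ⟨⟨a, i, r⟩ | ⟨b, j, r⟩, t⟩ | ⟨s, p, q⟩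
      · exact (continuous_const : Continuous fun _ : I => pt h u)
      · exact (continuous_onEdge h _).comp
          ((continuous_pull _).comp (continuous_id.prodMk continuous_const))
      · exact (continuous_onEdge h _).comp
          ((continuous_pull _).comp (continuous_id.prodMk continuous_const))
      · exact (continuous_onSquare h _).comp
          (((continuous_pull _).comp (continuous_id.prodMk continuous_const)).prodMk
            ((continuous_pull _).comp (continuous_id.prodMk continuous_const)))⟩)
    fun _ _ hpq => ContinuousMap.ext fun τ => proj_pullCell h v τ hpq

/-- The values lie in the space of paths so that continuity can be tested on the cells; the product
of the quotient map with the interval need not be considered. -/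
theorem continuous_contraction (v : Bool × Bool) : Continuous (contraction h v) := by
  refine continuous_quot_lift _ (continuous_sum_dom.mpr ⟨?_, continuous_sum_dom.mpr ⟨?_, ?_⟩⟩)
  · exact continuous_sigma fun u => continuous_of_const fun _ _ => rfl
  · refine continuous_sigma fun e => ContinuousMap.continuous_of_continuous_uncurry _ ?_
    rcases e with ⟨a, i, r⟩ | ⟨b, j, r⟩
    · exact (continuous_onEdge h (.v a i r)).comp
        ((continuous_pull (xor r v.2)).comp (continuous_snd.prodMk continuous_fst))
    · exact (continuous_onEdge h (.h b j r)).comp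
        ((continuous_pull (xor r v.1)).comp (continuous_snd.prodMk continuous_fst))
  · refine continuous_sigma fun s => ContinuousMap.continuous_of_continuous_uncurry _ ?_
    exact (continuous_onSquare h s).comp
      (((continuous_pull v.2).comp
          (continuous_snd.prodMk (continuous_fst.comp continuous_fst))).prodMk
        ((continuous_pull v.1).comp
          (continuous_snd.prodMk (continuous_snd.comp continuous_fst))))

theorem contraction_onEdge_v (v : Bool × Bool) (a : A) (i : Bool) (t τ : I) :
    contraction h v (onEdge h (.v a i false) t) τ = onEdge h (.v a i false) (pull v.2 τ t) := by
  change onEdge h (.v a i false) (pull (xor false v.2) τ t) = _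
  rw [Bool.false_xor]

theorem contraction_onEdge_h (v : Bool × Bool) (b : B) (j : Bool) (t τ : I) :
    contraction h v (onEdge h (.h b j false) t) τ = onEdge h (.h b j false) (pull v.1 τ t) := by
  change onEdge h (.h b j false) (pull (xor false v.1) τ t) = _
  rw [Bool.false_xor]

theorem contraction_onSquare (v : Bool × Bool) (s : V4Square A B) (p : I × I) (τ : I) :
    contraction h v (onSquare h s p) τ = onSquare h s (pull v.2 τ p.1, pull v.1 τ p.2) := rfl

theorem onEdge_v_mem_openStar {v : Bool × Bool} {a : A} {i : Bool} {t : I} :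
    onEdge h (.v a i false) t ∈ openStar h v ↔ i = v.1 ∧ (fromEnd v.2 t : ℝ) < 2 / 3 := by
  change i = v.1 ∧ (fromEnd (xor false v.2) t : ℝ) < 2 / 3 ↔ _
  rw [Bool.false_xor]

theorem onEdge_h_mem_openStar {v : Bool × Bool} {b : B} {j : Bool} {t : I} :
    onEdge h (.h b j false) t ∈ openStar h v ↔ j = v.2 ∧ (fromEnd v.1 t : ℝ) < 2 / 3 := by
  change j = v.2 ∧ (fromEnd (xor false v.1) t : ℝ) < 2 / 3 ↔ _
  rw [Bool.false_xor]

/-- Case distinction for the points of the square complex. -/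
theorem point_cases {P : (v4Complex h).Realization → Prop} (hpt : ∀ v, P (pt h v))
    (hv : ∀ a i t, P (onEdge h (.v a i false) t)) (hh : ∀ b j t, P (onEdge h (.h b j false) t))
    (hs : ∀ s p, P (onSquare h s p)) (x : (v4Complex h).Realization) : P x := by
  induction x using Quot.ind with
  | mk p =>
    rcases p with ⟨u, ⟨⟩⟩ | ⟨⟨a, i, r⟩ | ⟨b, j, r⟩, t⟩ | ⟨s, p⟩
    · exact hpt u
    · change P (onEdge h _ t)
      rw [onEdge_v]
      exact hv _ _ _
    · change P (onEdge h _ t)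
      rw [onEdge_h]
      exact hh _ _ _
    · exact hs s p

theorem contraction_zero (v : Bool × Bool) (x : (v4Complex h).Realization) :
    contraction h v x 0 = x := by
  refine point_cases h (P := fun x => contraction h v x 0 = x) (fun u => rfl) (fun a i t => ?_)
    (fun b j t => ?_) (fun s p => ?_) x
  · rw [contraction_onEdge_v, pull_zero_left]
  · rw [contraction_onEdge_h, pull_zero_left]
  · rw [contraction_onSquare, pull_zero_left, pull_zero_left]

theorem contraction_one (v : Bool × Bool) (x : (v4Complex h).Realization) :
    x ∈ openStar h v → contraction h v x 1 = pt h v := by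
  refine point_cases h (P := fun x => x ∈ openStar h v → contraction h v x 1 = pt h v)
    (fun u hu => ?_) (fun a i t hx => ?_) (fun b j t hx => ?_) (fun s p hx => ?_) x
  · obtain rfl : u = v := hu
    rfl
  · obtain ⟨rfl, ht⟩ := (onEdge_v_mem_openStar h).mp hx
    rw [contraction_onEdge_v, pull_one_left ht, onEdge_v_endPt]
  · obtain ⟨rfl, ht⟩ := (onEdge_h_mem_openStar h).mp hx
    rw [contraction_onEdge_h, pull_one_left ht, onEdge_h_endPt]
  · rw [contraction_onSquare, pull_one_left hx.1, pull_one_left hx.2, onSquare_endPt]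

/-- The path from a point in the open star of `v` to `v`. -/
def tether {v : Bool × Bool} {x : (v4Complex h).Realization} (hx : x ∈ openStar h v) :
    Path x (pt h v) where
  toContinuousMap := contraction h v x
  source' := contraction_zero h v x
  target' := contraction_one h v x hx

/-- The map `(s, τ) ↦ contraction (δ s) τ` on the unit square has `δ`, the two tethers and the
constant path at `v` as its sides. Both ways along the boundary are homotopic to the diagonal. -/
theorem trans_tether {v : Bool × Bool} {x y : (v4Complex h).Realization} (δ : Path x y)
    (hδ : ∀ t, δ t ∈ openStar h v) (hx : x ∈ openStar h v) (hy : y ∈ openStar h v) :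
    (Path.Homotopic.Quotient.mk δ).trans (.mk (tether h hy)) = .mk (tether h hx) := by
  have hc : Continuous fun p : I × I => contraction h v (δ p.1) p.2 :=
    ContinuousEval.continuous_eval.comp
      ((((continuous_contraction h v).comp δ.continuous).comp continuous_fst).prodMk continuous_snd)
  let diag : Path x (pt h v) :=
    { toFun := fun t => contraction h v (δ t) t
      continuous_toFun := hc.comp (continuous_id.prodMk continuous_id)
      source' := by rw [contraction_zero, δ.source]
      target' := by rw [contraction_one h v _ (hδ 1)] }
  have h1 : (Path.Homotopic.Quotient.mk δ).trans (.mk (tether h hy)) = .mk diag :=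
    mk_trans_mk_of_factor ⟨_, hc⟩ ((ContinuousMap.id I).prodMk (.const I 0))
      ((ContinuousMap.const I 1).prodMk (.id I)) ((ContinuousMap.id I).prodMk (.id I))
      rfl rfl rfl _ _ _ (fun t => (contraction_zero h v (δ t)).symm)
      (fun t => by
        change contraction h v y t = contraction h v (δ 1) t
        rw [δ.target]) fun t => rfl
  have h2 : (Path.Homotopic.Quotient.mk (tether h hx)).trans (.mk (Path.refl (pt h v)))
      = .mk diag :=
    mk_trans_mk_of_factor ⟨_, hc⟩ ((ContinuousMap.const I 0).prodMk (.id I))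
      ((ContinuousMap.id I).prodMk (.const I 1)) ((ContinuousMap.id I).prodMk (.id I))
      rfl rfl rfl _ _ _
      (fun t => by
        change contraction h v x t = contraction h v (δ 0) t
        rw [δ.source])
      (fun t => (contraction_one h v _ (hδ t)).symm) fun t => rfl
  rw [h1, ← h2, Path.Homotopic.Quotient.mk_refl, Path.Homotopic.Quotient.trans_refl]

/-- The label of an oriented edge. -/
def label : V4Edge A B → Λ
  | .v a _ r => if r then (a : Λ)⁻¹ else a
  | .h b _ r => if r then (b : Λ)⁻¹ else b

/-- The homotopy classes of edge paths, with the products of the labels. -/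
inductive IsEdgePath : ∀ v w : Bool × Bool, Path.Homotopic.Quotient (pt h v) (pt h w) → Λ → Prop
  | refl (v : Bool × Bool) : IsEdgePath v v (.refl _) 1
  | edge_v (a : A) (i r : Bool) : IsEdgePath (i, r) (i, !r)
      (.mk (edgePath (X := v4Complex h) (.v a i r))) (label (A := A) (B := B) (.v a i r))
  | edge_h (b : B) (j r : Bool) : IsEdgePath (r, j) (!r, j)
      (.mk (edgePath (X := v4Complex h) (.h b j r))) (label (A := A) (B := B) (.h b j r))
  | trans {u v w : Bool × Bool} {γ : Path.Homotopic.Quotient (pt h u) (pt h v)}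
      {δ : Path.Homotopic.Quotient (pt h v) (pt h w)} {g k : Λ} :
      IsEdgePath u v γ g → IsEdgePath v w δ k → IsEdgePath u w (γ.trans δ) (g * k)

end v4Complex

/-! ### Generation of the fundamental groupoid by edge paths -/

theorem fromEnd_zero (b : Bool) : fromEnd b 0 = endPt b := by
  cases b <;> simp [fromEnd, endPt]

theorem fromEnd_one (b : Bool) : fromEnd b 1 = endPt !b := by
  cases b <;> simp [fromEnd, endPt]

theorem symm_trans_cast_trans {X : Type} [TopologicalSpace X] {x y x' y' : X} (hx : x' = x)
    (hy : y' = y) (γ : Path x y) (p : Path x' x) (q : Path y' y)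
    (hp : p = (Path.refl x).cast hx rfl) (hq : q = (Path.refl y).cast hy rfl) :
    (Path.Homotopic.Quotient.mk p).symm.trans
      ((Path.Homotopic.Quotient.mk (γ.cast hx hy)).trans (.mk q)) = .mk γ := by
  subst hx hy hp hq
  change (Path.Homotopic.Quotient.mk (Path.refl x')).symm.trans
    ((Path.Homotopic.Quotient.mk γ).trans (Path.Homotopic.Quotient.mk (Path.refl y'))) = .mk γ
  rw [Path.Homotopic.Quotient.mk_refl, Path.Homotopic.Quotient.mk_refl,
    Path.Homotopic.Quotient.trans_refl]
  exact Path.Homotopic.Quotient.refl_trans _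

namespace v4Complex

open SquareComplex

variable {Λ : Type} [Group Λ] {A B : Set Λ} (h : IsV4Structure A B)

/-- The change of vertex in the intersection of two open stars. -/
def change {v w : Bool × Bool} {x : (v4Complex h).Realization} (hv : x ∈ openStar h v)
    (hw : x ∈ openStar h w) : Path.Homotopic.Quotient (pt h v) (pt h w) :=
  (Path.Homotopic.Quotient.mk (tether h hv)).symm.trans (.mk (tether h hw))

theorem change_self {v : Bool × Bool} {x : (v4Complex h).Realization} (hv : x ∈ openStar h v) :
    change h hv hv = .refl _ := by
  rw [change, Path.Homotopic.Quotient.symm_trans]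

theorem change_trans {u v w : Bool × Bool} {x : (v4Complex h).Realization}
    (hu : x ∈ openStar h u) (hv : x ∈ openStar h v) (hw : x ∈ openStar h w) :
    (change h hu hv).trans (change h hv hw) = change h hu hw := by
  rw [change, change, change, Path.Homotopic.Quotient.trans_assoc,
    ← Path.Homotopic.Quotient.trans_assoc (Path.Homotopic.Quotient.mk (tether h hv)),
    Path.Homotopic.Quotient.trans_symm, Path.Homotopic.Quotient.refl_trans]

/-- Both tethers and the edge path factor through one interval, where only the end points matter. -/
theorem change_onEdge_v {a : A} {i j : Bool} {t : I}
    (hv : onEdge h (.v a i false) t ∈ openStar h (i, j))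
    (hw : onEdge h (.v a i false) t ∈ openStar h (i, !j)) :
    change h hv hw = .mk (edgePath (X := v4Complex h) (.v a i j)) := by
  rw [change, ← Path.Homotopic.Quotient.mk_symm]
  refine mk_trans_mk_of_factor ⟨_, continuous_onEdge h (.v a i false)⟩
    ⟨fun τ => pull j (σ τ) t, (continuous_pull j).comp
      (unitInterval.continuous_symm.prodMk continuous_const)⟩
    ⟨fun τ => pull (!j) τ t, (continuous_pull !j).comp (continuous_id.prodMk continuous_const)⟩
    ⟨_, continuous_fromEnd j⟩ ?_ ?_ ?_ _ _ _ (fun τ => contraction_onEdge_v h (i, j) a i t (σ τ))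
    (fun τ => contraction_onEdge_v h (i, !j) a i t τ) fun t => onEdge_v h a i j t
  · simp [pull_zero_left]
  · simp [fromEnd_zero, pull_one_left ((onEdge_v_mem_openStar h).mp hv).2]
  · simp [fromEnd_one, pull_one_left ((onEdge_v_mem_openStar h).mp hw).2]

theorem change_onEdge_h {b : B} {i j : Bool} {t : I}
    (hv : onEdge h (.h b j false) t ∈ openStar h (i, j))
    (hw : onEdge h (.h b j false) t ∈ openStar h (!i, j)) :
    change h hv hw = .mk (edgePath (X := v4Complex h) (.h b j i)) := by
  rw [change, ← Path.Homotopic.Quotient.mk_symm]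
  refine mk_trans_mk_of_factor ⟨_, continuous_onEdge h (.h b j false)⟩
    ⟨fun τ => pull i (σ τ) t, (continuous_pull i).comp
      (unitInterval.continuous_symm.prodMk continuous_const)⟩
    ⟨fun τ => pull (!i) τ t, (continuous_pull !i).comp (continuous_id.prodMk continuous_const)⟩
    ⟨_, continuous_fromEnd i⟩ ?_ ?_ ?_ _ _ _ (fun τ => contraction_onEdge_h h (i, j) b j t (σ τ))
    (fun τ => contraction_onEdge_h h (!i, j) b j t τ) fun t => onEdge_h h b j i t
  · simp [pull_zero_left]
  · simp [fromEnd_zero, pull_one_left ((onEdge_h_mem_openStar h).mp hv).2]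
  · simp [fromEnd_one, pull_one_left ((onEdge_h_mem_openStar h).mp hw).2]

/-- Inside the simply connected square, the way from one corner through `p` to an adjacent corner is
homotopic to the side between them. -/
theorem change_onSquare_v {s : V4Square A B} {i j : Bool} {p : I × I}
    (hv : onSquare h s p ∈ openStar h (i, j)) (hw : onSquare h s p ∈ openStar h (i, !j)) :
    change h hv hw = .mk (edgePath (X := v4Complex h) (.v (sideV s i) i j)) := by
  rw [change, ← Path.Homotopic.Quotient.mk_symm]
  refine mk_trans_mk_of_factor ⟨_, continuous_onSquare h s⟩
    ⟨fun τ => (pull j (σ τ) p.1, pull i (σ τ) p.2),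
      ((continuous_pull j).comp (unitInterval.continuous_symm.prodMk continuous_const)).prodMk
        ((continuous_pull i).comp (unitInterval.continuous_symm.prodMk continuous_const))⟩
    ⟨fun τ => (pull (!j) τ p.1, pull i τ p.2),
      ((continuous_pull !j).comp (continuous_id.prodMk continuous_const)).prodMk
        ((continuous_pull i).comp (continuous_id.prodMk continuous_const))⟩
    ⟨fun t => (fromEnd j t, endPt i), (continuous_fromEnd j).prodMk continuous_const⟩
    ?_ ?_ ?_ _ _ _ (fun τ => rfl) (fun τ => rfl)
    fun t => (onEdge_v h _ i j t).trans (onSquare_sideV h s i _).symm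
  · simp [pull_zero_left]
  · simp [fromEnd_zero, pull_one_left hv.1, pull_one_left hv.2]
  · simp [fromEnd_one, pull_one_left hw.1, pull_one_left hw.2]

theorem change_onSquare_h {s : V4Square A B} {i j : Bool} {p : I × I}
    (hv : onSquare h s p ∈ openStar h (i, j)) (hw : onSquare h s p ∈ openStar h (!i, j)) :
    change h hv hw = .mk (edgePath (X := v4Complex h) (.h (sideH s j) j i)) := by
  rw [change, ← Path.Homotopic.Quotient.mk_symm]
  refine mk_trans_mk_of_factor ⟨_, continuous_onSquare h s⟩
    ⟨fun τ => (pull j (σ τ) p.1, pull i (σ τ) p.2),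
      ((continuous_pull j).comp (unitInterval.continuous_symm.prodMk continuous_const)).prodMk
        ((continuous_pull i).comp (unitInterval.continuous_symm.prodMk continuous_const))⟩
    ⟨fun τ => (pull j τ p.1, pull (!i) τ p.2),
      ((continuous_pull j).comp (continuous_id.prodMk continuous_const)).prodMk
        ((continuous_pull !i).comp (continuous_id.prodMk continuous_const))⟩
    ⟨fun t => (endPt j, fromEnd i t), continuous_const.prodMk (continuous_fromEnd i)⟩
    ?_ ?_ ?_ _ _ _ (fun τ => rfl) (fun τ => rfl)
    fun t => (onEdge_h h _ j i t).trans (onSquare_sideH h s j _).symm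
  · simp [pull_zero_left]
  · simp [fromEnd_zero, pull_one_left hv.1, pull_one_left hv.2]
  · simp [fromEnd_one, pull_one_left hw.1, pull_one_left hw.2]

theorem exists_isEdgePath_change {v w : Bool × Bool} (x : (v4Complex h).Realization) :
    ∀ (hv : x ∈ openStar h v) (hw : x ∈ openStar h w), ∃ g, IsEdgePath h v w
      (change h hv hw) g := by
  have hself (v : Bool × Bool) (x : (v4Complex h).Realization) (hv : x ∈ openStar h v) :
      ∃ g, IsEdgePath h v v (change h hv hv) g := ⟨1, by rw [change_self]; exact .refl v⟩
  obtain ⟨i, j⟩ := v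
  obtain ⟨k, l⟩ := w
  refine point_cases h (P := fun x => ∀ (hv : x ∈ openStar h (i, j)) (hw : x ∈ openStar h (k, l)),
    ∃ g, IsEdgePath h (i, j) (k, l) (change h hv hw) g)
    (fun u hv hw => ?_) (fun a m t hv hw => ?_) (fun b m t hv hw => ?_) (fun s p hv hw => ?_) x
  · obtain rfl : u = (i, j) := hv
    obtain ⟨rfl, rfl⟩ : i = k ∧ j = l := Prod.mk.inj hw
    exact hself _ _ _
  · obtain rfl : m = i := ((onEdge_v_mem_openStar h).mp hv).1
    obtain rfl : m = k := ((onEdge_v_mem_openStar h).mp hw).1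
    rcases eq_or_ne l j with rfl | hl
    · exact hself _ _ _
    · obtain rfl : l = !j := Bool.eq_not.mpr hl
      have := IsEdgePath.edge_v (h := h) a m j
      rw [← change_onEdge_v h hv hw] at this
      exact ⟨_, this⟩
  · obtain rfl : m = j := ((onEdge_h_mem_openStar h).mp hv).1
    obtain rfl : m = l := ((onEdge_h_mem_openStar h).mp hw).1
    rcases eq_or_ne k i with rfl | hl
    · exact hself _ _ _
    · obtain rfl : k = !i := Bool.eq_not.mpr hl
      have := IsEdgePath.edge_h (h := h) b m i
      rw [← change_onEdge_h h hv hw] at this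
      exact ⟨_, this⟩
  -- For opposite corners, pass through the corner `(k, j)`. The point lies in its star too, since
  -- membership is a condition on each coordinate separately.
  · have hu : onSquare h s p ∈ openStar h (k, j) := ⟨hv.1, hw.2⟩
    have h1 : ∃ g, IsEdgePath h (i, j) (k, j) (change h hv hu) g := by
      rcases eq_or_ne k i with rfl | hl
      · exact hself _ _ _
      · obtain rfl : k = !i := Bool.eq_not.mpr hl
        have := IsEdgePath.edge_h (h := h) (sideH s j) j i
        rw [← change_onSquare_h h hv hu] at this
        exact ⟨_, this⟩
    have h2 : ∃ g, IsEdgePath h (k, j) (k, l) (change h hu hw) g := by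
      rcases eq_or_ne l j with rfl | hl
      · exact hself _ _ _
      · obtain rfl : l = !j := Bool.eq_not.mpr hl
        have := IsEdgePath.edge_v (h := h) (sideV s k) k j
        rw [← change_onSquare_v h hu hw] at this
        exact ⟨_, this⟩
    obtain ⟨g₁, h1⟩ := h1
    obtain ⟨g₂, h2⟩ := h2
    exact ⟨g₁ * g₂, by rw [← change_trans h hv hu hw]; exact h1.trans h2⟩

/-- Induction over a subdivision whose pieces lie in single open stars. Inside a star a piece is
absorbed by the tethers; between stars a change of vertex contributes an edge path. -/
theorem exists_isEdgePath_tether {x y : (v4Complex h).Realization} (γ : Path x y)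
    {v : Bool × Bool} (hv : γ 0 ∈ openStar h v) (s : I) (n : ℕ) (t : ℕ → I) (ht0 : t 0 = 0)
    (ht : Monotone t)
    (hc : ∀ n, ∃ u, Set.Icc (t n) (t (n + 1)) ⊆ {s | γ s ∈ openStar h u}) (hs : t n = s) :
    ∀ w, ∀ hw : γ s ∈ openStar h w, ∃ g, IsEdgePath h v w
      ((Path.Homotopic.Quotient.mk (tether h hv)).symm.trans
        ((Path.Homotopic.Quotient.mk (γ.subpath 0 s)).trans (.mk (tether h hw)))) g := by
  induction n generalizing s with
  | zero =>
    obtain rfl : s = 0 := hs.symm.trans ht0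
    intro w hw
    rw [Path.subpath_self, Path.Homotopic.Quotient.mk_refl, Path.Homotopic.Quotient.refl_trans]
    exact exists_isEdgePath_change h _ hv hw
  | succ n ih =>
    subst hs
    intro w hw
    obtain ⟨u, hu⟩ := hc n
    have hle : t n ≤ t (n + 1) := ht n.le_succ
    have h0 : γ (t n) ∈ openStar h u := hu ⟨le_rfl, hle⟩
    have h1 : γ (t (n + 1)) ∈ openStar h u := hu ⟨hle, le_rfl⟩
    obtain ⟨g₁, ih⟩ := ih (t n) rfl u h0
    obtain ⟨g₂, hg⟩ := exists_isEdgePath_change h _ h1 hw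
    refine ⟨g₁ * g₂, ?_⟩
    have hδ : ∀ τ, γ.subpath (t n) (t (n + 1)) τ ∈ openStar h u := by
      intro τ
      have : γ.subpath (t n) (t (n + 1)) τ ∈ γ '' Set.Icc (t n) (t (n + 1)) := by
        rw [← Path.range_subpath_of_le _ _ _ hle]
        exact Set.mem_range_self τ
      obtain ⟨r, hr, e⟩ := this
      rw [← e]
      exact hu hr
    convert ih.trans hg using 1
    rw [← trans_tether h _ hδ h0 h1, change, ← subpath_trans_subpath γ 0 (t n) (t (n + 1))]
    simp only [Path.Homotopic.Quotient.trans_assoc]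
    rw [← Path.Homotopic.Quotient.trans_assoc (Path.Homotopic.Quotient.mk (tether h h1)),
      Path.Homotopic.Quotient.trans_symm, Path.Homotopic.Quotient.refl_trans]

/-- A Lebesgue subdivision for the cover by the four open stars exists, and the tethers at the two
ends are constant because these are vertices. -/
theorem exists_isEdgePath {v w : Bool × Bool} (γ : Path.Homotopic.Quotient (pt h v) (pt h w)) :
    ∃ g, IsEdgePath h v w γ g := by
  obtain ⟨γ, rfl⟩ := Path.Homotopic.Quotient.mk_surjective γ
  obtain ⟨t, ht0, ht, ⟨n, hn⟩, hc⟩ := exists_monotone_Icc_subset_open_cover_unitInterval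
    (c := fun u => {s | γ s ∈ openStar h u}) (fun u => (isOpen_openStar h u).preimage γ.continuous)
    fun s _ => Set.mem_iUnion.mpr (exists_mem_openStar h (γ s))
  have hv : γ 0 ∈ openStar h v := by
    rw [γ.source]
    exact rfl
  have hw : γ 1 ∈ openStar h w := by
    rw [γ.target]
    exact rfl
  obtain ⟨g, hg⟩ := exists_isEdgePath_tether h γ hv 1 n t ht0 ht hc (hn n le_rfl) w hw
  refine ⟨g, ?_⟩
  have hcast {v : Bool × Bool} {x : (v4Complex h).Realization} (hx : x ∈ openStar h v)
      (e : x = pt h v) : tether h hx = (Path.refl (pt h v)).cast e rfl := by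
    subst e
    rfl
  rw [Path.subpath_zero_one] at hg
  rwa [symm_trans_cast_trans γ.source γ.target γ _ _ (hcast hv γ.source)
    (hcast hw γ.target)] at hg

end v4Complex

/-! ### The labels of homotopy classes of edge paths -/

namespace v4Complex

open SquareComplex

variable {Λ : Type} [Group Λ] {A B : Set Λ} (h : IsV4Structure A B)

/-- A potential for the labels on a closed cell. -/
def potential (v : Bool × Bool) : (v4Complex h).Cells → Λ
  | .inl _ => 1
  | .inr (.inl ⟨.v a _ _, _⟩) => if v.2 then a else 1
  | .inr (.inl ⟨.h b _ _, _⟩) => if v.1 then b else 1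
  | .inr (.inr ⟨s, _⟩) => if v.1 then (if v.2 then (s.bottom : Λ) * s.right else s.bottom)
      else (if v.2 then s.left else 1)

/-- Each cell normalises its potential at its own corner, so glued cells agree only in the
differences. On the side `bd 1` this is the relation `left * top = bottom * right` of the square. -/
theorem potential_of_glue {v w : Bool × Bool} {p q : (v4Complex h).Cells}
    (hpq : (v4Complex h).Glue p q) (hv : inStar h v q) (hw : inStar h w q) :
    (potential h v p)⁻¹ * potential h w p = (potential h v q)⁻¹ * potential h w q := by
  obtain ⟨i, j⟩ := v
  obtain ⟨k, l⟩ := w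
  cases hpq with
  | src e =>
    obtain ⟨rfl, rfl⟩ : i = k ∧ j = l := Prod.mk.inj ((show _ = _ from hv).symm.trans hw)
    rw [inv_mul_cancel, inv_mul_cancel]
  | rev e t =>
    rcases e with ⟨a, m, r⟩ | ⟨b, m, r⟩ <;> rfl
  | bd0 s t =>
    obtain rfl : false = i := hv.1
    obtain rfl : false = k := hw.1
    rfl
  | bd1 s t =>
    obtain rfl : true = j := hv.1
    obtain rfl : true = l := hw.1
    have := s.mul_eq
    change (if i then (s.bottom : Λ) * s.right else s.left)⁻¹ *
      (if k then (s.bottom : Λ) * s.right else s.left)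
      = (if i then (s.top : Λ) else 1)⁻¹ * (if k then (s.top : Λ) else 1)
    rw [← this]
    cases i <;> cases k <;> simp
  | bd2 s t =>
    obtain rfl : true = i := hv.1
    obtain rfl : true = k := hw.1
    change (if j then (s.bottom : Λ) * s.right else s.bottom)⁻¹ *
      (if l then (s.bottom : Λ) * s.right else s.bottom)
      = (if j then (s.right : Λ) else 1)⁻¹ * (if l then (s.right : Λ) else 1)
    cases j <;> cases l <;> simp
  | bd3 s t =>
    obtain rfl : false = j := hv.1
    obtain rfl : false = l := hw.1
    rfl

open scoped Classical in
/-- The difference of the potentials of two vertices, at a point of both open stars. -/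
def cocycle (v w : Bool × Bool) : (v4Complex h).Realization → Λ :=
  Quot.lift (fun p => if inStar h v p ∧ inStar h w p then
    (potential h v p)⁻¹ * potential h w p else 1) fun p q hpq => by
      rw [inStar_iff_of_glue h v hpq, inStar_iff_of_glue h w hpq]
      split_ifs with hq
      · exact potential_of_glue h hpq hq.1 hq.2
      · rfl

theorem cocycle_proj {v w : Bool × Bool} {p : (v4Complex h).Cells} (hv : inStar h v p)
    (hw : inStar h w p) :
    cocycle h v w ((v4Complex h).proj p) = (potential h v p)⁻¹ * potential h w p :=
  if_pos ⟨hv, hw⟩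

theorem cocycle_self {v : Bool × Bool} {x : (v4Complex h).Realization} (hx : x ∈ openStar h v) :
    cocycle h v v x = 1 := by
  induction x using Quot.ind with
  | mk p => exact (cocycle_proj h hx hx).trans (inv_mul_cancel _)

theorem cocycle_mul_cocycle {u v w : Bool × Bool} {x : (v4Complex h).Realization}
    (hu : x ∈ openStar h u) (hv : x ∈ openStar h v) (hw : x ∈ openStar h w) :
    cocycle h u v x * cocycle h v w x = cocycle h u w x := by
  induction x using Quot.ind with
  | mk p =>
    change cocycle h u v ((v4Complex h).proj p) * cocycle h v w ((v4Complex h).proj p)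
      = cocycle h u w ((v4Complex h).proj p)
    rw [cocycle_proj h hu hv, cocycle_proj h hv hw, cocycle_proj h hu hw, mul_assoc,
      mul_inv_cancel_left]

theorem continuous_potential [TopologicalSpace Λ] (v : Bool × Bool) :
    Continuous (potential h v) := by
  refine continuous_sum_dom.mpr ⟨continuous_const, continuous_sum_dom.mpr
    ⟨continuous_sigma fun e => ?_, continuous_sigma fun s => continuous_of_const fun _ _ => rfl⟩⟩
  rcases e with ⟨a, i, r⟩ | ⟨b, j, r⟩ <;> exact continuous_of_const fun _ _ => rfl

theorem continuousOn_cocycle [TopologicalSpace Λ] [DiscreteTopology Λ] (v w : Bool × Bool) :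
    ContinuousOn (cocycle h v w) (openStar h v ∩ openStar h w) := by
  have hq : Topology.IsQuotientMap (v4Complex h).proj := isQuotientMap_quot_mk
  rw [hq.continuousOn_isOpen_iff ((isOpen_openStar h v).inter (isOpen_openStar h w))]
  exact ((continuous_potential h v).inv.mul (continuous_potential h w)).continuousOn.congr
    fun p hp => cocycle_proj h hp.1 hp.2

/-! ### Monodromy of the covering given by the labels -/

/-- The covering of the square complex with fibre `Λ` that is given by the labels. -/
def labelBundle [TopologicalSpace Λ] [DiscreteTopology Λ] :
    FiberBundleCore (Bool × Bool) (v4Complex h).Realization Λ where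
  baseSet := openStar h
  isOpen_baseSet := isOpen_openStar h
  indexAt x := (exists_mem_openStar h x).choose
  mem_baseSet_at x := (exists_mem_openStar h x).choose_spec
  coordChange v w x g := g * cocycle h v w x
  coordChange_self v x hx g := by rw [cocycle_self h hx, mul_one]
  continuousOn_coordChange v w :=
    continuousOn_snd.mul ((continuousOn_cocycle h v w).comp continuousOn_fst fun p hp => hp.1)
  coordChange_comp u v w x hx g := by
    rw [mul_assoc, cocycle_mul_cocycle h hx.1.1 hx.1.2 hx.2]

section Covering

variable [TopologicalSpace Λ] [DiscreteTopology Λ]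

theorem isCoveringMap_labelBundle : IsCoveringMap (labelBundle h).proj :=
  FiberBundle.isCoveringMap (F := Λ) (E := (labelBundle h).Fiber)

/-- The point above `x` with coordinate `g` over the open star of `v`. -/
def liftPt (v : Bool × Bool) (g : Λ) (x : (v4Complex h).Realization) :
    (labelBundle h).proj ⁻¹' {x} :=
  ⟨⟨x, (labelBundle h).coordChange v ((labelBundle h).indexAt x) x g⟩, rfl⟩

theorem liftPt_eq_liftPt {v w : Bool × Bool} {x : (v4Complex h).Realization}
    (hv : x ∈ openStar h v) (hw : x ∈ openStar h w) (g : Λ) :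
    liftPt h v g x = liftPt h w (g * cocycle h v w x) x := by
  refine Subtype.ext (congrArg (Bundle.TotalSpace.mk x) ?_)
  exact ((labelBundle h).coordChange_comp v w _ x
    ⟨⟨hv, hw⟩, (labelBundle h).mem_baseSet_at x⟩ g).symm

theorem liftPt_injective (v : Bool × Bool) (x : (v4Complex h).Realization) :
    Function.Injective fun g => liftPt h v g x := by
  intro g k e
  have := congrArg (fun p => p.1.2) e
  exact mul_right_cancel this

/-- Over one open star the covering is trivialised, and the lift has constant coordinate. -/
theorem monodromy_liftPt {v : Bool × Bool} {x y : (v4Complex h).Realization} (δ : Path x y)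
    (hδ : ∀ t, δ t ∈ openStar h v) (g : Λ) :
    (isCoveringMap_labelBundle h).monodromy (.mk δ) (liftPt h v g x) = liftPt h v g y := by
  let Γ : Path (liftPt h v g x).1 (liftPt h v g y).1 :=
    { toFun := fun t => (liftPt h v g (δ t)).1
      continuous_toFun := by
        have : ContinuousOn ((labelBundle h).localTriv v).toOpenPartialHomeomorph.symm
          ((labelBundle h).localTriv v).target :=
            ((labelBundle h).localTriv v).toOpenPartialHomeomorph.continuousOn_symm
        refine this.comp_continuous (δ.continuous.prodMk continuous_const) fun t => ?_
        exact ((labelBundle h).mem_localTriv_target v (δ t, g)).mpr (hδ t)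
      source' := by rw [δ.source]
      target' := by rw [δ.target] }
  exact (isCoveringMap_labelBundle h).monodromy_eq_of_map_eq (.mk Γ) rfl

/-- The middle of the unit interval. -/
def half : I := ⟨1 / 2, by norm_num, by norm_num⟩

/-- Lift the two halves with constant coordinates in their stars; at the middle the coordinate
changes by the cocycle. An edge is of this kind, and its cocycle is its label. -/
theorem monodromy_liftPt_of_half {v w : Bool × Bool} {x y : (v4Complex h).Realization}
    (γ : Path x y) (hv : ∀ t ≤ half, γ t ∈ openStar h v) (hw : ∀ t ≥ half, γ t ∈ openStar h w)
    (g : Λ) :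
    (isCoveringMap_labelBundle h).monodromy (.mk γ) (liftPt h v g x)
      = liftPt h w (g * cocycle h v w (γ half)) y := by
  obtain ⟨γ, rfl, rfl⟩ := γ
  set γ' : Path (γ 0) (γ 1) := ⟨γ, rfl, rfl⟩
  have e : Path.Homotopic.Quotient.mk γ' = (Path.Homotopic.Quotient.mk (γ'.subpath 0 half)).trans
      (.mk (γ'.subpath half 1)) := by
    rw [subpath_trans_subpath, Path.subpath_zero_one]
    rfl
  have h0 : (0 : I) ≤ half := half.2.1
  have h1 : half ≤ (1 : I) := half.2.2
  have key {a b : I} (hab : a ≤ b) (t : I) : ∃ s ∈ Set.Icc a b, γ'.subpath a b t = γ' s := by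
    have : γ'.subpath a b t ∈ γ' '' Set.Icc a b := by
      rw [← Path.range_subpath_of_le _ _ _ hab]
      exact Set.mem_range_self t
    obtain ⟨s, hs, e⟩ := this
    exact ⟨s, hs, e.symm⟩
  rw [e, (isCoveringMap_labelBundle h).monodromy_trans_apply]
  have e1 := monodromy_liftPt h (γ'.subpath 0 half) (v := v) (fun t => by
    obtain ⟨s, hs, e⟩ := key h0 t
    rw [e]
    exact hv s hs.2) g
  have e2 := monodromy_liftPt h (γ'.subpath half 1) (v := w) (fun t => by
    obtain ⟨s, hs, e⟩ := key h1 t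
    rw [e]
    exact hw s hs.1) (g * cocycle h v w (γ' half))
  rw [← liftPt_eq_liftPt h (hv half le_rfl) (hw half le_rfl)] at e2
  exact (congrArg _ e1).trans e2

theorem monodromy_edgePath_v (a : A) (i r : Bool) (g : Λ) :
    (isCoveringMap_labelBundle h).monodromy
      (.mk (edgePath (X := v4Complex h) (.v a i r))) (liftPt h (i, r) g (pt h (i, r)))
      = liftPt h (i, !r) (g * label (A := A) (B := B) (.v a i r)) (pt h (i, !r)) := by
  have hv : ∀ t ≤ half, inStar h (i, r) (edg (X := v4Complex h) (.v a i r) t) := by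
    intro t ht
    refine ⟨rfl, ?_⟩
    rw [Bool.xor_self]
    exact lt_of_le_of_lt (show (t : ℝ) ≤ 1 / 2 from ht) (by norm_num)
  have hw : ∀ t ≥ half, inStar h (i, !r) (edg (X := v4Complex h) (.v a i r) t) := by
    intro t ht
    refine ⟨rfl, ?_⟩
    rw [Bool.xor_not, Bool.xor_self]
    have : (1 / 2 : ℝ) ≤ t := ht
    change 1 - (t : ℝ) < 2 / 3
    linarith
  have e := monodromy_liftPt_of_half h (edgePath (X := v4Complex h) (.v a i r)) hv hw g
  have hc : cocycle h (i, r) (i, !r) (onEdge h (.v a i r) half)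
      = label (A := A) (B := B) (.v a i r) := by
    refine (cocycle_proj h (hv half le_rfl) (hw half le_rfl)).trans ?_
    cases r <;> simp [potential, label]
  rw [← hc]
  exact e

theorem monodromy_edgePath_h (b : B) (j r : Bool) (g : Λ) :
    (isCoveringMap_labelBundle h).monodromy
      (.mk (edgePath (X := v4Complex h) (.h b j r))) (liftPt h (r, j) g (pt h (r, j)))
      = liftPt h (!r, j) (g * label (A := A) (B := B) (.h b j r)) (pt h (!r, j)) := by
  have hv : ∀ t ≤ half, inStar h (r, j) (edg (X := v4Complex h) (.h b j r) t) := by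
    intro t ht
    refine ⟨rfl, ?_⟩
    rw [Bool.xor_self]
    exact lt_of_le_of_lt (show (t : ℝ) ≤ 1 / 2 from ht) (by norm_num)
  have hw : ∀ t ≥ half, inStar h (!r, j) (edg (X := v4Complex h) (.h b j r) t) := by
    intro t ht
    refine ⟨rfl, ?_⟩
    rw [Bool.xor_not, Bool.xor_self]
    have : (1 / 2 : ℝ) ≤ t := ht
    change 1 - (t : ℝ) < 2 / 3
    linarith
  have e := monodromy_liftPt_of_half h (edgePath (X := v4Complex h) (.h b j r)) hv hw g
  have hc : cocycle h (r, j) (!r, j) (onEdge h (.h b j r) half)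
      = label (A := A) (B := B) (.h b j r) := by
    refine (cocycle_proj h (hv half le_rfl) (hw half le_rfl)).trans ?_
    cases r <;> simp [potential, label]
  rw [← hc]
  exact e

theorem IsEdgePath.monodromy {v w : Bool × Bool} {γ : Path.Homotopic.Quotient (pt h v) (pt h w)}
    {k : Λ} (hγ : IsEdgePath h v w γ k) (g : Λ) :
    (isCoveringMap_labelBundle h).monodromy γ (liftPt h v g (pt h v))
      = liftPt h w (g * k) (pt h w) := by
  induction hγ generalizing g with
  | refl v => rw [(isCoveringMap_labelBundle h).monodromy_refl, mul_one, id]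
  | edge_v a i r => exact monodromy_edgePath_v h a i r g
  | edge_h b j r => exact monodromy_edgePath_h h b j r g
  | trans h1 h2 ih1 ih2 =>
    rw [(isCoveringMap_labelBundle h).monodromy_trans_apply, ih1, ih2, mul_assoc]

end Covering

/-- The monodromy depends only on the homotopy class and carries the coordinate `1` to the product
of the labels. The topology put on `Λ` is the discrete one. -/
theorem IsEdgePath.unique {v w : Bool × Bool} {γ : Path.Homotopic.Quotient (pt h v) (pt h w)}
    {k l : Λ} (hk : IsEdgePath h v w γ k) (hl : IsEdgePath h v w γ l) : k = l := by
  let _ : TopologicalSpace Λ := ⊥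
  have : DiscreteTopology Λ := ⟨rfl⟩
  have := (hk.monodromy h 1).symm.trans (hl.monodromy h 1)
  rw [one_mul, one_mul] at this
  exact liftPt_injective h w _ this

end v4Complex

/-! ### The orbispace fundamental group -/

namespace OrbPi1

theorem cast_trans_cast_right {X : Type} [TopologicalSpace X] {a b c b' c' : X} (hb : b' = b)
    (hc : c' = c) (α : Path.Homotopic.Quotient a b) (β : Path.Homotopic.Quotient b c) :
    (α.cast rfl hb).trans (β.cast hb hc) = (α.trans β).cast rfl hc := by
  subst hb hc
  simp

theorem cast_cast_symm {X : Type} [TopologicalSpace X] {a b a' b' : X} (ha : a' = a)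
    (hb : b' = b) (α : Path.Homotopic.Quotient a b) :
    (α.cast ha hb).cast ha.symm hb.symm = α := by
  subst ha hb
  simp

theorem cast_injective {X : Type} [TopologicalSpace X] {a b a' b' : X} (ha : a' = a)
    (hb : b' = b) : Function.Injective fun α : Path.Homotopic.Quotient a b => α.cast ha hb := by
  subst ha hb
  intro α β e
  simpa using e

variable {G S : Type} [Group G] [TopologicalSpace S] [MulAction G S] {s : S}

theorem ofLoop_injective : Function.Injective (ofLoop (G := G) (s := s)) := by
  intro α β e
  exact cast_injective rfl (one_smul G s) (eq_of_heq (OrbPi1.mk.inj e).2)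

theorem exists_ofLoop_eq {x : OrbPi1 G s} (hx : x.order = 1) : ∃ α, ofLoop α = x := by
  obtain ⟨g, α⟩ := x
  obtain rfl : g = 1 := hx
  exact ⟨α.cast rfl (one_smul G s).symm, congrArg (OrbPi1.mk 1)
    (cast_cast_symm rfl (one_smul G s).symm α)⟩

variable [ContinuousConstSMul G S]

/-- The order as a homomorphism. -/
def orderHom : OrbPi1 G s →* G where
  toFun := order
  map_one' := rfl
  map_mul' _ _ := rfl

theorem ofLoop_trans (α β : Path.Homotopic.Quotient s s) :
    ofLoop (G := G) (α.trans β) = ofLoop α * ofLoop β := by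
  refine ext_cast (one_mul 1).symm ?_
  change (α.trans β).cast rfl (one_smul G s) = ((α.cast rfl (one_smul G s)).trans
    ((translate 1 (β.cast rfl (one_smul G s))).cast rfl (mul_smul 1 1 s))).cast rfl _
  rw [one_translate]
  simp only [Path.Homotopic.Quotient.cast_cast]
  rw [cast_trans_cast_right]
  exact (Path.Homotopic.Quotient.cast_cast _ _ _ _ _).symm

end OrbPi1

namespace v4Complex

open SquareComplex OrbPi1

variable {Λ : Type} [Group Λ] {A B : Set Λ} (h : IsV4Structure A B)

/-- The element of `V₄` that maps `s₀₀` to `s_{ij}`. -/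
def shift (v : Bool × Bool) : V4 :=
  (if v.2 then .ofAdd 1 else 1, if v.1 then .ofAdd 1 else 1)

theorem shift_smul (v : Bool × Bool) : shift v • s00 h = pt h v := by
  rcases v with ⟨_ | _, _ | _⟩ <;> rfl

theorem shift_surjective : Function.Surjective shift := by decide

theorem shift_eq_one {v : Bool × Bool} : shift v = 1 → v = (false, false) := by
  revert v
  decide

/-- The element of the orbispace fundamental group of a path from `s₀₀` to `v`. -/
def ofPath (v : Bool × Bool) (γ : Path.Homotopic.Quotient (pt h (false, false)) (pt h v)) :
    OrbPi1 V4 (s00 h) := ⟨shift v, γ.cast rfl (shift_smul h v)⟩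

theorem ofPath_refl : ofPath h (false, false) (.refl _) = 1 := rfl

theorem ofPath_injective (v : Bool × Bool) : Function.Injective (ofPath h v) := by
  intro α β e
  exact cast_injective rfl (shift_smul h v) (eq_of_heq (OrbPi1.mk.inj e).2)

/-- `V₄` is simply transitive on the four vertices, so the order of an element is determined by the
end of its path. -/
theorem exists_ofPath_eq (ω : OrbPi1 V4 (s00 h)) : ∃ v γ, ofPath h v γ = ω := by
  obtain ⟨g, α⟩ := ω
  obtain ⟨v, rfl⟩ := shift_surjective g
  exact ⟨v, α.cast rfl (shift_smul h v).symm, congrArg (OrbPi1.mk (shift v))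
    (cast_cast_symm rfl (shift_smul h v).symm α)⟩

/-- By the product rule `[γ; g] x = [γ * g x; …]`, right multiplication continues a path by a
translate of the path of `x`. -/
theorem ofPath_trans {v w : Bool × Bool}
    (γ : Path.Homotopic.Quotient (pt h (false, false)) (pt h v)) (δ : Path (pt h v) (pt h w))
    (x : OrbPi1 V4 (s00 h)) (ε : Path (s00 h) (x.order • s00 h)) (hx : x.cls = .mk ε)
    (ho : shift w = shift v * x.order) (hδ : ∀ t, δ t = shift v • ε t) :
    ofPath h w (γ.trans (.mk δ)) = ofPath h v γ * x := by
  refine ext_cast ho ?_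
  change (γ.trans (.mk δ)).cast rfl (shift_smul h w) =
    ((γ.cast rfl (shift_smul h v)).trans
      ((translate (shift v) x.cls).cast rfl (mul_smul _ _ _))).cast rfl _
  have hw : shift v • x.order • s00 h = pt h w := by rw [← mul_smul, ← ho, shift_smul]
  have ht : translate (shift v) x.cls
      = (Path.Homotopic.Quotient.mk δ).cast (shift_smul h v) hw := by
    rw [hx]
    exact congrArg Path.Homotopic.Quotient.mk (Path.ext (funext fun t => (hδ t).symm))
  rw [ht]
  simp only [Path.Homotopic.Quotient.cast_cast]
  rw [cast_trans_cast_right]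
  exact (Path.Homotopic.Quotient.cast_cast _ _ _ _ _).symm

/-- Every vertical edge is a translate of an edge at `s₀₀`. For `r = true` the translation by `γ_v`
reverses the edge, which accounts for the inverse label. -/
theorem ofPath_trans_edgePath_v {i r : Bool}
    (γ : Path.Homotopic.Quotient (pt h (false, false)) (pt h (i, r))) (a : A) :
    ofPath h (i, !r) (γ.trans (.mk (edgePath (X := v4Complex h) (.v a i r))))
      = ofPath h (i, r) γ * α h (if r then invA h a else a) := by
  refine ofPath_trans h γ (edgePath (X := v4Complex h) (.v a i r)) _ _ rfl ?_ fun t => ?_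
  · exact (by decide : ∀ i r, shift (i, !r) = shift (i, r) * γv) i r
  · change onEdge h (.v a i r) t
      = shift (i, r) • onEdge h (.v (if r then invA h a else a) false false) t
    cases r
    · cases i <;> rfl
    · refine Eq.trans (b := onEdge h (.v (invA h (invA h a)) i true) t) ?_ ?_
      · rw [invA_invA]
      · cases i <;> rfl

theorem ofPath_trans_edgePath_h {j r : Bool}
    (γ : Path.Homotopic.Quotient (pt h (false, false)) (pt h (r, j))) (b : B) :
    ofPath h (!r, j) (γ.trans (.mk (edgePath (X := v4Complex h) (.h b j r))))
      = ofPath h (r, j) γ * β h (if r then invB h b else b) := by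
  refine ofPath_trans h γ (edgePath (X := v4Complex h) (.h b j r)) _ _ rfl ?_ fun t => ?_
  · exact (by decide : ∀ j r, shift (!r, j) = shift (r, j) * γh) j r
  · change onEdge h (.h b j r) t
      = shift (r, j) • onEdge h (.h (if r then invB h b else b) false false) t
    cases r
    · cases j <;> rfl
    · refine Eq.trans (b := onEdge h (.h (invB h (invB h b)) j true) t) ?_ ?_
      · rw [invB_invB]
      · cases j <;> rfl

theorem ofPath_edgePath_v (a : A) :
    ofPath h (false, true) (.mk (edgePath (X := v4Complex h) (.v a false false))) = α h a := rfl

theorem ofPath_edgePath_h (b : B) :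
    ofPath h (true, false) (.mk (edgePath (X := v4Complex h) (.h b false false))) = β h b := rfl

theorem α_mul_α_invA (a : A) : α h a * α h (invA h a) = 1 := by
  rw [← ofPath_edgePath_v]
  refine (ofPath_trans_edgePath_v h _ a).symm.trans ?_
  have : edgePath (X := v4Complex h) (.v a false true)
      = (edgePath (X := v4Complex h) (.v a false false)).symm :=
    Path.ext (funext fun t => onEdge_v h a false true t)
  rw [this]
  exact (congrArg (ofPath h (false, false)) (Path.Homotopic.Quotient.trans_symm _)).trans
    (ofPath_refl h)

theorem β_mul_β_invB (b : B) : β h b * β h (invB h b) = 1 := by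
  rw [← ofPath_edgePath_h]
  refine (ofPath_trans_edgePath_h h _ b).symm.trans ?_
  have : edgePath (X := v4Complex h) (.h b false true)
      = (edgePath (X := v4Complex h) (.h b false false)).symm :=
    Path.ext (funext fun t => onEdge_h h b false true t)
  rw [this]
  exact (congrArg (ofPath h (false, false)) (Path.Homotopic.Quotient.trans_symm _)).trans
    (ofPath_refl h)

/-- Both sides run from `s₀₀` to `s₁₁` along the boundary of the square. Each is the change of
vertex at the centre, which lies in all four stars. -/
theorem α_mul_β (s : V4Square A B) : α h s.left * β h s.top = β h s.bottom * α h s.right := by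
  have hl := ofPath_trans_edgePath_h (j := true) (r := false) h
    (.mk (edgePath (X := v4Complex h) (.v s.left false false))) s.top
  have hr := ofPath_trans_edgePath_v (i := true) (r := false) h
    (.mk (edgePath (X := v4Complex h) (.h s.bottom false false))) s.right
  have hm (v : Bool × Bool) : onSquare h s (half, half) ∈ openStar h v := by
    obtain ⟨i, j⟩ := v
    constructor <;> [cases j; cases i] <;> norm_num [fromEnd, half]
  have e1 := change_trans h (hm (false, false)) (hm (false, true)) (hm (true, true))
  have e2 := change_trans h (hm (false, false)) (hm (true, false)) (hm (true, true))
  rw [← e2] at e1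
  rw [change_onSquare_v h (hm (false, false)) (hm (false, true)),
    change_onSquare_h h (hm (false, true)) (hm (true, true)),
    change_onSquare_h h (hm (false, false)) (hm (true, false)),
    change_onSquare_v h (hm (true, false)) (hm (true, true))] at e1
  exact hl.symm.trans ((congrArg (ofPath h (true, true)) e1).trans hr)

section Hom

variable {Θ : Λ →* OrbPi1 V4 (s00 h)}

theorem IsEdgePath.ofPath_trans (hA : ∀ a : A, Θ a = α h a) (hB : ∀ b : B, Θ b = β h b)
    {v w : Bool × Bool} {δ : Path.Homotopic.Quotient (pt h v) (pt h w)} {k : Λ}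
      (hδ : IsEdgePath h v w δ k) :
    ∀ (γ : Path.Homotopic.Quotient (pt h (false, false)) (pt h v)) (g : Λ),
      ofPath h v γ = Θ g → ofPath h w (γ.trans δ) = Θ (g * k) := by
  induction hδ with
  | refl v =>
    intro γ g e
    rw [Path.Homotopic.Quotient.trans_refl, mul_one, e]
  | edge_v a i r =>
    intro γ g e
    rw [ofPath_trans_edgePath_v, e, map_mul, ← hA]
    cases r <;> rfl
  | edge_h b j r =>
    intro γ g e
    rw [ofPath_trans_edgePath_h, e, map_mul, ← hB]
    cases r <;> rfl
  | trans h1 h2 ih1 ih2 =>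
    intro γ g e
    rw [← Path.Homotopic.Quotient.trans_assoc, ← mul_assoc]
    exact ih2 _ _ (ih1 _ _ e)

/-- Every class is an edge path, and such a class is the image under `Θ` of the product of its
labels. -/
theorem surjective_of_hom (hA : ∀ a : A, Θ a = α h a) (hB : ∀ b : B, Θ b = β h b) :
    Function.Surjective Θ := by
  intro ω
  obtain ⟨v, γ, rfl⟩ := exists_ofPath_eq h ω
  obtain ⟨g, hg⟩ := exists_isEdgePath h γ
  have := hg.ofPath_trans h hA hB (.refl _) 1 ((ofPath_refl h).trans (map_one Θ).symm)
  rw [Path.Homotopic.Quotient.refl_trans] at this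
  exact ⟨_, this.symm⟩

/-- A word in the generators is read as an edge path from `s₀₀`: at each vertex there is exactly one
oriented edge on which a given letter can be read, in the backward direction with the inverse label.
-/
theorem exists_isEdgePath_ofPath_eq (hA : ∀ a : A, Θ a = α h a) (hB : ∀ b : B, Θ b = β h b)
    (g : Λ) :
    ∃ v γ, IsEdgePath h (false, false) v γ g ∧ ofPath h v γ = Θ g := by
  have hg : g ∈ Subgroup.closure (A ∪ B) := by
    rw [h.closure_union]
    trivial
  have step (g : Λ) (hg : ∃ v γ, IsEdgePath h (false, false) v γ g ∧ ofPath h v γ = Θ g) (y : Λ)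
      (hy : y ∈ A ∪ B) : ∃ v γ, IsEdgePath h (false, false) v γ (g * y) ∧
        ofPath h v γ = Θ (g * y) := by
    obtain ⟨⟨i, j⟩, γ, hγ, e⟩ := hg
    rcases hy with hy | hy
    · have hd := IsEdgePath.edge_v (h := h) (if j then invA h ⟨y, hy⟩ else ⟨y, hy⟩) i j
      have hl : label (A := A) (B := B) (.v (if j then invA h ⟨y, hy⟩ else ⟨y, hy⟩) i j) = y := by
        cases j
        · rfl
        · exact inv_inv y
      rw [hl] at hd
      exact ⟨_, _, hγ.trans hd, hd.ofPath_trans h hA hB γ g e⟩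
    · have hd := IsEdgePath.edge_h (h := h) (if i then invB h ⟨y, hy⟩ else ⟨y, hy⟩) j i
      have hl : label (A := A) (B := B) (.h (if i then invB h ⟨y, hy⟩ else ⟨y, hy⟩) j i) = y := by
        cases i
        · rfl
        · exact inv_inv y
      rw [hl] at hd
      exact ⟨_, _, hγ.trans hd, hd.ofPath_trans h hA hB γ g e⟩
  induction hg using Subgroup.closure_induction_right with
  | one => exact ⟨_, _, .refl _, (ofPath_refl h).trans (map_one Θ).symm⟩
  | mul_right g _ y hy ih => exact step g ih y hy
  | mul_inv_cancel g _ y hy ih =>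
    exact step g ih _ (hy.imp (h.inv_mem_left y) (h.inv_mem_right y))

/-- An element of the kernel is the label of an edge path that is homotopic to a constant path,
whose label is `1`. -/
theorem injective_of_hom (hA : ∀ a : A, Θ a = α h a) (hB : ∀ b : B, Θ b = β h b) :
    Function.Injective Θ := by
  refine (injective_iff_map_eq_one Θ).mpr fun g hg => ?_
  obtain ⟨v, γ, hγ, e⟩ := exists_isEdgePath_ofPath_eq h hA hB g
  rw [hg] at e
  obtain rfl : v = (false, false) := shift_eq_one (congrArg OrbPi1.order e)
  obtain rfl : γ = .refl _ := ofPath_injective h _ (e.trans (ofPath_refl h).symm)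
  exact hγ.unique h (.refl _)

end Hom

end v4Complex

/-! ### Identification of the fundamental groups with `Λ` and `Γ` -/

theorem lamRels_orbPi1 (h : IsV4Structure setA setB) :
    LamRels (v4Complex.α h ⟨b1L, .inl rfl⟩) (v4Complex.β h ⟨b2L, .inl rfl⟩)
      (v4Complex.α h ⟨c1L, .inr (.inr rfl)⟩) (v4Complex.β h ⟨c2L, .inr (.inr rfl)⟩) where
  cc₁ := by
    have := v4Complex.α_mul_α_invA h ⟨c1L, .inr (.inr rfl)⟩
    rwa [show v4Complex.invA h ⟨c1L, .inr (.inr rfl)⟩ = ⟨c1L, .inr (.inr rfl)⟩ from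
      Subtype.ext (inv_eq_of_mul_eq_one_left lamRels_Lam.cc₁)] at this
  cc₂ := by
    have := v4Complex.β_mul_β_invB h ⟨c2L, .inr (.inr rfl)⟩
    rwa [show v4Complex.invB h ⟨c2L, .inr (.inr rfl)⟩ = ⟨c2L, .inr (.inr rfl)⟩ from
      Subtype.ext (inv_eq_of_mul_eq_one_left lamRels_Lam.cc₂)] at this
  comm := v4Complex.α_mul_β h ⟨_, _, _, _, lamRels_Lam.comm⟩
  -- The square used is `b₁ b₂ = b₂⁻¹ c₁`; the following relation is the square `b₁ c₂ = b₂ b₁⁻¹`.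
  bcb := by
    rw [mul_assoc, ← eq_inv_mul_iff_mul_eq,
      inv_eq_of_mul_eq_one_right (v4Complex.β_mul_β_invB h ⟨b2L, .inl rfl⟩)]
    exact v4Complex.α_mul_β h ⟨_, _, v4Complex.invB h ⟨b2L, .inl rfl⟩, _,
      eq_inv_mul_of_mul_eq ((mul_assoc _ _ _).symm.trans lamRels_Lam.bcb)⟩
  bbc := by
    rw [← eq_mul_inv_iff_mul_eq,
      inv_eq_of_mul_eq_one_right (v4Complex.α_mul_α_invA h ⟨b1L, .inl rfl⟩)]
    exact v4Complex.α_mul_β h ⟨_, _, _, v4Complex.invA h ⟨b1L, .inl rfl⟩,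
      eq_mul_inv_of_mul_eq lamRels_Lam.bbc⟩

theorem exists_orbPi1_mulEquiv (h : IsV4Structure setA setB) :
    ∃ φ : OrbPi1 V4 (v4Complex.s00 h) ≃* Lam,
      (∀ a, φ (v4Complex.α h a) = a) ∧ (∀ b, φ (v4Complex.β h b) = b) ∧
      ∀ ω, φ ω ∈ Gam ↔ ω.order = 1 := by
  obtain ⟨Θ, hb1, hb2, hc1, hc2⟩ := exists_hom_of_lamRels (lamRels_orbPi1 h)
  have hA (a : setA) : Θ a = v4Complex.α h a := by
    obtain ⟨a, rfl | rfl | rfl⟩ := a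
    · exact hb1
    · change Θ b1L⁻¹ = _
      rw [map_inv, hb1]
      exact inv_eq_of_mul_eq_one_right (v4Complex.α_mul_α_invA h ⟨b1L, .inl rfl⟩)
    · exact hc1
  have hB (b : setB) : Θ b = v4Complex.β h b := by
    obtain ⟨b, rfl | rfl | rfl⟩ := b
    · exact hb2
    · change Θ b2L⁻¹ = _
      rw [map_inv, hb2]
      exact inv_eq_of_mul_eq_one_right (v4Complex.β_mul_β_invB h ⟨b2L, .inl rfl⟩)
    · exact hc2
  let Φ := MulEquiv.ofBijective Θ ⟨v4Complex.injective_of_hom h hA hB,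
    v4Complex.surjective_of_hom h hA hB⟩
  have horder (g : Lam) : (Θ g).order = delta g := by
    -- Orders correspond to `δ`, as a comparison on the generators shows. So trivial order means
    -- lying in the kernel `Γ`.
    have key : (OrbPi1.orderHom.comp Θ) = delta := by
      refine MonoidHom.ext fun g => ?_
      induction g using Lam_induction with
      | hb1 => exact (congrArg OrbPi1.order hb1).trans delta_b1.symm
      | hb2 => exact (congrArg OrbPi1.order hb2).trans delta_b2.symm
      | hc1 => exact (congrArg OrbPi1.order hc1).trans delta_c1.symm
      | hc2 => exact (congrArg OrbPi1.order hc2).trans delta_c2.symm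
      | hone => rw [map_one, map_one]
      | hmul g k ihg ihk => rw [map_mul, map_mul, ihg, ihk]
      | hinv g ih => rw [map_inv, map_inv, ih]
    exact DFunLike.congr_fun key g
  refine ⟨Φ.symm, fun a => ?_, fun b => ?_, fun ω => ?_⟩
  · rw [← hA]
    exact Φ.symm_apply_apply _
  · rw [← hB]
    exact Φ.symm_apply_apply _
  · rw [mem_Gam_iff, ← horder]
    change (Φ (Φ.symm ω)).order = 1 ↔ _
    rw [Φ.apply_symm_apply]

theorem exists_fundamentalGroup_mulEquiv (h : IsV4Structure setA setB)
    (φ : OrbPi1 V4 (v4Complex.s00 h) ≃* Lam) (hφ : ∀ ω, φ ω ∈ Gam ↔ ω.order = 1) :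
    ∃ ψ : FundamentalGroup (v4Complex h).Realization (v4Complex.s00 h) ≃* Gam,
      ∀ p, φ (OrbPi1.ofLoop (FundamentalGroup.toPath p⁻¹)) = ψ p := by
  let f : FundamentalGroup (v4Complex h).Realization (v4Complex.s00 h) →* Gam :=
    MonoidHom.mk' (fun p => ⟨φ (OrbPi1.ofLoop (FundamentalGroup.toPath p⁻¹)), (hφ _).mpr rfl⟩)
      fun p q => Subtype.ext <| by
        change φ (OrbPi1.ofLoop (FundamentalGroup.toPath (p * q)⁻¹)) =
          φ (OrbPi1.ofLoop (FundamentalGroup.toPath p⁻¹)) *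
            φ (OrbPi1.ofLoop (FundamentalGroup.toPath q⁻¹))
        -- The product in `FundamentalGroup` corresponds to concatenation in the opposite order; the
        -- inverse in the definition of `f` makes up for this.
        rw [← map_mul, ← OrbPi1.ofLoop_trans, mul_inv_rev]
        rfl
  refine ⟨MulEquiv.ofBijective f ⟨fun p q e => ?_, fun g => ?_⟩, fun p => rfl⟩
  · exact inv_injective (OrbPi1.ofLoop_injective (φ.injective (congrArg Subtype.val e)))
  · obtain ⟨α, hα⟩ := OrbPi1.exists_ofLoop_eq
      ((hφ (φ.symm g)).mp (by rw [φ.apply_symm_apply]; exact g.2))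
    refine ⟨(FundamentalGroup.fromPath α)⁻¹, Subtype.ext ?_⟩
    change φ (OrbPi1.ofLoop (FundamentalGroup.toPath (FundamentalGroup.fromPath α)⁻¹⁻¹)) = g
    rw [inv_inv]
    exact (congrArg φ hα).trans (φ.apply_symm_apply _)

end QuaternionLattice

end

theorem theoremA :
    -- The Bruhat–Tits graph is the 3-regular tree, and `PGL₂` acts on it by automorphisms.
    (BTTree.IsTree ∧ (∀ v, (BTTree.neighborSet v).ncard = 3) ∧
      ∀ (g : PGL(2, L)) (v w : BTVertex), BTTree.Adj (g • v) (g • w) ↔ BTTree.Adj v w) ∧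
    -- `Λ = G(R₁)`.
    Lam = GR1 ∧
    -- `Λ` is a cocompact lattice.
    (Function.Injective diag ∧ DiscreteTopology diag.range ∧
      CompactSpace ((PGL(2, L) × PGL(2, L)) ⧸ diag.range)) ∧
    -- The action on the vertices of `T₃ × T₃` is simply transitive.
    (∀ v w : BTVertex × BTVertex, ∃! g : Lam, btAct g v = w) ∧
    -- The presentation of `Λ`.
    (∃ e : PresentedGroup relsLam ≃* Lam,
      e (PresentedGroup.of 0) = b1L ∧ e (PresentedGroup.of 1) = b2L ∧
      e (PresentedGroup.of 2) = c1L ∧ e (PresentedGroup.of 3) = c2L) ∧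
    -- `(𝒜, ℬ)` is a `V₄`-structure of `Λ`; its square complex, and its two fundamental groups.
    (∃ h : IsV4Structure setA setB,
      Nat.card (v4Complex h).V = 4 ∧ Nat.card (v4Complex h).UnorientedEdge = 12 ∧
      Nat.card (v4Complex h).S = 9 ∧
      ∃ φ : OrbPi1 V4 (v4Complex.s00 h) ≃* Lam,
        (∀ a, φ (v4Complex.α h a) = a) ∧ (∀ b, φ (v4Complex.β h b) = b) ∧
        (∀ ω, φ ω ∈ Gam ↔ ω.order = 1) ∧
        ∃ ψ : FundamentalGroup (v4Complex h).Realization (v4Complex.s00 h) ≃* Gam,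
          ∀ p, φ (OrbPi1.ofLoop (FundamentalGroup.toPath p⁻¹)) = ψ p) ∧
    -- `Γ` is torsion-free and normal with quotient `V₄`, and its presentation.
    (∀ g : Gam, g ≠ 1 → ¬ IsOfFinOrder g) ∧
    (∃ _ : Gam.Normal, Nonempty (Lam ⧸ Gam ≃* V4)) ∧
    (∃ e : PresentedGroup relsGam ≃* Gam,
      e (PresentedGroup.of 0) = a1G ∧ e (PresentedGroup.of 1) = a2G) := by
  refine ⟨⟨btTree_isTree, ncard_neighborSet, fun g v w => pgl_adj_iff g v w⟩, Lam_eq_GR1,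
    ⟨diag_injective, discreteTopology_diag, compactSpace_quotient⟩, btAct_existsUnique,
    presentation_Lam, ⟨isV4Structure_Lam, v4Complex.card_V _, ?_, ?_, ?_⟩, torsionFree_Gam,
    normal_Gam, presentation_Gam⟩
  · rw [v4Complex.card_unorientedEdge, card_setA, card_setB]
  · rw [v4Complex.card_S, card_setA, card_setB]
  · obtain ⟨φ, hA, hB, hφ⟩ := exists_orbPi1_mulEquiv isV4Structure_Lam
    exact ⟨φ, hA, hB, hφ, exists_fundamentalGroup_mulEquiv isV4Structure_Lam φ hφ⟩
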